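/- **Setting.** Let $\gamma\in(-1,1)$, let $\mathbb D=\{|z|\le 1\}$ be the Euclidean unit disk with interior $\mathbb D^\circ$, metric $g=dx^2+dy^2$, $z=x+iy$, and $d(z)=1-|z|^2$. All functions and tensors are complex valued. Put $L^2_\gamma(\mathbb D)=L^2(\mathbb D,d^\gamma\,dx\,dy)$, and let $L^2_\gamma(\mathbb D;S^m(T^*\mathbb D))$ be the symmetric covariant $m$-tensor fields all of whose components lie in $L^2_\gamma(\mathbb D)$ (for $m=0$: $L^2_\gamma(\mathbb D)$). Let $H^{1,-\gamma}_0(\mathbb D)$ be the completion of $C_c^\infty(\mathbb D^\circ)$ for the norm $(\|u\|^2_{L^2_{-\gamma}}+\|\nabla u\|^2_{L^2_{-\gamma}})^{1/2}$, and $H^{1,-\gamma}_0(\mathbb D;S^m(T^*\mathbb D))$ the symmetric $m$-tensor fields with components in it. With $\sigma$ the symmetrization, let $d^s=\sigma\circ\nabla$, $Lv=\sigma(g\otimes v)$, and let $\star dx=dy$, $\star dy=-dx$. For $m\ge1$ put $$L^2_\gamma(\mathbb D;S^m_{tt}(T^*\mathbb D))=\{a\,dz^m+b\,d\bar z^m:\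 a,b\in L^2_\gamma(\mathbb D),\ a\text{ analytic and } b \text{ antianalytic on }\mathbb D^\circ\}.$$ For an $m$-tensor field $f$, $a\in\mathbb R$, $\beta\in\mathbb R/2\pi\mathbb Z$ and $\alpha\in[-\frac\pi2,\frac\pi2]$ let $$I_m d^a f(\beta,\alpha)=\int_0^{2\cos\alpha} f_{z(t)}(v,\dots,v)\,d(z(t))^a\,dt,\qquad z(t)=e^{i\beta}+te^{i\theta},\quad v=\cos\theta\,\partial_x+\sin\theta\,\partial_y,\quad \theta=\beta+\pi+\alpha,$$ and $I_m=I_md^0$. **Statement.** Let $m\ge 1$. Every $f\in L^2_\gamma(\mathbb D;S^m(T^*\mathbb D))$ decomposes uniquely in the form $$f=d^{-\gamma}d^s q+f^{itt},\qquad q\in H^{1,-\gamma}_0(\mathbb D;S^{m-1}(T^*\mathbb D)),$$ where $f^{itt}\in L^2_\gamma(\mathbb D;S^m(T^*\mathbb D))$ has the following form, its components $\tilde f_k$ and $h$ being unique as well. * If $m=2p$ with $p\ge1$, then $$f^{itt}=\sum_{j=0}^pL^{p-j}\tilde f_{2j},\qquad \tilde f_0\in L^2_\gamma(\mathbb D),\quad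 \tilde f_{2j}\in L^2_\gamma(\mathbb D;S^{2j}_{tt}(T^*\mathbb D))\ \ (1\le j\le p).$$ Moreover $I_{2p}d^\gamma f=I_{2p}d^\gamma f^{itt}=\sum_{j=0}^pI_{2j}d^\gamma\tilde f_{2j}$. * If $m=2p+1$ with $p\ge0$, then $$f^{itt}=L^p\big(d^{-\gamma}{\star dh}\big)+\sum_{j=0}^pL^{p-j}\tilde f_{2j+1},\qquad h\in H^{1,-\gamma}_0(\mathbb D),\quad \tilde f_{2j+1}\in L^2_\gamma(\mathbb D;S^{2j+1}_{tt}(T^*\mathbb D))\ \ (0\le j\le p).$$ Moreover $I_{2p+1}d^\gamma f=I_{2p+1}d^\gamma f^{itt}=I_1(\star dh)+\sum_{j=0}^pI_{2j+1}d^\gamma\tilde f_{2j+1}$. All these transforms are given by integrals that converge absolutely for almost every $(\beta,\alpha)$, and the identities between them hold for almost every $(\beta,\alpha)$. -/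

import Mathlib

open MeasureTheory

namespace WeightedXray

noncomputable section

/-! ### The disk, the weight and the weighted Lebesgue spaces -/

/-- The boundary defining function `d(z) = 1 - |z|²` of the unit disk. -/
def bdf (z : ℂ) : ℝ := 1 - ‖z‖ ^ 2

/-- The measure `d^γ |dz|²` on the unit disk. The boundary circle is a Lebesgue null set, so the
open disk may be used instead of the closed one. -/
def diskMeasure (γ : ℝ) : Measure ℂ :=
  (volume.restrict (Metric.ball (0 : ℂ) 1)).withDensity fun z => ENNReal.ofReal (bdf z ^ γ)

/-- The complex Hilbert space `L²_γ(𝔻) = L²(𝔻, d^γ |dz|²)`. -/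
abbrev L2 (γ : ℝ) : Type := Lp ℂ 2 (diskMeasure γ)

lemma bdf_pos {z : ℂ} (hz : z ∈ Metric.ball (0 : ℂ) 1) : 0 < bdf z := by
  have h1 : ‖z‖ < 1 := by simpa using hz
  have h0 := norm_nonneg z
  unfold bdf
  nlinarith

lemma measurable_bdf_rpow (γ : ℝ) : Measurable fun z : ℂ => bdf z ^ γ := by
  unfold bdf
  fun_prop

lemma diskMeasure_ac (γ δ : ℝ) : diskMeasure γ ≪ diskMeasure δ := by
  refine (withDensity_absolutelyContinuous _ _).trans ?_
  refine withDensity_absolutelyContinuous' (measurable_bdf_rpow δ).ennreal_ofReal.aemeasurable ?_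
  refine (ae_restrict_mem Metric.isOpen_ball.measurableSet).mono fun z hz => ?_
  simpa using Real.rpow_pos_of_pos (bdf_pos hz) δ

lemma memLp_weight_mul (γ : ℝ) (u : L2 (-γ)) :
    MemLp (fun z => ((bdf z ^ (-γ) : ℝ) : ℂ) * u z) 2 (diskMeasure γ) := by
  have hu := Lp.memLp u
  have hm : AEStronglyMeasurable (fun z => ((bdf z ^ (-γ) : ℝ) : ℂ) * u z) (diskMeasure γ) :=
    (Complex.measurable_ofReal.comp (measurable_bdf_rpow (-γ))).aestronglyMeasurable.mul
      (hu.1.mono_ac (diskMeasure_ac γ (-γ)))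
  refine ⟨hm, ?_⟩
  have h2 := hu.2
  rw [eLpNorm_lt_top_iff_lintegral_rpow_enorm_lt_top (by norm_num) (by norm_num)] at h2 ⊢
  have hae : ∀ δ : ℝ, ∀ᵐ z ∂(volume.restrict (Metric.ball (0 : ℂ) 1)),
      ENNReal.ofReal (bdf z ^ δ) < ⊤ := fun δ => by simp
  unfold diskMeasure at h2 ⊢
  rw [lintegral_withDensity_eq_lintegral_mul_non_measurable₀ _
    (measurable_bdf_rpow _).ennreal_ofReal.aemeasurable (hae _)] at h2 ⊢
  refine lt_of_le_of_lt (le_of_eq ?_) h2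
  refine setLIntegral_congr_fun Metric.isOpen_ball.measurableSet fun z hz => ?_
  have hp := bdf_pos hz
  have hn : (0 : ℝ) ≤ bdf z ^ (-γ) := (Real.rpow_pos_of_pos hp _).le
  have he : ‖((bdf z ^ (-γ) : ℝ) : ℂ)‖ₑ = ENNReal.ofReal (bdf z ^ (-γ)) := by
    rw [← ofReal_norm, Complex.norm_real, Real.norm_of_nonneg hn]
  have hw : ENNReal.ofReal (bdf z ^ γ) * ENNReal.ofReal (bdf z ^ (-γ)) = 1 := by
    rw [← ENNReal.ofReal_mul (Real.rpow_pos_of_pos hp _).le, ← Real.rpow_add hp]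
    simp
  have key : ∀ a b c : ENNReal, a * b = 1 → a * (b ^ 2 * c) = b * c := fun a b c hab => by
    calc a * (b ^ 2 * c) = (a * b) * (b * c) := by ring
      _ = b * c := by rw [hab, one_mul]
  simp only [Pi.mul_apply, enorm_mul, he, ENNReal.toReal_ofNat, ENNReal.rpow_two, mul_pow]
  exact key _ _ _ hw

/-- Multiplication by `d^{-γ}`, from `L²_{-γ}(𝔻)` to `L²_γ(𝔻)`. -/
def weightMul (γ : ℝ) (u : L2 (-γ)) : L2 γ := (memLp_weight_mul γ u).toLp _

/-- `L²_γ(𝔻) ∩ ker ∂̄`: the `L²_γ` functions that are analytic on the open disk. -/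
def IsAnalytic {γ : ℝ} (u : L2 γ) : Prop :=
  ∃ g : ℂ → ℂ, DifferentiableOn ℂ g (Metric.ball 0 1) ∧ u =ᵐ[diskMeasure γ] g

/-- `L²_γ(𝔻) ∩ ker ∂`: the `L²_γ` functions that are antianalytic on the open disk. -/
def IsAntianalytic {γ : ℝ} (u : L2 γ) : Prop :=
  ∃ g : ℂ → ℂ, DifferentiableOn ℂ g (Metric.ball 0 1) ∧
    u =ᵐ[diskMeasure γ] fun z => (starRingEnd ℂ) (g z)

/-! ### The spaces `H₀^{1,γ}` -/

/-- The coordinate vectors `∂_x`, `∂_y` of the plane, as complex numbers. -/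
def coordVec (i : Fin 2) : ℂ := ![1, Complex.I] i

/-- The pairs `(φ, (∂_x φ, ∂_y φ))` with `φ ∈ C_c^∞` of the open disk, inside `L²_γ × (L²_γ)²`. -/
def testPairs (γ : ℝ) : Submodule ℂ (L2 γ × (Fin 2 → L2 γ)) where
  carrier := {w | ∃ φ : ℂ → ℂ, ContDiff ℝ (⊤ : ℕ∞) φ ∧ HasCompactSupport φ ∧
    tsupport φ ⊆ Metric.ball 0 1 ∧ w.1 =ᵐ[diskMeasure γ] φ ∧
    ∀ i, w.2 i =ᵐ[diskMeasure γ] fun z => fderiv ℝ φ z (coordVec i)}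
  zero_mem' := by
    refine ⟨0, contDiff_const, HasCompactSupport.zero, by simp [tsupport], ?_, fun i => ?_⟩
    · exact Lp.coeFn_zero ℂ 2 (diskMeasure γ)
    · simpa [Pi.zero_def] using Lp.coeFn_zero ℂ 2 (diskMeasure γ)
  add_mem' := by
    rintro a b ⟨φ, hφ, hcφ, hsφ, h1, h2⟩ ⟨ψ, hψ, hcψ, hsψ, h3, h4⟩
    refine ⟨φ + ψ, hφ.add hψ, hcφ.add hcψ,
      (tsupport_add φ ψ).trans (Set.union_subset hsφ hsψ), ?_, fun i => ?_⟩
    · exact (Lp.coeFn_add a.1 b.1).trans (h1.add h3)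
    · refine (Lp.coeFn_add (a.2 i) (b.2 i)).trans (((h2 i).add (h4 i)).trans (.of_forall ?_))
      intro z
      simp [fderiv_add (hφ.differentiable (by simp) z) (hψ.differentiable (by simp) z)]
  smul_mem' := by
    rintro c a ⟨φ, hφ, hcφ, hsφ, h1, h2⟩
    refine ⟨c • φ, hφ.const_smul c, hcφ.smul_left (f := fun _ => c),
      (closure_mono (Function.support_const_smul_subset c φ)).trans hsφ, ?_, fun i => ?_⟩
    · exact (Lp.coeFn_smul c a.1).trans (h1.const_smul c)
    · refine (Lp.coeFn_smul c (a.2 i)).trans (((h2 i).const_smul c).trans (.of_forall ?_))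
      intro z
      simp [fderiv_const_smul (hφ.differentiable (by simp) z)]

/-- `H₀^{1,γ}(𝔻)`: the completion of `C_c^∞` of the open disk for the norm
`(‖u‖² + ‖∇u‖²)^{1/2}` of `L²_γ`, realized as the closure of the pairs `(φ, ∇φ)` in the Hilbert
space `L²_γ × (L²_γ)²`. An element is a function together with its gradient. -/
def H01 (γ : ℝ) : Submodule ℂ (L2 γ × (Fin 2 → L2 γ)) := (testPairs γ).topologicalClosure

/-- The partial derivatives `∂_x u` (`i = 0`) and `∂_y u` (`i = 1`) of `u ∈ H₀^{1,γ}`. -/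
def H01.pderiv {γ : ℝ} (i : Fin 2) (u : H01 γ) : L2 γ := u.1.2 i

/-! ### Symmetric covariant tensors

A covariant tensor field of rank `m` on the disk is given by its components
`T_{i₁…i_m}` in the global coframe `dx` (index `0`), `dy` (index `1`), with entries in a space `V`
of complex functions. -/

section Tensors

variable {V : Type*} [AddCommGroup V] [Module ℂ V]

/-- Symmetric tensors of rank `m`, all of whose components belong to `V`. -/
def SymTensor (m : ℕ) (V : Type*) [AddCommGroup V] [Module ℂ V] :
    Submodule ℂ ((Fin m → Fin 2) → V) where
  carrier := {T | ∀ (π : Equiv.Perm (Fin m)) (I : Fin m → Fin 2), T (I ∘ π) = T I}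
  zero_mem' := fun _ _ => rfl
  add_mem' := fun ha hb π I => by simp [ha π I, hb π I]
  smul_mem' := fun c _ ha π I => by simp [ha π I]

/-- The symmetrization operator `σ`. -/
def symmetrize {m : ℕ} (T : (Fin m → Fin 2) → V) : SymTensor m V :=
  ⟨fun I => ((m.factorial : ℂ)⁻¹) • ∑ π : Equiv.Perm (Fin m), T (I ∘ π), by
    intro ρ I
    refine congrArg (((m.factorial : ℂ)⁻¹) • ·) ?_
    exact Fintype.sum_equiv (Equiv.mulLeft ρ) (fun π => T ((I ∘ ρ) ∘ π)) (fun π => T (I ∘ π))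
      fun π => rfl⟩

/-- The operator `L v = σ(g ⊗ v)` with `g = dx² + dy²`. -/
def metricMul {m : ℕ} (v : SymTensor m V) : SymTensor (m + 2) V :=
  symmetrize fun I => (if I 0 = I 1 then (1 : ℂ) else 0) • v.1 fun k => I k.succ.succ

/-- The iterates `L^k`. -/
def metricMulPow {m : ℕ} (v : SymTensor m V) : (k : ℕ) → SymTensor (m + 2 * k) V
  | 0 => v
  | k + 1 => metricMul (metricMulPow v k)

/-- Transport of a tensor along an equality of ranks (the components are unchanged). -/
def SymTensor.cast {m n : ℕ} (h : m = n) (v : SymTensor m V) : SymTensor n V :=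
  ⟨fun I => v.1 fun k => I (Fin.cast h k), by
    subst h
    exact v.2⟩

end Tensors

/-- `L²_γ(𝔻; S^m(T^*𝔻))`; for `m = 0` this is `L²_γ(𝔻)`. -/
abbrev TensorL2 (γ : ℝ) (m : ℕ) : Type := SymTensor m (L2 γ)

/-- `H₀^{1,γ}(𝔻; S^m(T^*𝔻))`. -/
abbrev TensorH01 (γ : ℝ) (m : ℕ) : Type := SymTensor m (H01 γ)

/-- The inner derivative `d^s = σ ∘ ∇`, with `(∇q)_{i j₁…j_m} = ∂_i q_{j₁…j_m}`. -/
def innerDeriv {γ : ℝ} {m : ℕ} (q : TensorH01 γ m) : TensorL2 γ (m + 1) :=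
  symmetrize fun I => H01.pderiv (I 0) (q.1 fun k => I k.succ)

/-- The one-form `⋆dh`, where `⋆dx = dy` and `⋆dy = -dx`. -/
def starDeriv {γ : ℝ} (h : H01 γ) : TensorL2 γ 1 :=
  ⟨fun I => ![-H01.pderiv 1 h, H01.pderiv 0 h] (I 0), by
    intro π I
    rw [Subsingleton.elim π 1]
    rfl⟩

/-- Multiplication of tensors by `d^{-γ}`. -/
def tensorWeightMul (γ : ℝ) {m : ℕ} (T : TensorL2 (-γ) m) : TensorL2 γ m :=
  ⟨fun I => weightMul γ (T.1 I), fun π I => congrArg (weightMul γ) (T.2 π I)⟩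

/-- The space `L²_γ(𝔻; S_tt^m(T^*𝔻))` (for `m ≥ 1`) of the tensors `a dz^m + b dz̄^m` with
`a ∈ L²_γ ∩ ker ∂̄` and `b ∈ L²_γ ∩ ker ∂`; note `dz = dx + i dy`, `dz̄ = dx - i dy`. -/
def IsTT {γ : ℝ} {m : ℕ} (T : TensorL2 γ m) : Prop :=
  ∃ a b : L2 γ, IsAnalytic a ∧ IsAntianalytic b ∧
    ∀ I, T.1 I = (∏ k, coordVec (I k)) • a + (∏ k, (starRingEnd ℂ) (coordVec (I k))) • b

/-! ### The weighted X-ray transform -/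

/-- `ℓ_m f (z, θ) = f_z(v, …, v)` with `v = cos θ ∂_x + sin θ ∂_y`. -/
def ell {γ : ℝ} {m : ℕ} (f : TensorL2 γ m) (z : ℂ) (θ : ℝ) : ℂ :=
  ∑ I : Fin m → Fin 2, f.1 I z * ∏ k, ((![Real.cos θ, Real.sin θ] (I k) : ℝ) : ℂ)

/-- The geodesic `z_{β,α}(t) = e^{iβ} + t e^{i(β+π+α)}`. -/
def chord (β α t : ℝ) : ℂ :=
  Complex.exp (β * Complex.I) + t * Complex.exp ((β + Real.pi + α : ℝ) * Complex.I)

/-- The integrand of `I_m d^a f` along the geodesic with fan-beam coordinates `(β, α)`. -/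
def xrayIntegrand (a : ℝ) {γ : ℝ} {m : ℕ} (f : TensorL2 γ m) (β α t : ℝ) : ℂ :=
  ell f (chord β α t) (β + Real.pi + α) * ((bdf (chord β α t) ^ a : ℝ) : ℂ)

/-- The X-ray transform `I_m d^a f (β, α)`, an integral over `t ∈ [0, 2 cos α]`.
The unweighted transform `I_m` is the case `a = 0`. -/
def xray (a : ℝ) {γ : ℝ} {m : ℕ} (f : TensorL2 γ m) (w : ℝ × ℝ) : ℂ :=
  ∫ t in (0 : ℝ)..(2 * Real.cos w.2), xrayIntegrand a f w.1 w.2 t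

/-- The measure `μ^{-2γ} dβ dα`, `μ = cos α`, on the inward boundary
`∂₊S𝔻 = (ℝ/2πℤ) × [-π/2, π/2]` in fan-beam coordinates. -/
def fanMeasure (γ : ℝ) : Measure (ℝ × ℝ) :=
  (volume.restrict (Set.Ioc 0 (2 * Real.pi) ×ˢ Set.Icc (-(Real.pi / 2)) (Real.pi / 2))).withDensity
    fun w => ENNReal.ofReal (Real.cos w.2 ^ (-2 * γ))

/-- For almost every geodesic the integral defining `I_m d^a f` converges absolutely. -/
def XrayConverges (a : ℝ) {γ : ℝ} {m : ℕ} (f : TensorL2 γ m) : Prop :=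
  ∀ᵐ w ∂(fanMeasure γ), IntervalIntegrable (xrayIntegrand a f w.1 w.2) volume 0 (2 * Real.cos w.2)

/-! ### Iterated-tt tensors -/

/-- `f^{itt} = ∑_{j=0}^p L^{p-j} f̃_{2j}`, of rank `2p`. -/
def ittEven {γ : ℝ} (p : ℕ) (ft : (j : Fin (p + 1)) → TensorL2 γ (2 * j)) : TensorL2 γ (2 * p) :=
  ∑ j : Fin (p + 1), SymTensor.cast (by omega) (metricMulPow (ft j) (p - j))

/-- `f^{itt} = L^p (d^{-γ} ⋆dh) + ∑_{j=0}^p L^{p-j} f̃_{2j+1}`, of rank `2p+1`. -/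
def ittOdd {γ : ℝ} (p : ℕ) (h : H01 (-γ)) (ft : (j : Fin (p + 1)) → TensorL2 γ (2 * j + 1)) :
    TensorL2 γ (2 * p + 1) :=
  SymTensor.cast (by omega) (metricMulPow (tensorWeightMul γ (starDeriv h)) p) +
    ∑ j : Fin (p + 1), SymTensor.cast (by omega) (metricMulPow (ft j) (p - j))

/-- `f = d^{-γ} d^s q + f^{itt}` for a tensor of rank `2p`, where `f^{itt}` is built from
`f̃_0 ∈ L²_γ(𝔻)` and the tt tensors `f̃_{2j}`, `1 ≤ j ≤ p`. -/
def IsDecompEven {γ : ℝ} {p : ℕ} (hp : 1 ≤ p) (f : TensorL2 γ (2 * p))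
    (q : TensorH01 (-γ) (2 * p - 1)) (ft : (j : Fin (p + 1)) → TensorL2 γ (2 * j)) : Prop :=
  (∀ j : Fin (p + 1), 1 ≤ (j : ℕ) → IsTT (ft j)) ∧
    f = SymTensor.cast (by omega) (tensorWeightMul γ (innerDeriv q)) + ittEven p ft

/-- `f = d^{-γ} d^s q + f^{itt}` for a tensor of rank `2p+1`, where `f^{itt}` is built from
`h ∈ H₀^{1,-γ}(𝔻)` and the tt tensors `f̃_{2j+1}`, `0 ≤ j ≤ p`. -/
def IsDecompOdd {γ : ℝ} {p : ℕ} (f : TensorL2 γ (2 * p + 1)) (q : TensorH01 (-γ) (2 * p))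
    (h : H01 (-γ)) (ft : (j : Fin (p + 1)) → TensorL2 γ (2 * j + 1)) : Prop :=
  (∀ j : Fin (p + 1), IsTT (ft j)) ∧
    f = tensorWeightMul γ (innerDeriv q) + ittOdd p h ft

end

end WeightedXray

open WeightedXray

/-!
# Decomposition of tensor fields for the weighted X-ray transform on the disk

In the coframe `dz`, `dz̄` a symmetric `m`-tensor field is a list of `m + 1` functions `f_k`, the
coefficients of `dz^k dz̄^(m-k)`. In these components `L` is a shift by one place
(`comp_metricMulPow`), `d^s q` has components `∂q_{k-1} + ∂̄q_k` (`comp_innerDeriv`), and a tt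
tensor only has its two extreme components, one analytic and one antianalytic (`isTT_iff`). Hence
`L^{p-j} f̃_{2j}` occupies the components `p - j` and `p + j` of a tensor of rank `2p`, and
`f = d^{-γ} d^s q + f^{itt}` is a system in which, going inwards from either end, each equation
contains one new component of `q`: it reads `g = d^{-γ} ∂u + a` with `a` analytic in the upper
half and `g = d^{-γ} ∂̄u + b` with `b` antianalytic in the lower half. In even rank the middle
equation is left over for `f̃_0`. In odd rank `2p + 1` both halves reach the middle component `q_p`
and prescribe `q_p - ih` and `q_p + ih` there, which determines `q_p` and `h`.

The system is therefore uniquely solvable once `L²_γ = d^{-γ} ∂ H₀^{1,-γ} ⊕ (L²_γ ∩ ker ∂̄)`, and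
the same with `∂` and `∂̄` exchanged (`exists_sub_mem_kerSpace`,
`eq_zero_of_weightedD_mem_kerSpace`). The range of `d^{-γ} ∂` is closed and `∂` is injective by an
a priori estimate (`exists_norm_le_wirtingerL`): for test functions, integration by parts gives an
identity for `‖∂u‖² - ‖∂̄u‖²` in terms of the angular derivative of `u` with the weight `d^{-γ-1}`,
and a Hardy inequality controls `u` and that angular term by `∂u`; here `γ > -1` is used. The
orthogonal complement of the range consists of the weak solutions of `∂̄a = 0`, because the weights
cancel in the pairing; by Weyl's lemma (`exists_analytic_of_weak`) these are the analytic
functions in `L²_γ`. That such functions are integrable uses `γ < 1`.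

For the X-ray transform, `L²_γ` embeds into `L¹(d^γ)` because `d^γ` has finite mass, and the lines
of each direction foliate the plane, so by Fubini the integrals converge along almost every line
of each direction, and depend continuously on the function in the `L¹` sense. Along a line of
direction `v` the integrand for `d^{-γ} d^s q` is the derivative of `q(v, …, v)`; its integral
vanishes for test functions and hence, by density, for `q ∈ H₀^{1,-γ}` (`xray_innerDeriv`). The
operator `L` multiplies the integrand by `|v|² = 1`, which yields the formulas for `f^{itt}`.
Statements on almost every line of each direction pass to almost every geodesic in fan-beam
coordinates by `ae_fanMeasure`.
-/

namespace WeightedXray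

noncomputable section

/-! ### Symmetric tensors as binary forms in `dz`, `dz̄` -/

section Components

variable {V W : Type*} [AddCommGroup V] [AddCommGroup W]

/-- The sequence `0, c 0, c 1, …`: multiplication of a binary form by `dz`. -/
def shift (c : ℕ → V) : ℕ → V
  | 0 => 0
  | k + 1 => c k

@[simp] lemma shift_zero (c : ℕ → V) : shift c 0 = 0 := rfl
@[simp] lemma shift_succ (c : ℕ → V) (k : ℕ) : shift c (k + 1) = c k := rfl

variable [Module ℂ V] [Module ℂ W]

/-- The value of the covariant tensor `T` on the constant family of vectors `v, …, v ∈ ℂ²`. -/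
def polyEval {m : ℕ} (T : (Fin m → Fin 2) → V) (v : Fin 2 → ℂ) : V :=
  ∑ I : Fin m → Fin 2, (∏ k, v (I k)) • T I

/-- The value of `dz` on the complexified vector `v`. -/
def dzVal (v : Fin 2 → ℂ) : ℂ := v 0 + Complex.I * v 1

/-- The value of `dz̄` on the complexified vector `v`. -/
def dzbarVal (v : Fin 2 → ℂ) : ℂ := v 0 - Complex.I * v 1

lemma exists_dzVal (a b : ℂ) : ∃ v, dzVal v = a ∧ dzbarVal v = b := by
  refine ⟨![(a + b) / 2, (a - b) / (2 * Complex.I)], ?_, ?_⟩ <;>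
  · have := Complex.I_ne_zero
    simp only [dzVal, dzbarVal, Matrix.cons_val_zero, Matrix.cons_val_one]
    field_simp
    ring

/-- The components of `σ T` in the coframe `dz, dz̄`: the `k`-th one is the coefficient of
`dz^k dz̄^(m-k)`. It is defined by expanding `dx = (dz + dz̄)/2` and `dy = (dz - dz̄)/(2i)` in
one slot after the other, and vanishes for `k > m`. -/
def comp : {m : ℕ} → ((Fin m → Fin 2) → V) → ℕ → V
  | 0, T => fun k => if k = 0 then T default else 0
  | _ + 1, T => fun k =>
      shift (fun l => (1 / 2 : ℂ) • (comp (fun J => T (Fin.cons 0 J)) l -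
        Complex.I • comp (fun J => T (Fin.cons 1 J)) l)) k +
      (1 / 2 : ℂ) • (comp (fun J => T (Fin.cons 0 J)) k +
        Complex.I • comp (fun J => T (Fin.cons 1 J)) k)

lemma comp_of_lt {m : ℕ} (T : (Fin m → Fin 2) → V) {k : ℕ} (hk : m < k) : comp T k = 0 := by
  induction m generalizing k with
  | zero => simp [comp, hk.ne']
  | succ m ih =>
    obtain ⟨k, rfl⟩ : ∃ l, k = l + 1 := ⟨k - 1, by omega⟩
    simp [comp, ih _ (show m < k by omega), ih _ (show m < k + 1 by omega)]

lemma polyEval_succ {m : ℕ} (T : (Fin (m + 1) → Fin 2) → V) (v : Fin 2 → ℂ) :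
    polyEval T v = v 0 • polyEval (fun J => T (Fin.cons 0 J)) v +
      v 1 • polyEval (fun J => T (Fin.cons 1 J)) v := by
  unfold polyEval
  rw [← (Fin.consEquiv fun _ => Fin 2).sum_comp, Fintype.sum_prod_type, Fin.sum_univ_two]
  simp [Fin.prod_univ_succ, Finset.smul_sum, mul_smul, Fin.consEquiv]

/-- A tensor evaluated on `v, …, v` is the binary form in `dz(v)`, `dz̄(v)` with coefficients
`comp T`. -/
lemma polyEval_eq_comp {m : ℕ} (T : (Fin m → Fin 2) → V) (v : Fin 2 → ℂ) :
    polyEval T v = ∑ k ∈ Finset.range (m + 1), (dzVal v ^ k * dzbarVal v ^ (m - k)) • comp T k := by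
  induction m with
  | zero =>
    simp only [polyEval, comp]
    simp
    exact congrArg T (Subsingleton.elim _ _)
  | succ m ih =>
    rw [polyEval_succ, ih, ih]
    set A := comp fun J => T (Fin.cons 0 J) with hA
    set B := comp fun J => T (Fin.cons 1 J) with hB
    have hc : ∀ k, comp T k = shift (fun l => (1 / 2 : ℂ) • (A l - Complex.I • B l)) k +
      (1 / 2 : ℂ) • (A k + Complex.I • B k) := fun k => rfl
    simp only [hc, smul_add, Finset.sum_add_distrib]
    have hA0 : A (m + 1) = 0 := comp_of_lt _ (Nat.lt_succ_self m)
    have hB0 : B (m + 1) = 0 := comp_of_lt _ (Nat.lt_succ_self m)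
    rw [Finset.sum_range_succ' _ (m + 1)]
    simp only [Finset.sum_range_succ _ (m + 1), hA0, hB0]
    simp only [shift_zero, shift_succ, smul_zero, add_zero, Finset.smul_sum,
      ← Finset.sum_add_distrib]
    refine Finset.sum_congr rfl fun k hk => ?_
    have hkm : m + 1 - k = (m - k) + 1 := by
      have := Finset.mem_range.1 hk
      omega
    rw [Nat.add_sub_add_right, hkm]
    have h0 : v 0 = (dzVal v + dzbarVal v) / 2 := by simp only [dzVal, dzbarVal]; ring
    have h1 : v 1 = -Complex.I * (dzVal v - dzbarVal v) / 2 := by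
      simp only [dzVal, dzbarVal]
      linear_combination v 1 * Complex.I_sq
    rw [h0, h1]
    generalize dzVal v = a
    generalize dzbarVal v = b
    module

lemma eq_zero_of_forall_sum_pow_smul {n : ℕ} {c : ℕ → V}
    (h : ∀ x : ℂ, ∑ k ∈ Finset.range n, x ^ k • c k = 0) {k : ℕ} (hk : k < n) : c k = 0 := by
  rw [← Module.forall_dual_apply_eq_zero_iff ℂ]
  intro φ
  have hp : (∑ k ∈ Finset.range n, Polynomial.monomial k (φ (c k))) = 0 := by
    refine Polynomial.funext fun x => ?_
    have := congrArg φ (h x)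
    simpa [Polynomial.eval_finsetSum, mul_comm] using this
  have := congrArg (fun p => Polynomial.coeff p k) hp
  simpa [Polynomial.finsetSum_coeff, Polynomial.coeff_monomial, hk] using this

lemma comp_eq_of_polyEval {m : ℕ} {T : (Fin m → Fin 2) → V} {c : ℕ → V}
    (h : ∀ v, polyEval T v =
      ∑ k ∈ Finset.range (m + 1), (dzVal v ^ k * dzbarVal v ^ (m - k)) • c k)
    {k : ℕ} (hk : k ≤ m) : comp T k = c k := by
  rw [← sub_eq_zero]
  refine eq_zero_of_forall_sum_pow_smul (c := fun k => comp T k - c k) (n := m + 1) (fun x => ?_)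
    (by omega)
  obtain ⟨v, hv, hv'⟩ := exists_dzVal x 1
  have := (polyEval_eq_comp T v).symm.trans (h v)
  simpa [hv, hv', smul_sub, sub_eq_zero] using this

lemma comp_congr_of_polyEval {m : ℕ} {S T : (Fin m → Fin 2) → V}
    (h : ∀ v, polyEval S v = polyEval T v) : comp S = comp T := by
  ext k
  rcases le_or_gt k m with hk | hk
  · exact comp_eq_of_polyEval (fun v => (h v).trans (polyEval_eq_comp T v)) hk
  · rw [comp_of_lt _ hk, comp_of_lt _ hk]

lemma polyEval_symmetrize {m : ℕ} (T : (Fin m → Fin 2) → V) (v : Fin 2 → ℂ) :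
    polyEval (symmetrize T).1 v = polyEval T v := by
  have h : ∀ π : Equiv.Perm (Fin m),
      ∑ I : Fin m → Fin 2, (∏ k, v (I k)) • T (I ∘ π) = polyEval T v := fun π => by
    refine Fintype.sum_equiv (Equiv.arrowCongr π.symm (Equiv.refl _)) _ _ fun I => ?_
    congr 1
    exact (Equiv.prod_comp π fun k => v (I k)).symm
  simp only [polyEval, symmetrize, Finset.smul_sum]
  rw [Finset.sum_comm]
  simp only [smul_comm _ ((m.factorial : ℂ)⁻¹), ← Finset.smul_sum]
  rw [Finset.smul_sum, Finset.sum_congr rfl fun π _ => congrArg _ (h π)]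
  have hf : (m.factorial : ℂ) ≠ 0 := Nat.cast_ne_zero.2 m.factorial_ne_zero
  rw [Finset.sum_const, Finset.card_univ, Fintype.card_perm, Fintype.card_fin,
    ← Nat.cast_smul_eq_nsmul ℂ, smul_smul, mul_inv_cancel₀ hf, one_smul, polyEval]

lemma comp_symmetrize {m : ℕ} (T : (Fin m → Fin 2) → V) : comp (symmetrize T).1 = comp T :=
  comp_congr_of_polyEval (polyEval_symmetrize T)

/-- A symmetric tensor is determined by its `dz, dz̄` components. -/
lemma SymTensor.ext_comp {m : ℕ} {S T : SymTensor m V} (h : ∀ k ≤ m, comp S.1 k = comp T.1 k) :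
    S = T := by
  have hev : ∀ v, polyEval S.1 v = polyEval T.1 v := fun v => by
    rw [polyEval_eq_comp, polyEval_eq_comp]
    refine Finset.sum_congr rfl fun k hk => ?_
    rw [h k (Nat.lt_succ_iff.1 (Finset.mem_range.1 hk))]
  -- `ones I` counts the slots in which the multi-index `I` has the value `1`.
  let ones : (Fin m → Fin 2) → ℕ := fun I => (Finset.univ.filter fun k => I k = 1).card
  have hones : ∀ I, ones I ∈ Finset.range (m + 1) := fun I => by
    have := Finset.card_filter_le (Finset.univ : Finset (Fin m)) fun k => I k = 1
    rw [Finset.card_univ, Fintype.card_fin] at this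
    exact Finset.mem_range.2 (Nat.lt_succ_of_le this)
  have hperm : ∀ I J : Fin m → Fin 2, ones I = ones J →
      ∃ π : Equiv.Perm (Fin m), I = J ∘ π := fun I J hIJ => by
    have e : {k // I k = 1} ≃ {k // J k = 1} := Fintype.equivOfCardEq (by
      rw [Fintype.card_subtype, Fintype.card_subtype]
      exact hIJ)
    refine ⟨e.extendSubtype, funext fun k => ?_⟩
    by_cases hk : I k = 1
    · exact hk.trans (e.extendSubtype_mem k hk).symm
    · have h1 := e.extendSubtype_not_mem k hk
      simp only [Function.comp_apply]
      omega
  refine Subtype.ext (funext fun I => ?_)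
  -- evaluation at `(1, x)` groups the multi-indices by the number of ones
  have hsum : ∀ x : ℂ, ∑ k ∈ Finset.range (m + 1), x ^ k •
      (∑ J ∈ Finset.univ.filter fun J => ones J = k, (S.1 J - T.1 J)) = 0 := fun x => by
    have := hev ![1, x]
    rw [← sub_eq_zero, polyEval, polyEval, ← Finset.sum_sub_distrib] at this
    rw [← this, ← Finset.sum_fiberwise_of_maps_to (t := Finset.range (m + 1)) (g := ones)
      fun J _ => hones J]
    refine Finset.sum_congr rfl fun k _ => ?_
    rw [Finset.smul_sum]
    refine Finset.sum_congr rfl fun J hJ => ?_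
    have hp : (∏ l, (![1, x] : Fin 2 → ℂ) (J l)) = x ^ k := by
      rw [← (Finset.mem_filter.1 hJ).2, ← Finset.prod_const, Finset.prod_filter]
      refine Finset.prod_congr rfl fun l _ => ?_
      generalize J l = b
      fin_cases b <;> simp
    rw [hp, smul_sub]
  have h0 := eq_zero_of_forall_sum_pow_smul hsum (Finset.mem_range.1 (hones I))
  have hconst : ∀ J ∈ Finset.univ.filter (fun J => ones J = ones I),
      S.1 J - T.1 J = S.1 I - T.1 I := fun J hJ => by
    obtain ⟨π, rfl⟩ := hperm J I (Finset.mem_filter.1 hJ).2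
    rw [S.2 π I, T.2 π I]
  rw [Finset.sum_congr rfl hconst, Finset.sum_const, ← Nat.cast_smul_eq_nsmul ℂ,
    smul_eq_zero] at h0
  refine sub_eq_zero.1 (h0.resolve_left ?_)
  rw [← ne_eq, Nat.cast_ne_zero, Finset.card_ne_zero]
  exact ⟨I, by simp⟩

/-- Symmetric tensors with prescribed `dz, dz̄` components exist. -/
lemma SymTensor.exists_comp (m : ℕ) (c : ℕ → V) :
    ∃ T : SymTensor m V, ∀ k ≤ m, comp T.1 k = c k := by
  -- `σ(dz ⊗ ⋯ ⊗ dz ⊗ dz̄ ⊗ ⋯ ⊗ dz̄)`, with `k` factors `dz`, has `k`-th component `1`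
  let e : ℕ → Fin m → Fin 2 → ℂ := fun k l i =>
    if (l : ℕ) < k then coordVec i else (starRingEnd ℂ) (coordVec i)
  refine ⟨symmetrize fun I => ∑ k ∈ Finset.range (m + 1), (∏ l, e k l (I l)) • c k,
    fun k hk => ?_⟩
  rw [comp_symmetrize]
  refine comp_eq_of_polyEval (fun v => ?_) hk
  simp only [polyEval, Finset.smul_sum, smul_smul, ← Finset.prod_mul_distrib]
  rw [Finset.sum_comm]
  refine Finset.sum_congr rfl fun j hj => ?_
  rw [← Finset.sum_smul]
  congr 1
  have := (Finset.prod_univ_sum (fun _ : Fin m => (Finset.univ : Finset (Fin 2)))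
    fun l i => v i * e j l i).symm
  rw [Fintype.piFinset_univ] at this
  rw [this]
  have hl : ∀ l : Fin m, ∑ i, v i * e j l i = if (l : ℕ) < j then dzVal v else dzbarVal v := by
    intro l
    by_cases h : (l : ℕ) < j <;> simp [e, h, Fin.sum_univ_two, coordVec, dzVal, dzbarVal] <;> ring
  have hjm : j ≤ m := Nat.lt_succ_iff.1 (Finset.mem_range.1 hj)
  rw [Finset.prod_congr rfl fun l _ => hl l, Fin.prod_univ_eq_prod_range
    (fun l => if l < j then dzVal v else dzbarVal v) m, Finset.prod_ite, Finset.prod_const,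
    Finset.prod_const]
  have h1 : ((Finset.range m).filter fun l => l < j) = Finset.range j := by
    ext; simp; omega
  have h2 : ((Finset.range m).filter fun l => ¬ l < j) = Finset.Ico j m := by
    ext; simp; omega
  rw [h1, h2, Finset.card_range, Nat.card_Ico]

lemma comp_map {m : ℕ} (A : V →ₗ[ℂ] W) (T : (Fin m → Fin 2) → V) (k : ℕ) :
    comp (fun I => A (T I)) k = A (comp T k) := by
  induction m generalizing k with
  | zero => simp only [comp]; split <;> simp
  | succ m ih =>
    cases k <;> simp [comp, ih]

lemma comp_add {m : ℕ} (S T : (Fin m → Fin 2) → V) (k : ℕ) :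
    comp (S + T) k = comp S k + comp T k := by
  induction m generalizing k with
  | zero => simp only [comp]; split <;> simp
  | succ m ih =>
    have h : ∀ (i : Fin 2) (l : ℕ), comp (fun J : Fin m → Fin 2 => (S + T) (Fin.cons i J)) l =
        comp (fun J : Fin m → Fin 2 => S (Fin.cons i J)) l +
          comp (fun J : Fin m → Fin 2 => T (Fin.cons i J)) l := fun i l => ih _ _ l
    cases k <;> simp only [comp, h, shift_zero, shift_succ] <;> module

lemma comp_zero {m : ℕ} (k : ℕ) : comp (0 : (Fin m → Fin 2) → V) k = 0 := by
  have := comp_add (0 : (Fin m → Fin 2) → V) 0 k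
  simpa using this

lemma comp_sum {m : ℕ} {ι : Type*} (s : Finset ι) (T : ι → SymTensor m V) (k : ℕ) :
    comp (∑ j ∈ s, T j).1 k = ∑ j ∈ s, comp (T j).1 k := by
  classical
  induction s using Finset.induction_on with
  | empty => simpa using comp_zero (V := V) (m := m) k
  | insert a s ha ih =>
    rw [Finset.sum_insert ha, Finset.sum_insert ha, ← ih]
    exact comp_add _ _ _

lemma comp_cast {m n : ℕ} (h : m = n) (v : SymTensor m V) (k : ℕ) :
    comp (SymTensor.cast h v).1 k = comp v.1 k := by
  subst h
  rfl

lemma polyEval_metricMul {m : ℕ} (w : SymTensor m V) (v : Fin 2 → ℂ) :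
    polyEval (metricMul w).1 v = (v 0 ^ 2 + v 1 ^ 2) • polyEval w.1 v := by
  rw [metricMul, polyEval_symmetrize, polyEval_succ, polyEval_succ, polyEval_succ]
  have h : ∀ (i j : Fin 2), polyEval (fun J : Fin m → Fin 2 =>
      (if (Fin.cons i (Fin.cons j J : Fin (m + 1) → Fin 2) : Fin (m + 2) → Fin 2) 0 =
        (Fin.cons i (Fin.cons j J : Fin (m + 1) → Fin 2) : Fin (m + 2) → Fin 2) 1
        then (1 : ℂ) else 0) •
      w.1 fun k => (Fin.cons i (Fin.cons j J : Fin (m + 1) → Fin 2) : Fin (m + 2) → Fin 2)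
        k.succ.succ) v = (if i = j then (1 : ℂ) else 0) • polyEval w.1 v := by
    intro i j
    have h1 : ∀ J : Fin m → Fin 2,
      (Fin.cons i (Fin.cons j J : Fin (m + 1) → Fin 2) : Fin (m + 2) → Fin 2) 1 = j := fun J => rfl
    simp only [polyEval, Fin.cons_succ, Fin.cons_zero, h1, Finset.smul_sum]
    exact Finset.sum_congr rfl fun J _ => smul_comm _ _ _
  simp only [h]
  simp
  module

/-- In the coframe `dz, dz̄` the metric is `dz dz̄`, so `L` moves every component by one place. -/
lemma comp_metricMul {m : ℕ} (w : SymTensor m V) (k : ℕ) :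
    comp (metricMul w).1 k = shift (comp w.1) k := by
  rcases le_or_gt k (m + 2) with hk | hk
  · refine comp_eq_of_polyEval (fun v => ?_) hk
    rw [polyEval_metricMul, polyEval_eq_comp, Finset.sum_range_succ' _ (m + 2),
      Finset.sum_range_succ _ (m + 1), Finset.smul_sum]
    simp only [shift_zero, shift_succ, smul_zero, add_zero]
    rw [comp_of_lt _ (Nat.lt_succ_self m), smul_zero, add_zero]
    refine Finset.sum_congr rfl fun j hj => ?_
    have hjm : m + 2 - (j + 1) = (m - j) + 1 := by
      have := Finset.mem_range.1 hj
      omega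
    have hv : v 0 ^ 2 + v 1 ^ 2 = dzVal v * dzbarVal v := by
      simp only [dzVal, dzbarVal]
      linear_combination (v 1) ^ 2 * Complex.I_sq
    rw [hjm, hv, smul_smul]
    ring_nf
  · obtain ⟨k, rfl⟩ : ∃ l, k = l + 1 := ⟨k - 1, by omega⟩
    rw [comp_of_lt _ hk, shift_succ, comp_of_lt _ (by omega)]

lemma comp_metricMulPow {m : ℕ} (w : SymTensor m V) (n k : ℕ) :
    comp (metricMulPow w n).1 k = if n ≤ k then comp w.1 (k - n) else 0 := by
  induction n generalizing k with
  | zero => simp [metricMulPow]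
  | succ n ih =>
    have : comp (metricMulPow w (n + 1)).1 k = shift (comp (metricMulPow w n).1) k :=
      comp_metricMul _ k
    rw [this]
    cases k with
    | zero => simp
    | succ k => simp [ih]

end Components

/-! ### The energy estimate for `∂` and `∂̄` in weighted spaces -/

section Energy

lemma contDiff_bdf {n : WithTop ℕ∞} : ContDiff ℝ n bdf :=
  contDiff_const.sub (contDiff_norm_sq ℝ)

lemma fderiv_bdf (z v : ℂ) : fderiv ℝ bdf z v = -2 * (z.re * v.re + z.im * v.im) := by
  have h : HasFDerivAt bdf (-(2 • innerSL ℝ z)) z := by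
    have h1 := (hasFDerivAt_const (1 : ℝ) z).sub (hasStrictFDerivAt_norm_sq z).hasFDerivAt
    rw [zero_sub] at h1
    exact h1
  rw [h.fderiv]
  simp [Complex.inner, Complex.mul_re]
  ring

variable {S : Set ℂ} {K : ℂ → ℝ}

lemma contDiff_weight_mul {n : WithTop ℕ∞} (hSc : IsClosed S) (hS : S ⊆ Metric.ball 0 1)
    (hK : ContDiff ℝ n K) (h0 : ∀ z, z ∉ S → K z = 0) (a : ℝ) :
    ContDiff ℝ n fun z => bdf z ^ a * K z := by
  rw [contDiff_iff_contDiffAt]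
  intro z
  by_cases hz : z ∈ S
  · exact ((contDiff_bdf.contDiffAt).rpow_const_of_ne (bdf_pos (hS hz)).ne').mul hK.contDiffAt
  · have : (fun z => bdf z ^ a * K z) =ᶠ[nhds z] fun _ => 0 := by
      filter_upwards [hSc.isOpen_compl.mem_nhds hz] with w hw
      rw [h0 w hw, mul_zero]
    exact contDiffAt_const.congr_of_eventuallyEq this

lemma integrable_weight_mul (hSc : IsCompact S) (hS : S ⊆ Metric.ball 0 1)
    (hK : Continuous K) (h0 : ∀ z, z ∉ S → K z = 0) (a : ℝ) :
    Integrable fun z => bdf z ^ a * K z := by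
  refine Continuous.integrable_of_hasCompactSupport ?_
    (HasCompactSupport.intro hSc fun z hz => by rw [h0 z hz, mul_zero])
  exact contDiff_zero.1 (contDiff_weight_mul hSc.isClosed hS (contDiff_zero.2 hK) h0 a)

lemma fderiv_eq_zero_off {E : Type*} [NormedAddCommGroup E] [NormedSpace ℝ E] {f : ℂ → E}
    (hSc : IsClosed S) (h0 : ∀ z, z ∉ S → f z = 0) {z : ℂ} (hz : z ∉ S) : fderiv ℝ f z = 0 := by
  have : f =ᶠ[nhds z] fun _ => 0 := by
    filter_upwards [hSc.isOpen_compl.mem_nhds hz] with w hw using h0 w hw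
  rw [this.fderiv_eq]
  simp

lemma integral_fderiv_eq_zero {f : ℂ → ℝ} (hSc : IsCompact S) (hf : ContDiff ℝ 1 f)
    (h0 : ∀ z, z ∉ S → f z = 0) (v : ℂ) : ∫ z, fderiv ℝ f z v = 0 := by
  have hc : Continuous fun z => fderiv ℝ f z v :=
    (hf.continuous_fderiv one_ne_zero).clm_apply continuous_const
  have hi : Integrable fun z => fderiv ℝ f z v :=
    hc.integrable_of_hasCompactSupport (HasCompactSupport.intro hSc fun z hz => by
      rw [fderiv_eq_zero_off hSc.isClosed h0 hz]; rfl)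
  have hi' : Integrable f :=
    hf.continuous.integrable_of_hasCompactSupport (HasCompactSupport.intro hSc h0)
  have := integral_mul_fderiv_eq_neg_fderiv_mul_of_integrable (μ := volume) (𝕜 := ℝ)
    (f := fun _ : ℂ => (1 : ℝ)) (g := f) (v := v) (by simp) (by simpa using hi) (by simpa using hi')
    (fun z _ => by fun_prop)
    (fun z _ => hf.differentiable one_ne_zero z)
  simpa using this

/-- Integration by parts against a power of the boundary defining function. -/
lemma integral_weight_fderiv (hSc : IsCompact S) (hS : S ⊆ Metric.ball 0 1)
    (hK : ContDiff ℝ 1 K) (h0 : ∀ z, z ∉ S → K z = 0) (a : ℝ) (v : ℂ) :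
    ∫ z, bdf z ^ a * fderiv ℝ K z v =
      2 * a * ∫ z, bdf z ^ (a - 1) * ((z.re * v.re + z.im * v.im) * K z) := by
  have hd : ∀ z, fderiv ℝ (fun z => bdf z ^ a * K z) z v = bdf z ^ a * fderiv ℝ K z v -
      2 * a * (bdf z ^ (a - 1) * ((z.re * v.re + z.im * v.im) * K z)) := fun z => by
    by_cases hz : z ∈ S
    · have h1 : HasFDerivAt (fun z => bdf z ^ a) ((a * bdf z ^ (a - 1)) • fderiv ℝ bdf z) z :=
        ((contDiff_bdf (n := 1)).differentiable one_ne_zero z).hasFDerivAt.rpow_const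
          (Or.inl (bdf_pos (hS hz)).ne')
      have h2 : HasFDerivAt (fun z => bdf z ^ a * K z) _ z :=
        h1.mul (hK.differentiable one_ne_zero z).hasFDerivAt
      rw [h2.fderiv]
      simp only [_root_.add_apply, _root_.smul_apply, smul_eq_mul,
        fderiv_bdf]
      ring
    · rw [fderiv_eq_zero_off hSc.isClosed (fun w hw => by rw [h0 w hw, mul_zero]) hz,
        fderiv_eq_zero_off hSc.isClosed h0 hz, h0 z hz]
      simp
  have h := integral_fderiv_eq_zero hSc (contDiff_weight_mul hSc.isClosed hS hK h0 a)
    (fun w hw => by rw [h0 w hw, mul_zero]) v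
  simp only [hd] at h
  have hc : Continuous fun z => fderiv ℝ K z v :=
    (hK.continuous_fderiv one_ne_zero).clm_apply continuous_const
  rw [integral_sub, integral_const_mul] at h
  · linarith
  · exact integrable_weight_mul hSc hS hc (fun z hz => by
      rw [fderiv_eq_zero_off hSc.isClosed h0 hz]; rfl) a
  · refine (integrable_weight_mul hSc hS ?_ (fun z hz => by rw [h0 z hz, mul_zero]) _).const_mul _
    have := hK.continuous
    fun_prop

/-- The density of `⟨-i ∂_θ u, u⟩`, where `u = a + i b`. -/
def angDensity (a b : ℂ → ℝ) (z : ℂ) : ℝ :=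
  z.re * (a z * fderiv ℝ b z Complex.I - b z * fderiv ℝ a z Complex.I) -
    z.im * (a z * fderiv ℝ b z 1 - b z * fderiv ℝ a z 1)

/-- The density of `|∂u|²`, where `u = a + i b`; that of `|∂̄u|²` is `dzDensity a (-b)`. -/
def dzDensity (a b : ℂ → ℝ) (z : ℂ) : ℝ :=
  ((fderiv ℝ a z 1 + fderiv ℝ b z Complex.I) ^ 2 +
    (fderiv ℝ b z 1 - fderiv ℝ a z Complex.I) ^ 2) / 4

variable {a b : ℂ → ℝ}

lemma continuous_fderiv_apply' (ha : ContDiff ℝ 2 a) (v : ℂ) :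
    Continuous fun z => fderiv ℝ a z v :=
  (ha.continuous_fderiv two_ne_zero).clm_apply continuous_const

lemma continuous_angDensity (ha : ContDiff ℝ 2 a) (hb : ContDiff ℝ 2 b) :
    Continuous (angDensity a b) := by
  have h1 := continuous_fderiv_apply' ha
  have h2 := continuous_fderiv_apply' hb
  have h3 := ha.continuous
  have h4 := hb.continuous
  unfold angDensity
  have := h1 1; have := h1 Complex.I; have := h2 1; have := h2 Complex.I
  fun_prop

lemma continuous_dzDensity (ha : ContDiff ℝ 2 a) (hb : ContDiff ℝ 2 b) :
    Continuous (dzDensity a b) := by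
  have h1 := continuous_fderiv_apply' ha
  have h2 := continuous_fderiv_apply' hb
  unfold dzDensity
  have := h1 1; have := h1 Complex.I; have := h2 1; have := h2 Complex.I
  fun_prop

lemma angDensity_neg (z : ℂ) : angDensity a (-b) z = -angDensity a b z := by
  simp only [angDensity, fderiv_neg, Pi.neg_apply, _root_.neg_apply]
  ring

/-- `‖∂u‖² - ‖∂̄u‖² = s ⟨-i ∂_θ u, u⟩`: the difference of the two energies is a null form,
whose integral against a weight only sees the derivative of the weight. -/
lemma integral_dzDensity_sub (hSc : IsCompact S) (hS : S ⊆ Metric.ball 0 1)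
    (ha : ContDiff ℝ 2 a) (hb : ContDiff ℝ 2 b) (ha0 : ∀ z, z ∉ S → a z = 0)
    (hb0 : ∀ z, z ∉ S → b z = 0) (s : ℝ) :
    (∫ z, bdf z ^ s * dzDensity a b z) - ∫ z, bdf z ^ s * dzDensity a (-b) z =
      s * ∫ z, bdf z ^ (s - 1) * angDensity a b z := by
  have hsm : ∀ {f : ℂ → ℝ}, ContDiff ℝ 2 f → ∀ v, ContDiff ℝ 1 fun z => fderiv ℝ f z v :=
    fun hf v => (hf.fderiv_right (m := 1) le_rfl).clm_apply contDiff_const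
  have hsymm : ∀ {f : ℂ → ℝ}, ContDiff ℝ 2 f → ∀ z v w,
      fderiv ℝ (fun z => fderiv ℝ f z v) z w = fderiv ℝ (fun z => fderiv ℝ f z w) z v := by
    intro f hf z v w
    have hd : DifferentiableAt ℝ (fderiv ℝ f) z :=
      (hf.fderiv_right (m := 1) le_rfl).differentiable one_ne_zero z
    have h2 : ∀ v w, fderiv ℝ (fun z => fderiv ℝ f z v) z w = fderiv ℝ (fderiv ℝ f) z w v := by
      intro v w
      rw [fderiv_clm_apply hd (differentiableAt_const v)]
      simp
    rw [h2, h2]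
    exact (hf.contDiffAt.isSymmSndFDerivAt (by simp)) w v
  let k : ℂ → ℂ → ℝ := fun v z => a z * fderiv ℝ b z v - b z * fderiv ℝ a z v
  have ha1 : ContDiff ℝ 1 a := ha.of_le (by norm_num)
  have hb1 : ContDiff ℝ 1 b := hb.of_le (by norm_num)
  have hk : ∀ v, ContDiff ℝ 1 (k v) := fun v => (ha1.mul (hsm hb v)).sub (hb1.mul (hsm ha v))
  have hk0 : ∀ v z, z ∉ S → k v z = 0 := fun v z hz => by simp [k, ha0 z hz, hb0 z hz]
  have hkd : ∀ v w z, fderiv ℝ (k v) z w = fderiv ℝ a z w * fderiv ℝ b z v +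
      a z * fderiv ℝ (fun z => fderiv ℝ b z v) z w - fderiv ℝ b z w * fderiv ℝ a z v -
      b z * fderiv ℝ (fun z => fderiv ℝ a z v) z w := by
    intro v w z
    have hda := (ha1.differentiable one_ne_zero z).hasFDerivAt
    have hdb := (hb1.differentiable one_ne_zero z).hasFDerivAt
    have hda' := ((hsm ha v).differentiable one_ne_zero z).hasFDerivAt
    have hdb' := ((hsm hb v).differentiable one_ne_zero z).hasFDerivAt
    have hkz : HasFDerivAt (k v) _ z := (hda.mul hdb').sub (hdb.mul hda')
    rw [hkz.fderiv]
    simp only [_root_.add_apply, _root_.sub_apply,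
      _root_.smul_apply, smul_eq_mul]
    ring
  have e1 := integral_weight_fderiv hSc hS (hk Complex.I) (hk0 Complex.I) s 1
  have e2 := integral_weight_fderiv hSc hS (hk 1) (hk0 1) s Complex.I
  have hkc : ∀ v w, Continuous fun z => fderiv ℝ (k v) z w := fun v w =>
    ((hk v).continuous_fderiv one_ne_zero).clm_apply continuous_const
  have hkd0 : ∀ v w z, z ∉ S → fderiv ℝ (k v) z w = 0 := fun v w z hz => by
    rw [fderiv_eq_zero_off hSc.isClosed (hk0 v) hz]; rfl
  have i1 := fun v w => integrable_weight_mul hSc hS (hkc v w) (hkd0 v w) s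
  have hz0 : ∀ b' : ℂ → ℝ, (∀ z, z ∉ S → b' z = 0) → ∀ z, z ∉ S → dzDensity a b' z = 0 :=
    fun b' hb' z hz => by
      simp [dzDensity, fderiv_eq_zero_off hSc.isClosed ha0 hz,
        fderiv_eq_zero_off hSc.isClosed hb' hz]
  rw [← integral_sub
    (integrable_weight_mul hSc hS (continuous_dzDensity ha hb) (hz0 b hb0) s)
    (integrable_weight_mul hSc hS (continuous_dzDensity (b := -b) ha hb.neg)
      (hz0 (-b) fun z hz => by simp [hb0 z hz]) s)]
  have i2 : ∀ (v : ℂ) (g : ℂ → ℝ), Continuous g →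
      Integrable fun z => bdf z ^ (s - 1) * (g z * k v z) := fun v g hg =>
    integrable_weight_mul (K := fun z => g z * k v z) hSc hS (hg.mul (hk v).continuous)
      (fun z hz => by rw [hk0 v z hz, mul_zero]) _
  have hL : ∀ z, bdf z ^ s * dzDensity a b z - bdf z ^ s * dzDensity a (-b) z =
      (1 / 2) * (bdf z ^ s * fderiv ℝ (k Complex.I) z 1 -
        bdf z ^ s * fderiv ℝ (k 1) z Complex.I) := fun z => by
    rw [hkd, hkd, hsymm hb z Complex.I 1, hsymm ha z Complex.I 1]
    simp only [dzDensity, fderiv_neg, _root_.neg_apply]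
    ring
  have hR : ∀ z, bdf z ^ (s - 1) * angDensity a b z =
      bdf z ^ (s - 1) * ((z.re * (1 : ℂ).re + z.im * (1 : ℂ).im) * k Complex.I z) -
      bdf z ^ (s - 1) * ((z.re * Complex.I.re + z.im * Complex.I.im) * k 1 z) := fun z => by
    simp only [angDensity, k, Complex.one_re, Complex.one_im, Complex.I_re, Complex.I_im]
    ring
  simp only [hL, hR]
  rw [integral_const_mul, integral_sub (i1 _ _) (i1 _ _), e1, e2, integral_sub]
  · ring
  · exact i2 _ _ (by fun_prop)
  · exact i2 _ _ (by fun_prop)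

/-- Hardy's inequality in first-order form. The divergence of the vector field
`d^(s-1) |u|² (x, y)` integrates to zero; the radial derivative of `u` in it is
`2 z ∂u + i ∂_θ u`, and the part with `∂u` is absorbed by completing squares. -/
lemma integral_sq_le_dzDensity_add (hSc : IsCompact S) (hS : S ⊆ Metric.ball 0 1)
    (ha : ContDiff ℝ 2 a) (hb : ContDiff ℝ 2 b) (ha0 : ∀ z, z ∉ S → a z = 0)
    (hb0 : ∀ z, z ∉ S → b z = 0) {s : ℝ} (hs : s < 1) :
    ∫ z, bdf z ^ (s - 1) * (a z ^ 2 + b z ^ 2) ≤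
      (1 - s)⁻¹ * (∫ z, bdf z ^ s * dzDensity a b z) +
        ∫ z, bdf z ^ (s - 1) * angDensity a b z := by
  have ha1 : ContDiff ℝ 1 a := ha.of_le (by norm_num)
  have hb1 : ContDiff ℝ 1 b := hb.of_le (by norm_num)
  have hac := ha.continuous
  have hbc := hb.continuous
  have hu : ContDiff ℝ 1 fun z => a z ^ 2 + b z ^ 2 := (ha1.pow 2).add (hb1.pow 2)
  have hre : ContDiff ℝ 1 fun z : ℂ => z.re := Complex.reCLM.contDiff
  have him : ContDiff ℝ 1 fun z : ℂ => z.im := Complex.imCLM.contDiff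
  have hu0 : ∀ z, z ∉ S → a z ^ 2 + b z ^ 2 = 0 := fun z hz => by simp [ha0 z hz, hb0 z hz]
  have hder : ∀ (L : ℂ →L[ℝ] ℝ) (z v : ℂ), fderiv ℝ (fun z => L z * (a z ^ 2 + b z ^ 2)) z v =
      L v * (a z ^ 2 + b z ^ 2) + L z * (2 * a z * fderiv ℝ a z v + 2 * b z * fderiv ℝ b z v) := by
    intro L z v
    have hda := (ha1.differentiable one_ne_zero z).hasFDerivAt
    have hdb := (hb1.differentiable one_ne_zero z).hasFDerivAt
    have hL : HasFDerivAt (fun z => L z * (a z ^ 2 + b z ^ 2)) _ z :=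
      L.hasFDerivAt.mul ((hda.pow 2).add (hdb.pow 2))
    rw [hL.fderiv]
    simp only [_root_.add_apply, _root_.smul_apply, smul_eq_mul]
    simp
    ring
  have e1 := integral_weight_fderiv hSc hS (hre.mul hu)
    (fun z hz => by rw [hu0 z hz, mul_zero]) (s - 1) 1
  have e2 := integral_weight_fderiv hSc hS (him.mul hu)
    (fun z hz => by rw [hu0 z hz, mul_zero]) (s - 1) Complex.I
  have d1 := fun z v => hder Complex.reCLM z v
  have d2 := fun z v => hder Complex.imCLM z v
  simp only [Complex.reCLM_apply, Complex.imCLM_apply] at d1 d2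
  simp only [d1, d2, Complex.one_re, Complex.one_im, Complex.I_re, Complex.I_im] at e1 e2
  have c1 := continuous_fderiv_apply' ha 1
  have c2 := continuous_fderiv_apply' ha Complex.I
  have c3 := continuous_fderiv_apply' hb 1
  have c4 := continuous_fderiv_apply' hb Complex.I
  have hint : ∀ (t : ℝ) (F : ℂ → ℝ), Continuous F →
      (∀ z, a z = 0 → b z = 0 → fderiv ℝ a z = 0 → fderiv ℝ b z = 0 → F z = 0) →
      Integrable fun z => bdf z ^ t * F z := fun t F hF hF0 =>
    integrable_weight_mul hSc hS hF (fun z hz => hF0 z (ha0 z hz) (hb0 z hz)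
      (fderiv_eq_zero_off hSc.isClosed ha0 hz) (fderiv_eq_zero_off hSc.isClosed hb0 hz)) t
  have hG := hint (s - 1) (fun z => a z ^ 2 + b z ^ 2) (by fun_prop)
    fun z h1 h2 _ _ => by simp [h1, h2]
  have hP := hint s (dzDensity a b) (continuous_dzDensity ha hb)
    fun z _ _ h3 h4 => by simp [dzDensity, h3, h4]
  have hN := hint (s - 1) (angDensity a b) (continuous_angDensity ha hb)
    fun z h1 h2 _ _ => by simp [angDensity, h1, h2]
  have i1 := hint (s - 1) (fun z => 1 * (a z ^ 2 + b z ^ 2) +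
      z.re * (2 * a z * fderiv ℝ a z 1 + 2 * b z * fderiv ℝ b z 1)) (by fun_prop)
    fun z h1 h2 h3 h4 => by simp [h1, h2]
  have i2 := hint (s - 1) (fun z => 1 * (a z ^ 2 + b z ^ 2) +
      z.im * (2 * a z * fderiv ℝ a z Complex.I + 2 * b z * fderiv ℝ b z Complex.I)) (by fun_prop)
    fun z h1 h2 h3 h4 => by simp [h1, h2]
  have i3 := hint (s - 1 - 1) (fun z => (z.re * 1 + z.im * 0) * (z.re * (a z ^ 2 + b z ^ 2)))
    (by fun_prop) fun z h1 h2 h3 h4 => by simp [h1, h2]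
  have i4 := hint (s - 1 - 1) (fun z => (z.re * 0 + z.im * 1) * (z.im * (a z ^ 2 + b z ^ 2)))
    (by fun_prop) fun z h1 h2 h3 h4 => by simp [h1, h2]
  have hκ : 0 < 1 - s := by linarith
  -- after adding the two integrals by parts, whose sum vanishes, the integrand is a sum of two
  -- squares
  have hpt : ∀ z, 0 ≤ (1 - s)⁻¹ * (bdf z ^ s * dzDensity a b z) +
      bdf z ^ (s - 1) * angDensity a b z - bdf z ^ (s - 1) * (a z ^ 2 + b z ^ 2) +
      (1 / 2 : ℝ) * (bdf z ^ (s - 1) * (1 * (a z ^ 2 + b z ^ 2) +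
        z.re * (2 * a z * fderiv ℝ a z 1 + 2 * b z * fderiv ℝ b z 1)) +
      bdf z ^ (s - 1) * (1 * (a z ^ 2 + b z ^ 2) +
        z.im * (2 * a z * fderiv ℝ a z Complex.I + 2 * b z * fderiv ℝ b z Complex.I))) +
      (1 - s) * (bdf z ^ (s - 1 - 1) * ((z.re * 1 + z.im * 0) * (z.re * (a z ^ 2 + b z ^ 2))) +
        bdf z ^ (s - 1 - 1) * ((z.re * 0 + z.im * 1) * (z.im * (a z ^ 2 + b z ^ 2)))) := by
    intro z
    by_cases hz : z ∈ S
    · have hd := bdf_pos (hS hz)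
      rw [Real.rpow_sub_one hd.ne' (s - 1), Real.rpow_sub_one hd.ne' s]
      have hD : 0 ≤ bdf z ^ s := (Real.rpow_pos_of_pos hd s).le
      simp only [dzDensity, angDensity]
      generalize bdf z ^ s = D at *
      generalize bdf z = d at *
      generalize fderiv ℝ a z 1 = ax
      generalize fderiv ℝ b z 1 = bx
      generalize fderiv ℝ a z Complex.I = ay
      generalize fderiv ℝ b z Complex.I = by'
      generalize a z = a
      generalize b z = b
      generalize z.re = x
      generalize z.im = y
      have : 0 ≤ D * ((1 - s)⁻¹ * (((1 - s) * (a * x + b * y) / d + (ax + by') / 2) ^ 2 +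
          ((1 - s) * (a * y - b * x) / d - (bx - ay) / 2) ^ 2)) := by positivity
      refine this.trans (le_of_eq ?_)
      field_simp
      ring
    · simp [dzDensity, angDensity, ha0 z hz, hb0 z hz, fderiv_eq_zero_off hSc.isClosed ha0 hz,
        fderiv_eq_zero_off hSc.isClosed hb0 hz]
  have h := integral_nonneg_of_ae (μ := (volume : Measure ℂ)) (Filter.Eventually.of_forall fun z => hpt z)
  have j1 := hP.const_mul (1 - s)⁻¹
  have j2 := (i1.fun_add i2).const_mul (1 / 2)
  have j4 : Integrable fun z => (1 - s)⁻¹ * (bdf z ^ s * dzDensity a b z) +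
    bdf z ^ (s - 1) * angDensity a b z - bdf z ^ (s - 1) * (a z ^ 2 + b z ^ 2) :=
    (j1.fun_add hN).sub hG
  have j3 := (i3.fun_add i4).const_mul (1 - s)
  rw [integral_add (j4.fun_add j2) j3,
    integral_add j4 j2, integral_sub (j1.fun_add hN) hG,
    integral_add j1 hN,
    integral_const_mul, integral_const_mul, integral_const_mul, integral_add i1 i2,
    integral_add i3 i4, e1, e2] at h
  linarith

/-- For `s < 1` and `u = a + i b` with compact support in the open disk, the weighted norms of
`u` and of `∂̄u` are controlled by that of `∂u`. -/
lemma energy_le (hSc : IsCompact S) (hS : S ⊆ Metric.ball 0 1)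
    (ha : ContDiff ℝ 2 a) (hb : ContDiff ℝ 2 b) (ha0 : ∀ z, z ∉ S → a z = 0)
    (hb0 : ∀ z, z ∉ S → b z = 0) {s : ℝ} (hs : s < 1) :
    (∫ z, bdf z ^ s * dzDensity a (-b) z) ≤
        ((1 - s) + (1 - s)⁻¹) * (∫ z, bdf z ^ s * dzDensity a b z) ∧
      (∫ z, bdf z ^ s * (a z ^ 2 + b z ^ 2)) ≤
        (1 - s)⁻¹ * (1 + ((1 - s) + (1 - s)⁻¹)) * (∫ z, bdf z ^ s * dzDensity a b z) := by
  have hb' : ContDiff ℝ 2 (-b) := hb.neg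
  have hb0' : ∀ z, z ∉ S → (-b) z = 0 := fun z hz => by simp [hb0 z hz]
  have hnn : ∀ c : ℂ → ℝ, (∀ z, z ∉ S → c z = 0) →
      0 ≤ ∫ z, bdf z ^ s * dzDensity a c z := fun c hc0 => by
    refine integral_nonneg fun z => ?_
    by_cases hz : z ∈ S
    · have := Real.rpow_pos_of_pos (bdf_pos (hS hz)) s
      simp only [Pi.zero_apply, dzDensity]
      positivity
    · simp [dzDensity, fderiv_eq_zero_off hSc.isClosed ha0 hz,
        fderiv_eq_zero_off hSc.isClosed hc0 hz]
  have hP := hnn b hb0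
  have hQ := hnn (-b) hb0'
  have e1 := integral_dzDensity_sub hSc hS ha hb ha0 hb0 s
  have e2 := integral_sq_le_dzDensity_add hSc hS ha hb ha0 hb0 hs
  -- the same inequality for the conjugate function, which exchanges `∂` and `∂̄`
  have e3 := integral_sq_le_dzDensity_add hSc hS ha hb' ha0 hb0' hs
  simp only [angDensity_neg, mul_neg, integral_neg, Pi.neg_apply, neg_sq] at e3
  have hu0 : ∀ z, z ∉ S → a z ^ 2 + b z ^ 2 = 0 := fun z hz => by simp [ha0 z hz, hb0 z hz]
  have hac := ha.continuous
  have hbc := hb.continuous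
  have hu : Continuous fun z => a z ^ 2 + b z ^ 2 := by fun_prop
  have hG : (∫ z, bdf z ^ s * (a z ^ 2 + b z ^ 2)) ≤
      ∫ z, bdf z ^ (s - 1) * (a z ^ 2 + b z ^ 2) := by
    refine integral_mono (integrable_weight_mul hSc hS hu hu0 _)
      (integrable_weight_mul hSc hS hu hu0 _) fun z => ?_
    by_cases hz : z ∈ S
    · refine mul_le_mul_of_nonneg_right ?_ (by positivity)
      refine Real.rpow_le_rpow_of_exponent_ge (bdf_pos (hS hz)) ?_ (by linarith)
      have := sq_nonneg ‖z‖
      unfold bdf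
      linarith
    · simp only [hu0 z hz, mul_zero, le_refl]
  have hG0 : 0 ≤ ∫ z, bdf z ^ (s - 1) * (a z ^ 2 + b z ^ 2) := by
    refine integral_nonneg fun z => ?_
    by_cases hz : z ∈ S
    · have := Real.rpow_pos_of_pos (bdf_pos (hS hz)) (s - 1)
      simp only [Pi.zero_apply]
      positivity
    · simp [hu0 z hz]
  generalize (∫ z, bdf z ^ s * (a z ^ 2 + b z ^ 2)) = G' at *
  generalize (∫ z, bdf z ^ (s - 1) * (a z ^ 2 + b z ^ 2)) = G at *
  generalize (∫ z, bdf z ^ s * dzDensity a b z) = P at *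
  generalize (∫ z, bdf z ^ s * dzDensity a (-b) z) = Q at *
  generalize (∫ z, bdf z ^ (s - 1) * angDensity a b z) = N at *
  obtain ⟨κ, rfl⟩ : ∃ κ, s = 1 - κ := ⟨1 - s, by ring⟩
  rw [sub_sub_cancel] at *
  have hκ : 0 < κ := by linarith
  have hκ' : 0 < κ⁻¹ := inv_pos.2 hκ
  have hmul : κ * κ⁻¹ = 1 := mul_inv_cancel₀ hκ.ne'
  have hQP : Q ≤ (κ + κ⁻¹) * P := by
    rcases le_or_gt κ 1 with h1 | h1
    · -- `s ≥ 0`: use the lower bound for `N`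
      have : (1 - κ) * (-(κ⁻¹ * P)) ≤ (1 - κ) * N :=
        mul_le_mul_of_nonneg_left (by linarith) (by linarith)
      have h2 : Q ≤ P + (1 - κ) * (κ⁻¹ * P) := by linarith
      have h3 : P + (1 - κ) * (κ⁻¹ * P) = κ⁻¹ * P := by linear_combination -P * hmul
      nlinarith [mul_nonneg hκ.le hP]
    · -- `s < 0`: use the upper bound for `N`
      have : (κ - 1) * N ≤ (κ - 1) * (κ⁻¹ * Q) :=
        mul_le_mul_of_nonneg_left (by linarith) (by linarith)
      have h2 : Q ≤ P + (κ - 1) * (κ⁻¹ * Q) := by linarith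
      have h3 : κ⁻¹ * Q ≤ P := by linear_combination h2 + Q * hmul
      have h4 : Q ≤ κ * P := by
        have := mul_le_mul_of_nonneg_left h3 hκ.le
        rwa [← mul_assoc, hmul, one_mul] at this
      nlinarith [mul_nonneg hκ'.le hP]
  refine ⟨hQP, ?_⟩
  have h5 : 2 * G ≤ κ⁻¹ * (P + Q) := by linarith
  have h6 : κ⁻¹ * (P + Q) ≤ κ⁻¹ * (P + (κ + κ⁻¹) * P) :=
    mul_le_mul_of_nonneg_left (by linarith) hκ'.le
  have h7 : κ⁻¹ * (P + (κ + κ⁻¹) * P) = κ⁻¹ * (1 + (κ + κ⁻¹)) * P := by ring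
  linarith

end Energy

/-! ### Weyl's lemma for `∂̄` -/

section Weyl

open Metric

/-- The Cauchy–Riemann operator `∂̄ = (∂_x + i ∂_y)/2`. -/
def dbar (φ : ℂ → ℂ) (z : ℂ) : ℂ :=
  (1 / 2) * (fderiv ℝ φ z 1 + Complex.I * fderiv ℝ φ z Complex.I)

lemma dbar_mul {φ ψ : ℂ → ℂ} {z : ℂ} (hφ : DifferentiableAt ℝ φ z)
    (hψ : DifferentiableAt ℝ ψ z) :
    dbar (fun w => φ w * ψ w) z = dbar φ z * ψ z + φ z * dbar ψ z := by
  have h : HasFDerivAt (fun w => φ w * ψ w) _ z := hφ.hasFDerivAt.mul hψ.hasFDerivAt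
  simp only [dbar, h.fderiv, _root_.add_apply, _root_.smul_apply, smul_eq_mul]
  ring

lemma dbar_eq_zero_of_differentiableAt {φ : ℂ → ℂ} {z : ℂ} (hφ : DifferentiableAt ℂ φ z) :
    dbar φ z = 0 := by
  have h := hφ.hasDerivAt.complexToReal_fderiv
  simp only [dbar, h.fderiv]
  simp
  linear_combination (deriv φ z) * Complex.I_sq

lemma dbar_congr {φ ψ : ℂ → ℂ} {z : ℂ} (h : φ =ᶠ[nhds z] ψ) : dbar φ z = dbar ψ z := by
  simp only [dbar, h.fderiv_eq]

lemma dbar_comp_sub (φ : ℂ → ℂ) (ζ z : ℂ) : dbar (fun w => φ (w - ζ)) z = dbar φ (z - ζ) := by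
  simp only [dbar, fderiv_comp_sub]

lemma continuous_dbar {φ : ℂ → ℂ} (hφ : ContDiff ℝ 1 φ) : Continuous (dbar φ) := by
  have h := fun v : ℂ => (hφ.continuous_fderiv one_ne_zero).clm_apply
    (continuous_const (y := v))
  have h1 := h 1
  have h2 := h Complex.I
  unfold dbar
  fun_prop

/-- A smooth monotone step, equal to `0` on `(-∞, 1/2]` and to `1` on `[1, ∞)`. -/
def smoothStep (t : ℝ) : ℝ := Real.smoothTransition (2 * t - 1)

lemma contDiff_smoothStep {n : ℕ∞} : ContDiff ℝ n smoothStep :=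
  Real.smoothTransition.contDiff.comp ((contDiff_const.mul contDiff_id).sub contDiff_const)

lemma smoothStep_of_le {t : ℝ} (ht : t ≤ 1 / 2) : smoothStep t = 0 :=
  Real.smoothTransition.zero_of_nonpos (by linarith)

lemma smoothStep_of_ge {t : ℝ} (ht : 1 ≤ t) : smoothStep t = 1 :=
  Real.smoothTransition.one_of_one_le (by linarith)

lemma continuous_deriv_smoothStep : Continuous (deriv smoothStep) :=
  (contDiff_smoothStep (n := 1)).continuous_deriv le_rfl

lemma deriv_smoothStep_of_lt {t : ℝ} (ht : t < 1 / 2) : deriv smoothStep t = 0 := by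
  have : smoothStep =ᶠ[nhds t] fun _ => 0 := by
    filter_upwards [Iio_mem_nhds ht] with x hx using smoothStep_of_le (le_of_lt hx)
  rw [this.deriv_eq, deriv_const]

lemma deriv_smoothStep_of_gt {t : ℝ} (ht : 1 < t) : deriv smoothStep t = 0 := by
  have : smoothStep =ᶠ[nhds t] fun _ => 1 := by
    filter_upwards [Ioi_mem_nhds ht] with x hx using smoothStep_of_ge (le_of_lt hx)
  rw [this.deriv_eq, deriv_const]

lemma deriv_smoothStep_nonneg (t : ℝ) : 0 ≤ deriv smoothStep t := by
  refine Monotone.deriv_nonneg fun x y h => Real.smoothTransition.monotone (by linarith)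

/-- The Cauchy kernel `1/w`, cut off smoothly inside the disk of radius `δ`. -/
def cutCauchy (δ : ℝ) (w : ℂ) : ℂ := w⁻¹ * (smoothStep (‖w‖ ^ 2 / δ ^ 2) : ℝ)

/-- The mollifier `∂̄` of the truncated Cauchy kernel. -/
def cauchyBump (δ : ℝ) (w : ℂ) : ℝ := (δ ^ 2)⁻¹ * deriv smoothStep (‖w‖ ^ 2 / δ ^ 2)

variable {δ : ℝ}

lemma cutCauchy_of_le (hδ : 0 < δ) {w : ℂ} (hw : δ ≤ ‖w‖) : cutCauchy δ w = w⁻¹ := by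
  have : 1 ≤ ‖w‖ ^ 2 / δ ^ 2 := by
    rw [le_div_iff₀ (by positivity), one_mul]
    gcongr
  simp [cutCauchy, smoothStep_of_ge this]

lemma cauchyBump_of_lt (hδ : 0 < δ) {w : ℂ} (hw : δ < ‖w‖) : cauchyBump δ w = 0 := by
  have : 1 < ‖w‖ ^ 2 / δ ^ 2 := by
    rw [lt_div_iff₀ (by positivity), one_mul]
    gcongr
  simp [cauchyBump, deriv_smoothStep_of_gt this]

lemma cauchyBump_nonneg (w : ℂ) : 0 ≤ cauchyBump δ w :=
  mul_nonneg (by positivity) (deriv_smoothStep_nonneg _)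

lemma cutCauchy_eventually_zero :
    cutCauchy δ =ᶠ[nhds 0] fun _ => 0 := by
  have h : Filter.Tendsto (fun w : ℂ => ‖w‖ ^ 2 / δ ^ 2) (nhds 0) (nhds 0) := by
    have : Continuous fun w : ℂ => ‖w‖ ^ 2 / δ ^ 2 := by fun_prop
    simpa using this.tendsto 0
  filter_upwards [h.eventually (gt_mem_nhds (show (0 : ℝ) < 1 / 2 by norm_num))] with w hw
  simp [cutCauchy, smoothStep_of_le hw.le]

lemma contDiff_smoothStep_norm (n : ℕ∞) :
    ContDiff ℝ n fun w : ℂ => smoothStep (‖w‖ ^ 2 / δ ^ 2) :=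
  contDiff_smoothStep.comp ((contDiff_norm_sq ℝ).div_const _)

lemma contDiff_cutCauchy : ContDiff ℝ (⊤ : ℕ∞) (cutCauchy δ) := by
  rw [contDiff_iff_contDiffAt]
  intro w
  by_cases hw : w = 0
  · subst hw
    exact contDiffAt_const.congr_of_eventuallyEq (cutCauchy_eventually_zero)
  · exact (contDiffAt_inv ℝ hw).mul
      (Complex.ofRealCLM.contDiff.comp (contDiff_smoothStep_norm _)).contDiffAt

lemma dbar_cutCauchy (w : ℂ) : dbar (cutCauchy δ) w = (cauchyBump δ w : ℝ) := by
  by_cases hw : w = 0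
  · subst hw
    rw [dbar_congr (cutCauchy_eventually_zero)]
    simp [dbar, cauchyBump, deriv_smoothStep_of_lt (show (0 : ℝ) < 1 / 2 by norm_num)]
  · have h1 : DifferentiableAt ℂ (fun w : ℂ => w⁻¹) w := differentiableAt_inv hw
    have hs : HasFDerivAt (fun w : ℂ => ((smoothStep (‖w‖ ^ 2 / δ ^ 2) : ℝ) : ℂ))
        (Complex.ofRealCLM.comp (deriv smoothStep (‖w‖ ^ 2 / δ ^ 2) •
          ((δ ^ 2)⁻¹ • (2 • innerSL ℝ w)))) w := by
      have h2 : HasFDerivAt (fun w : ℂ => ‖w‖ ^ 2 / δ ^ 2) ((δ ^ 2)⁻¹ • (2 • innerSL ℝ w)) w := by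
        have := (hasStrictFDerivAt_norm_sq w).hasFDerivAt.const_mul (δ ^ 2)⁻¹
        refine this.congr_of_eventuallyEq (Filter.Eventually.of_forall fun z => ?_)
        simp only [div_eq_inv_mul]
      have h3 : HasDerivAt smoothStep (deriv smoothStep (‖w‖ ^ 2 / δ ^ 2)) (‖w‖ ^ 2 / δ ^ 2) :=
        ((contDiff_smoothStep (n := 1)).differentiable one_ne_zero _).hasDerivAt
      have h4 := HasDerivAt.comp_hasFDerivAt w h3 h2
      exact Complex.ofRealCLM.hasFDerivAt.comp w h4
    have := dbar_mul (h1.restrictScalars ℝ) hs.differentiableAt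
    rw [dbar_eq_zero_of_differentiableAt h1, zero_mul, zero_add] at this
    refine this.trans ?_
    simp only [dbar, hs.fderiv, cauchyBump]
    have hre : ((w.re : ℝ) : ℂ) + w.im * Complex.I = w := Complex.re_add_im w
    simp [Complex.inner]
    field_simp
    linear_combination ((deriv smoothStep (‖w‖ ^ 2 / δ ^ 2) : ℝ) : ℂ) * ((δ : ℂ) ^ 2)⁻¹ * hre

/-- The mass of the mollifiers `cauchyBump δ`, which does not depend on `δ`. -/
def bumpMass : ℝ := ∫ w : ℂ, cauchyBump 1 w

lemma continuous_cauchyBump : Continuous (cauchyBump δ) := by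
  have := continuous_deriv_smoothStep
  unfold cauchyBump
  fun_prop

lemma bumpMass_pos : 0 < bumpMass := by
  -- the step is not constant, so its derivative does not vanish identically
  obtain ⟨t, ht, hd⟩ : ∃ t ∈ Set.Ioo (0 : ℝ) 1, deriv smoothStep t = 1 := by
    obtain ⟨t, ht, h⟩ := exists_deriv_eq_slope smoothStep (zero_lt_one' ℝ)
      (contDiff_smoothStep (n := 1)).continuous.continuousOn
      ((contDiff_smoothStep (n := 1)).differentiable one_ne_zero).differentiableOn
    refine ⟨t, ht, ?_⟩
    rw [h, smoothStep_of_le (show (0 : ℝ) ≤ 1 / 2 by norm_num), smoothStep_of_ge le_rfl]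
    norm_num
  refine Continuous.integral_pos_of_hasCompactSupport_nonneg_nonzero (x := ((√t : ℝ) : ℂ))
    continuous_cauchyBump ?_ (fun w => ?_) ?_
  · refine HasCompactSupport.intro (isCompact_closedBall (0 : ℂ) 1) fun w hw => ?_
    exact cauchyBump_of_lt one_pos (by simpa using hw)
  · exact cauchyBump_nonneg w
  · simp [cauchyBump, Real.sq_sqrt ht.1.le, hd]

lemma integral_cauchyBump (hδ : 0 < δ) (ζ : ℂ) : ∫ z, cauchyBump δ (z - ζ) = bumpMass := by
  rw [integral_sub_right_eq_self (cauchyBump δ) ζ]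
  have h : ∀ w : ℂ, cauchyBump δ w = (δ ^ 2)⁻¹ * cauchyBump 1 (δ⁻¹ • w) := fun w => by
    simp [cauchyBump, abs_of_pos hδ, div_eq_inv_mul, mul_pow]
  simp only [h]
  rw [integral_const_mul, Measure.integral_comp_inv_smul, Complex.finrank_real_complex, bumpMass,
    abs_of_pos (by positivity), smul_eq_mul, ← mul_assoc, inv_mul_cancel₀ (by positivity), one_mul]

lemma exists_cauchyBump_le : ∃ M, 0 ≤ M ∧ ∀ δ (w : ℂ), 0 < δ → cauchyBump δ w ≤ M * (δ ^ 2)⁻¹ := by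
  have hc : HasCompactSupport (deriv smoothStep) :=
    HasCompactSupport.intro (isCompact_Icc (a := (0 : ℝ)) (b := 1)) fun t ht => by
      rw [Set.mem_Icc, not_and_or, not_le, not_le] at ht
      rcases ht with h | h
      · exact deriv_smoothStep_of_lt (by linarith)
      · exact deriv_smoothStep_of_gt h
  obtain ⟨M, hM⟩ := hc.exists_bound_of_continuous continuous_deriv_smoothStep
  refine ⟨M, (norm_nonneg _).trans (hM 0), fun δ w hδ => ?_⟩
  rw [cauchyBump, mul_comm M]
  exact mul_le_mul_of_nonneg_left ((le_abs_self _).trans (hM _)) (by positivity)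

variable {f : ℂ → ℂ}

/-- Testing a weak solution of `∂̄f = 0` against a cut-off Cauchy kernel: all mollifications of
`f` at `ζ` agree with a Cauchy-type integral over the region where the cut-off `χ` varies. -/
lemma integral_mul_cauchyBump
    (hf : Integrable f) (hweak : ∀ φ : ℂ → ℂ, ContDiff ℝ (⊤ : ℕ∞) φ → HasCompactSupport φ →
      tsupport φ ⊆ ball 0 1 → ∫ z, f z * dbar φ z = 0)
    (χ : ContDiffBump (0 : ℂ)) (hχ : χ.rOut < 1) {ζ : ℂ} (hδ : 0 < δ) (hζ : δ ≤ χ.rIn - ‖ζ‖) :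
    ∫ z, f z * (cauchyBump δ (z - ζ) : ℝ) =
      -∫ z, f z * dbar (fun w => (χ w : ℂ)) z * (z - ζ)⁻¹ := by
  have hχs : ContDiff ℝ (⊤ : ℕ∞) fun w => (χ w : ℂ) := Complex.ofRealCLM.contDiff.comp χ.contDiff
  have hKs : ContDiff ℝ (⊤ : ℕ∞) fun w => cutCauchy δ (w - ζ) :=
    (contDiff_cutCauchy).comp (contDiff_id.sub contDiff_const)
  have hsub : tsupport (fun w => (χ w : ℂ)) ⊆ closedBall 0 χ.rOut := by
    rw [← χ.tsupport_eq]
    refine closure_mono fun w hw => ?_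
    simpa using hw
  have hts : tsupport (fun w => (χ w : ℂ) * cutCauchy δ (w - ζ)) ⊆ closedBall 0 χ.rOut :=
    (closure_mono (Function.support_mul_subset_left _ _)).trans hsub
  have h0 := hweak (fun w => (χ w : ℂ) * cutCauchy δ (w - ζ)) (hχs.mul hKs)
    (HasCompactSupport.of_support_subset_isCompact (isCompact_closedBall (0 : ℂ) χ.rOut)
      (subset_closure.trans hts))
    (hts.trans (closedBall_subset_ball hχ))
  have hdχ : ∀ z, ‖z‖ < χ.rIn → dbar (fun w => (χ w : ℂ)) z = 0 := fun z hz => by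
    have : (fun w => (χ w : ℂ)) =ᶠ[nhds z] fun _ => 1 := by
      filter_upwards [isOpen_ball.mem_nhds (show z ∈ ball (0 : ℂ) χ.rIn by simpa using hz)] with w hw
      rw [χ.one_of_mem_closedBall (ball_subset_closedBall hw), Complex.ofReal_one]
    rw [dbar_congr this]
    simp [dbar]
  have hpt : ∀ z, f z * dbar (fun w => (χ w : ℂ) * cutCauchy δ (w - ζ)) z =
      f z * dbar (fun w => (χ w : ℂ)) z * (z - ζ)⁻¹ + f z * (cauchyBump δ (z - ζ) : ℝ) := fun z => by
    rw [dbar_mul (hχs.differentiable (by simp) z) (hKs.differentiable (by simp) z),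
      dbar_comp_sub, dbar_cutCauchy]
    have htri : ‖z‖ ≤ ‖z - ζ‖ + ‖ζ‖ := by simpa using norm_add_le (z - ζ) ζ
    have e1 : dbar (fun w => (χ w : ℂ)) z * cutCauchy δ (z - ζ) =
        dbar (fun w => (χ w : ℂ)) z * (z - ζ)⁻¹ := by
      rcases lt_or_ge ‖z‖ χ.rIn with h | h
      · rw [hdχ z h, zero_mul, zero_mul]
      · rw [cutCauchy_of_le hδ (by linarith)]
    have e2 : (χ z : ℂ) * (cauchyBump δ (z - ζ) : ℝ) = (cauchyBump δ (z - ζ) : ℝ) := by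
      rcases lt_or_ge δ ‖z - ζ‖ with h | h
      · rw [cauchyBump_of_lt hδ h]; simp
      · rw [χ.one_of_mem_closedBall (by simpa using (by linarith : ‖z‖ ≤ χ.rIn))]
        simp
    rw [e1, e2]
    ring
  simp only [hpt] at h0
  have hbd : ∀ g : ℂ → ℂ, Continuous g → HasCompactSupport g → Integrable fun z => f z * g z :=
    fun g hg hgc => by
    obtain ⟨C, hC⟩ := hgc.exists_bound_of_continuous hg
    exact hf.mul_bdd (c := C) hg.aestronglyMeasurable (Filter.Eventually.of_forall hC)
  have i2 : Integrable fun z => f z * (cauchyBump δ (z - ζ) : ℝ) := by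
    refine hbd _ ?_ (HasCompactSupport.intro (isCompact_closedBall ζ δ) fun z hz => ?_)
    · have := continuous_cauchyBump (δ := δ)
      fun_prop
    · rw [cauchyBump_of_lt hδ (by simpa [dist_eq_norm] using hz)]; simp
  have i1 : Integrable fun z => f z * dbar (fun w => (χ w : ℂ)) z * (z - ζ)⁻¹ := by
    have h3 : Integrable fun z => f z * dbar (fun w => (χ w : ℂ) * cutCauchy δ (w - ζ)) z := by
      refine hbd _ (continuous_dbar ((hχs.mul hKs).of_le (by exact_mod_cast le_top)))
        (HasCompactSupport.intro (isCompact_closedBall (0 : ℂ) χ.rOut) fun z hz => ?_)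
      rw [dbar, fderiv_eq_zero_off isClosed_closedBall (fun w hw =>
        image_eq_zero_of_notMem_tsupport fun h => hw (hts h)) hz]
      simp
    have h4 := h3.sub i2
    refine h4.congr (Filter.Eventually.of_forall fun z => ?_)
    simp only [Pi.sub_apply, hpt]
    ring
  rw [integral_add i1 i2] at h0
  linear_combination h0

/-- The Cauchy-type integral is analytic on the disks on which the cut-off `χ` is constant. -/
lemma differentiableOn_cauchy_integral (hf : Integrable f)
    (χ : ContDiffBump (0 : ℂ)) {r : ℝ} (hr : r < χ.rIn) :
    DifferentiableOn ℂ (fun ζ => ∫ z, f z * dbar (fun w => (χ w : ℂ)) z * (z - ζ)⁻¹)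
      (ball 0 r) := by
  have hχs : ContDiff ℝ (⊤ : ℕ∞) fun w => (χ w : ℂ) := Complex.ofRealCLM.contDiff.comp χ.contDiff
  have hcd : Continuous (dbar fun w => (χ w : ℂ)) :=
    continuous_dbar (hχs.of_le (by exact_mod_cast le_top))
  have hsub : tsupport (fun w => (χ w : ℂ)) ⊆ closedBall 0 χ.rOut := by
    rw [← χ.tsupport_eq]
    refine closure_mono fun w hw => ?_
    simpa using hw
  have hcs : HasCompactSupport (dbar fun w => (χ w : ℂ)) :=
    HasCompactSupport.intro (isCompact_closedBall (0 : ℂ) χ.rOut) fun z hz => by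
      rw [dbar, fderiv_eq_zero_off isClosed_closedBall (fun w hw =>
        image_eq_zero_of_notMem_tsupport fun h => hw (hsub h)) hz]
      simp
  obtain ⟨C, hC⟩ := hcs.exists_bound_of_continuous hcd
  have hdχ : ∀ z, ‖z‖ < χ.rIn → dbar (fun w => (χ w : ℂ)) z = 0 := fun z hz => by
    have : (fun w => (χ w : ℂ)) =ᶠ[nhds z] fun _ => 1 := by
      filter_upwards [isOpen_ball.mem_nhds (show z ∈ ball (0 : ℂ) χ.rIn by simpa using hz)] with w hw
      rw [χ.one_of_mem_closedBall (ball_subset_closedBall hw), Complex.ofReal_one]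
    rw [dbar_congr this]
    simp [dbar]
  have hF : Integrable fun z => f z * dbar (fun w => (χ w : ℂ)) z :=
    hf.mul_bdd (c := C) hcd.aestronglyMeasurable (Filter.Eventually.of_forall hC)
  set F := fun z => f z * dbar (fun w => (χ w : ℂ)) z with hFdef
  have hF0 : ∀ z, ‖z‖ < χ.rIn → F z = 0 := fun z hz => by simp [hFdef, hdχ z hz]
  have hfar : ∀ ζ ∈ ball (0 : ℂ) r, ∀ z, χ.rIn ≤ ‖z‖ → χ.rIn - r ≤ ‖z - ζ‖ := by
    intro ζ hζ z hz
    have h1 : ‖ζ‖ < r := by simpa using hζ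
    have : ‖z‖ ≤ ‖z - ζ‖ + ‖ζ‖ := by simpa using norm_add_le (z - ζ) ζ
    linarith
  have hρ : 0 < χ.rIn - r := sub_pos.2 hr
  intro ζ₀ hζ₀
  have hmeas : ∀ ζ, AEStronglyMeasurable (fun z => F z * (z - ζ)⁻¹) := fun ζ =>
    hF.1.mul (Measurable.aestronglyMeasurable (by fun_prop))
  have key := hasDerivAt_integral_of_dominated_loc_of_deriv_le (𝕜 := ℂ) (μ := volume)
    (F := fun ζ z => F z * (z - ζ)⁻¹) (F' := fun ζ z => F z * ((z - ζ) ^ 2)⁻¹)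
    (x₀ := ζ₀) (s := ball 0 r) (bound := fun z => ‖F z‖ * ((χ.rIn - r) ^ 2)⁻¹)
    (isOpen_ball.mem_nhds hζ₀) (Filter.Eventually.of_forall hmeas) ?_ ?_ ?_ ?_ ?_
  · exact key.2.differentiableAt.differentiableWithinAt
  · refine (hF.norm.mul_const (χ.rIn - r)⁻¹).mono' (hmeas _) (Filter.Eventually.of_forall fun z => ?_)
    rw [norm_mul, norm_inv]
    rcases lt_or_ge ‖z‖ χ.rIn with h | h
    · simp [hF0 z h]
    · exact mul_le_mul_of_nonneg_left (inv_anti₀ hρ (hfar ζ₀ hζ₀ z h)) (norm_nonneg _)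
  · exact hF.1.mul (Measurable.aestronglyMeasurable (by fun_prop))
  · refine Filter.Eventually.of_forall fun z ζ hζ => ?_
    rw [norm_mul, norm_inv, norm_pow]
    rcases lt_or_ge ‖z‖ χ.rIn with h | h
    · simp [hF0 z h]
    · exact mul_le_mul_of_nonneg_left (inv_anti₀ (by positivity)
        (pow_le_pow_left₀ hρ.le (hfar ζ hζ z h) 2)) (norm_nonneg _)
  · exact hF.norm.mul_const _
  · refine Filter.Eventually.of_forall fun z ζ hζ => ?_
    rcases lt_or_ge ‖z‖ χ.rIn with h | h
    · simpa [hF0 z h] using hasDerivAt_const ζ (0 : ℂ)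
    · have hne : z - ζ ≠ 0 := norm_pos_iff.1 (hρ.trans_le (hfar ζ hζ z h))
      have := (((hasDerivAt_id ζ).const_sub z).inv hne).const_mul (F z)
      simpa using this

/-- Mollifications converge at Lebesgue points. -/
lemma ae_tendsto_integral_mul_cauchyBump (hf : Integrable f) :
    ∀ᵐ ζ, Filter.Tendsto (fun n : ℕ => ∫ z, f z * (cauchyBump ((n : ℝ) + 1)⁻¹ (z - ζ) : ℝ))
      Filter.atTop (nhds (f ζ * bumpMass)) := by
  obtain ⟨M, hM0, hM⟩ := exists_cauchyBump_le
  filter_upwards [IsUnifLocDoublingMeasure.ae_tendsto_average_norm_sub volume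
    hf.locallyIntegrable 1] with ζ hζ
  have hδ : ∀ n : ℕ, 0 < ((n : ℝ) + 1)⁻¹ := fun n => by positivity
  have hlim : Filter.Tendsto (fun n : ℕ => ((n : ℝ) + 1)⁻¹) Filter.atTop (nhdsWithin 0 (Set.Ioi 0)) :=
    tendsto_nhdsWithin_iff.2 ⟨by simpa using tendsto_one_div_add_atTop_nhds_zero_nat (𝕜 := ℝ),
      Filter.Eventually.of_forall hδ⟩
  have h := hζ (fun _ : ℕ => ζ) (fun n => ((n : ℝ) + 1)⁻¹) hlim
    (Filter.Eventually.of_forall fun n => by simpa using (hδ n).le)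
  rw [tendsto_iff_norm_sub_tendsto_zero]
  have h2 := h.const_mul (M * Real.pi)
  rw [mul_zero] at h2
  refine squeeze_zero (fun _ => norm_nonneg _) (fun n => ?_) h2
  set δ := ((n : ℝ) + 1)⁻¹ with hδdef
  have hδ0 : 0 < δ := hδ n
  have hcb : Continuous fun z : ℂ => (cauchyBump δ (z - ζ) : ℂ) := by
    have := continuous_cauchyBump (δ := δ)
    fun_prop
  have hcs : HasCompactSupport fun z : ℂ => (cauchyBump δ (z - ζ) : ℂ) :=
    HasCompactSupport.intro (isCompact_closedBall ζ δ) fun z hz => by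
      rw [cauchyBump_of_lt hδ0 (by simpa [dist_eq_norm] using hz)]; simp
  have i1 : Integrable fun z => f z * (cauchyBump δ (z - ζ) : ℂ) := by
    obtain ⟨C, hC⟩ := hcs.exists_bound_of_continuous hcb
    exact hf.mul_bdd (c := C) hcb.aestronglyMeasurable (Filter.Eventually.of_forall hC)
  have i2 : Integrable fun z => f ζ * (cauchyBump δ (z - ζ) : ℂ) :=
    (hcb.integrable_of_hasCompactSupport hcs).const_mul _
  have e1 : f ζ * (bumpMass : ℂ) = ∫ z, f ζ * (cauchyBump δ (z - ζ) : ℂ) := by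
    rw [integral_const_mul, integral_complex_ofReal, integral_cauchyBump hδ0]
  rw [e1, ← integral_sub i1 i2]
  have hion : IntegrableOn (fun z => ‖f z - f ζ‖) (closedBall ζ δ) :=
    (hf.integrableOn.sub (integrableOn_const measure_closedBall_lt_top.ne)).norm
  have hvol : volume.real (closedBall ζ δ) = δ ^ 2 * Real.pi := by
    rw [Measure.real, Complex.volume_closedBall]
    simp [hδ0.le]
  calc ‖∫ z, (f z * (cauchyBump δ (z - ζ) : ℂ) - f ζ * (cauchyBump δ (z - ζ) : ℂ))‖
      = ‖∫ z in closedBall ζ δ,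
          (f z * (cauchyBump δ (z - ζ) : ℂ) - f ζ * (cauchyBump δ (z - ζ) : ℂ))‖ := by
        rw [setIntegral_eq_integral_of_forall_compl_eq_zero]
        intro z hz
        rw [cauchyBump_of_lt hδ0 (by simpa [dist_eq_norm] using hz)]
        simp
    _ ≤ ∫ z in closedBall ζ δ, M * (δ ^ 2)⁻¹ * ‖f z - f ζ‖ := by
        refine norm_integral_le_of_norm_le (hion.const_mul _) (Filter.Eventually.of_forall fun z => ?_)
        rw [← sub_mul, norm_mul, Complex.norm_real, mul_comm]
        refine mul_le_mul_of_nonneg_right ?_ (norm_nonneg _)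
        rw [Real.norm_of_nonneg (cauchyBump_nonneg _)]
        exact hM δ _ hδ0
    _ = M * Real.pi * ⨍ z in closedBall ζ δ, ‖f z - f ζ‖ := by
        rw [integral_const_mul, setAverage_eq, hvol, smul_eq_mul]
        have := Real.pi_pos
        field_simp

/-- Weyl's lemma for `∂̄` on the disk: an integrable weak solution of `∂̄f = 0` is analytic. -/
theorem exists_analytic_of_weak (hf : Integrable f)
    (hweak : ∀ φ : ℂ → ℂ, ContDiff ℝ (⊤ : ℕ∞) φ → HasCompactSupport φ →
      tsupport φ ⊆ ball 0 1 → ∫ z, f z * dbar φ z = 0) :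
    ∃ g : ℂ → ℂ, DifferentiableOn ℂ g (ball 0 1) ∧ f =ᵐ[volume.restrict (ball 0 1)] g := by
  let g : ℂ → ℂ := fun ζ => (bumpMass : ℂ)⁻¹ * ∫ z, f z * (cauchyBump ((1 - ‖ζ‖) / 2) (z - ζ) : ℝ)
  -- For `‖ζ‖ < r` a cut-off equal to `1` up to the radius `(1 + r) / 2` leaves room for
  -- mollification at the scale `(1 - ‖ζ‖) / 2`.
  have hχ : ∀ r : ℝ, r < 1 → 0 ≤ r → ∃ χ : ContDiffBump (0 : ℂ), χ.rIn = (1 + r) / 2 ∧ χ.rOut < 1 :=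
    fun r hr hr0 => ⟨⟨(1 + r) / 2, (3 + r) / 4, by linarith, by linarith⟩, rfl, by
      show (3 + r) / 4 < 1
      linarith⟩
  have hg : ∀ r : ℝ, r < 1 → 0 ≤ r → ∀ χ : ContDiffBump (0 : ℂ), χ.rIn = (1 + r) / 2 → χ.rOut < 1 →
      ∀ ζ, ‖ζ‖ < r → g ζ = -((bumpMass : ℂ)⁻¹ *
        ∫ z, f z * dbar (fun w => (χ w : ℂ)) z * (z - ζ)⁻¹) := by
    intro r hr hr0 χ h1 h2 ζ hζ
    simp only [g]
    rw [integral_mul_cauchyBump hf hweak χ h2 (by linarith) (by rw [h1]; linarith), mul_neg]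
  have hbm : (bumpMass : ℂ) ≠ 0 := Complex.ofReal_ne_zero.2 bumpMass_pos.ne'
  refine ⟨g, fun ζ hζ => ?_, ?_⟩
  · have hζ1 : ‖ζ‖ < 1 := by simpa using hζ
    have hr0 := norm_nonneg ζ
    obtain ⟨χ, h1, h2⟩ := hχ ((1 + ‖ζ‖) / 2) (by linarith) (by linarith)
    have hmem : ζ ∈ ball (0 : ℂ) ((1 + ‖ζ‖) / 2) := by
      simp only [mem_ball, dist_zero_right]
      linarith
    have hd := (differentiableOn_cauchy_integral hf χ (r := (1 + ‖ζ‖) / 2)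
      (by rw [h1]; linarith)).differentiableAt (isOpen_ball.mem_nhds hmem)
    refine DifferentiableAt.differentiableWithinAt ?_
    refine ((hd.const_mul (bumpMass : ℂ)⁻¹).neg).congr_of_eventuallyEq ?_
    filter_upwards [isOpen_ball.mem_nhds hmem] with w hw
    exact hg _ (by linarith) (by linarith) χ h1 h2 w (by simpa using hw)
  · rw [Filter.EventuallyEq, ae_restrict_iff' isOpen_ball.measurableSet]
    filter_upwards [ae_tendsto_integral_mul_cauchyBump hf] with ζ hζ hζb
    have hζ1 : ‖ζ‖ < 1 := by simpa using hζb
    have hr0 := norm_nonneg ζ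
    obtain ⟨χ, h1, h2⟩ := hχ ((1 + ‖ζ‖) / 2) (by linarith) (by linarith)
    have hev : (fun n : ℕ => ∫ z, f z * (cauchyBump ((n : ℝ) + 1)⁻¹ (z - ζ) : ℝ))
        =ᶠ[Filter.atTop] fun _ => bumpMass * g ζ := by
      have hsmall := (tendsto_one_div_add_atTop_nhds_zero_nat (𝕜 := ℝ)).eventually
        (gt_mem_nhds (show (0 : ℝ) < (1 - ‖ζ‖) / 2 by linarith))
      filter_upwards [hsmall] with n hn
      rw [one_div] at hn
      rw [integral_mul_cauchyBump hf hweak χ h2 (by positivity) (by rw [h1]; linarith),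
        hg _ (by linarith) (by linarith) χ h1 h2 ζ (by linarith), mul_neg, ← mul_assoc,
        mul_inv_cancel₀ hbm, one_mul]
    have := tendsto_nhds_unique hζ ((Filter.tendsto_congr' hev).2 tendsto_const_nhds)
    rw [mul_comm] at this
    exact mul_left_cancel₀ hbm this

end Weyl

/-! ### Integrals in the weighted spaces -/

section Weighted

open Metric

lemma ae_diskMeasure_iff (δ : ℝ) {p : ℂ → Prop} :
    (∀ᵐ z ∂diskMeasure δ, p z) ↔ ∀ᵐ z ∂volume.restrict (ball (0 : ℂ) 1), p z := by
  refine ⟨fun h => ?_, fun h => (withDensity_absolutelyContinuous _ _).ae_le h⟩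
  refine Measure.AbsolutelyContinuous.ae_le ?_ h
  refine withDensity_absolutelyContinuous' (measurable_bdf_rpow δ).ennreal_ofReal.aemeasurable ?_
  refine (ae_restrict_mem isOpen_ball.measurableSet).mono fun z hz => ?_
  simpa using Real.rpow_pos_of_pos (bdf_pos hz) δ

lemma ae_mem_ball (δ : ℝ) : ∀ᵐ z ∂diskMeasure δ, z ∈ ball (0 : ℂ) 1 :=
  (ae_diskMeasure_iff δ).2 (ae_restrict_mem isOpen_ball.measurableSet)

lemma lintegral_diskMeasure (δ : ℝ) (g : ℂ → ENNReal) :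
    ∫⁻ z, g z ∂diskMeasure δ = ∫⁻ z in ball (0 : ℂ) 1, ENNReal.ofReal (bdf z ^ δ) * g z :=
  lintegral_withDensity_eq_lintegral_mul_non_measurable _
    (measurable_bdf_rpow δ).ennreal_ofReal (by simp) g

lemma integral_diskMeasure (δ : ℝ) {E : Type*} [NormedAddCommGroup E] [NormedSpace ℝ E]
    (g : ℂ → E) : ∫ z, g z ∂diskMeasure δ = ∫ z in ball (0 : ℂ) 1, (bdf z ^ δ) • g z := by
  rw [diskMeasure, integral_withDensity_eq_integral_toReal_smul
    (measurable_bdf_rpow δ).ennreal_ofReal (by simp)]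
  refine setIntegral_congr_fun isOpen_ball.measurableSet fun z hz => ?_
  simp only [ENNReal.toReal_ofReal (Real.rpow_pos_of_pos (bdf_pos hz) δ).le]

/-- For `δ > -1` the weight `d^δ` has finite mass. -/
lemma diskMeasure_univ_lt_top {δ : ℝ} (hδ : -1 < δ) : diskMeasure δ Set.univ < ⊤ := by
  -- the weight is at most `1 + (1 - |z|)^δ`
  let w : ℝ → ℝ := fun r => if r < 1 then 1 + (1 - r) ^ δ else 0
  have hw : Integrable fun z : ℂ => w ‖z‖ := by
    rw [integrable_fun_norm_addHaar (volume : Measure ℂ), Complex.finrank_real_complex]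
    have h1 : IntegrableOn (fun r : ℝ => r * (1 + (1 - r) ^ δ)) (Set.Ioo 0 1) := by
      have h0 : IntervalIntegrable (fun r : ℝ => (1 - r) ^ δ) volume 0 1 := by
        have := (intervalIntegral.intervalIntegrable_rpow' (a := 0) (b := 1) hδ).comp_sub_left 1
        simpa using this.symm
      have h2 : IntervalIntegrable (fun r : ℝ => r * (1 + (1 - r) ^ δ)) volume 0 1 :=
        ((_root_.intervalIntegrable_const (c := (1 : ℝ))).add h0).continuousOn_mul
          continuousOn_id
      exact (intervalIntegrable_iff_integrableOn_Ioo_of_le zero_le_one).1 h2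
    have h3 : IntegrableOn (fun r : ℝ => r ^ (2 - 1) • w r) (Set.Ioo 0 1) :=
      h1.congr_fun (fun r hr => by simp [w, hr.2]) measurableSet_Ioo
    have h4 : IntegrableOn (fun r : ℝ => r ^ (2 - 1) • w r) (Set.Ici 1) := by
      refine (integrableOn_zero (ε' := ℝ)).congr_fun (fun r hr => ?_) measurableSet_Ici
      simp [w, not_lt.2 (Set.mem_Ici.1 hr)]
    rw [← Set.Ioo_union_Ici_eq_Ioi zero_lt_one]
    exact h3.union h4
  rw [← lintegral_one, lintegral_diskMeasure]
  refine lt_of_le_of_lt ?_ hw.lintegral_lt_top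
  refine (setLIntegral_mono_ae' isOpen_ball.measurableSet
    (Filter.Eventually.of_forall fun z hz => ?_)).trans (setLIntegral_le_lintegral _ _)
  rw [mul_one]
  refine ENNReal.ofReal_le_ofReal ?_
  have h1 : ‖z‖ < 1 := by simpa using hz
  have h0 := norm_nonneg z
  simp only [w, if_pos h1]
  rcases le_or_gt 0 δ with h | h
  · have h2 : bdf z ^ δ ≤ 1 := by
      refine Real.rpow_le_one (bdf_pos hz).le ?_ h
      unfold bdf
      nlinarith
    have := Real.rpow_nonneg (sub_nonneg.2 h1.le) δ
    linarith
  · have h2 : bdf z ^ δ ≤ (1 - ‖z‖) ^ δ := by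
      refine Real.rpow_le_rpow_of_nonpos (sub_pos.2 h1) ?_ h.le
      unfold bdf
      nlinarith
    linarith

lemma isFiniteMeasure_diskMeasure {δ : ℝ} (hδ : -1 < δ) : IsFiniteMeasure (diskMeasure δ) :=
  ⟨diskMeasure_univ_lt_top hδ⟩

lemma enorm_L2_eq {δ : ℝ} (u : L2 δ) :
    ‖u‖ₑ = (∫⁻ z in ball (0 : ℂ) 1, ENNReal.ofReal (bdf z ^ δ) * ‖u z‖ₑ ^ 2) ^ (1 / 2 : ℝ) := by
  rw [Lp.enorm_def, eLpNorm_eq_lintegral_rpow_enorm_toReal two_ne_zero ENNReal.ofNat_ne_top,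
    lintegral_diskMeasure]
  simp

/-- `L²_δ(𝔻)` embeds into `L¹(𝔻, d^a)` when `2a - δ > -1`. -/
lemma exists_lintegral_le_enorm {a δ : ℝ} (h : -1 < 2 * a - δ) :
    ∃ C : ENNReal, C ≠ ⊤ ∧ ∀ u : L2 δ,
      ∫⁻ z in ball (0 : ℂ) 1, ‖u z‖ₑ * ENNReal.ofReal (bdf z ^ a) ≤ ‖u‖ₑ * C := by
  refine ⟨(diskMeasure (2 * a - δ) Set.univ) ^ (1 / 2 : ℝ),
    ENNReal.rpow_ne_top_of_nonneg (by norm_num) (diskMeasure_univ_lt_top h).ne, fun u => ?_⟩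
  have hm : ∀ t : ℝ, AEMeasurable (fun z => ENNReal.ofReal (bdf z ^ t))
      (volume.restrict (ball (0 : ℂ) 1)) := fun t =>
    (measurable_bdf_rpow t).ennreal_ofReal.aemeasurable
  have hu : AEMeasurable (fun z => ‖u z‖ₑ) (volume.restrict (ball (0 : ℂ) 1)) :=
    (Lp.stronglyMeasurable u).measurable.enorm.aemeasurable
  have hold := ENNReal.lintegral_mul_le_Lp_mul_Lq (volume.restrict (ball (0 : ℂ) 1))
    Real.HolderConjugate.two_two (hu.mul (hm (δ / 2))) (hm (a - δ / 2))
  have hsq : ∀ z ∈ ball (0 : ℂ) 1, ∀ t : ℝ, ENNReal.ofReal (bdf z ^ t) ^ 2 =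
      ENNReal.ofReal (bdf z ^ (2 * t)) := fun z hz t => by
    rw [← ENNReal.ofReal_pow (Real.rpow_pos_of_pos (bdf_pos hz) t).le, ← Real.rpow_natCast,
      ← Real.rpow_mul (bdf_pos hz).le, mul_comm]
    norm_num
  have e0 : ∫⁻ z in ball (0 : ℂ) 1, ‖u z‖ₑ * ENNReal.ofReal (bdf z ^ a) =
      ∫⁻ z in ball (0 : ℂ) 1, (((fun z => ‖u z‖ₑ) * fun z => ENNReal.ofReal (bdf z ^ (δ / 2))) *
        fun z => ENNReal.ofReal (bdf z ^ (a - δ / 2))) z := by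
    refine setLIntegral_congr_fun isOpen_ball.measurableSet fun z hz => ?_
    simp only [Pi.mul_apply]
    rw [mul_assoc, ← ENNReal.ofReal_mul (Real.rpow_pos_of_pos (bdf_pos hz) _).le,
      ← Real.rpow_add (bdf_pos hz)]
    ring_nf
  have e1 : ∫⁻ z in ball (0 : ℂ) 1,
      (((fun z => ‖u z‖ₑ) * fun z => ENNReal.ofReal (bdf z ^ (δ / 2))) z) ^ (2 : ℝ) =
      ∫⁻ z in ball (0 : ℂ) 1, ENNReal.ofReal (bdf z ^ δ) * ‖u z‖ₑ ^ 2 := by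
    refine setLIntegral_congr_fun isOpen_ball.measurableSet fun z hz => ?_
    simp only [Pi.mul_apply, ENNReal.rpow_two, mul_pow]
    rw [hsq z hz, mul_comm]
    ring_nf
  have e2 : ∫⁻ z in ball (0 : ℂ) 1, ENNReal.ofReal (bdf z ^ (a - δ / 2)) ^ (2 : ℝ) =
      diskMeasure (2 * a - δ) Set.univ := by
    rw [← lintegral_one, lintegral_diskMeasure]
    refine setLIntegral_congr_fun isOpen_ball.measurableSet fun z hz => ?_
    simp only [ENNReal.rpow_two]
    rw [hsq z hz, mul_one]
    ring_nf
  rw [e0, enorm_L2_eq]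
  rwa [e1, e2] at hold

lemma integrable_indicator_L2 {a δ : ℝ} (h : -1 < 2 * a - δ) (u : L2 δ) :
    Integrable ((ball (0 : ℂ) 1).indicator fun z => u z * ((bdf z ^ a : ℝ) : ℂ)) := by
  obtain ⟨C, hC, hle⟩ := exists_lintegral_le_enorm h
  have hm : StronglyMeasurable fun z => u z * ((bdf z ^ a : ℝ) : ℂ) :=
    (Lp.stronglyMeasurable u).mul
      (Complex.measurable_ofReal.comp (measurable_bdf_rpow a)).stronglyMeasurable
  rw [integrable_indicator_iff isOpen_ball.measurableSet]
  refine ⟨hm.aestronglyMeasurable, ?_⟩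
  refine lt_of_le_of_lt (le_of_eq ?_) ((hle u).trans_lt (ENNReal.mul_lt_top enorm_lt_top hC.lt_top))
  refine setLIntegral_congr_fun isOpen_ball.measurableSet fun z hz => ?_
  simp only [enorm_mul]
  congr 1
  rw [← ofReal_norm, Complex.norm_real, Real.norm_of_nonneg (Real.rpow_pos_of_pos (bdf_pos hz) _).le]

lemma norm_sq_L2 {δ : ℝ} (u : L2 δ) :
    ‖u‖ ^ 2 = ∫ z in ball (0 : ℂ) 1, bdf z ^ δ * ‖u z‖ ^ 2 := by
  have h := L2.inner_def (𝕜 := ℂ) u u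
  have h2 : (inner ℂ u u : ℂ) = ((‖u‖ ^ 2 : ℝ) : ℂ) := by
    rw [inner_self_eq_norm_sq_to_K]
    norm_cast
  rw [h2] at h
  have h3 : ∀ z, inner ℂ (u z) (u z) = ((‖u z‖ ^ 2 : ℝ) : ℂ) := fun z => by
    rw [inner_self_eq_norm_sq_to_K]
    norm_cast
  simp only [h3] at h
  rw [integral_complex_ofReal, Complex.ofReal_inj, integral_diskMeasure] at h
  simpa only [smul_eq_mul] using h

lemma norm_sq_L2_of_ae {δ : ℝ} {u : L2 δ} {g : ℂ → ℂ} {S : Set ℂ} (hS : S ⊆ ball 0 1)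
    (hu : u =ᵐ[diskMeasure δ] g) (h0 : ∀ z, z ∉ S → g z = 0) :
    ‖u‖ ^ 2 = ∫ z, bdf z ^ δ * ‖g z‖ ^ 2 := by
  have h := setIntegral_eq_integral_of_forall_compl_eq_zero (μ := volume) (s := ball (0 : ℂ) 1)
    (f := fun z => bdf z ^ δ * ‖g z‖ ^ 2) fun z hz => by
      rw [h0 z fun h => hz (hS h)]
      simp
  rw [norm_sq_L2, ← h]
  · refine integral_congr_ae ?_
    filter_upwards [(ae_diskMeasure_iff δ).1 hu] with z hz
    rw [hz]

lemma memLp_of_continuous {δ : ℝ} (hδ : -1 < δ) {g : ℂ → ℂ} (hg : Continuous g)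
    (hc : HasCompactSupport g) : MemLp g 2 (diskMeasure δ) := by
  have := isFiniteMeasure_diskMeasure hδ
  obtain ⟨C, hC⟩ := hc.exists_bound_of_continuous hg
  exact MemLp.of_bound hg.aestronglyMeasurable C (Filter.Eventually.of_forall hC)

lemma coeFn_weightMul (γ : ℝ) (u : L2 (-γ)) :
    weightMul γ u =ᵐ[diskMeasure γ] fun z => ((bdf z ^ (-γ) : ℝ) : ℂ) * u z :=
  MemLp.coeFn_toLp _

lemma norm_weightMul (γ : ℝ) (u : L2 (-γ)) : ‖weightMul γ u‖ = ‖u‖ := by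
  rw [← sq_eq_sq₀ (norm_nonneg _) (norm_nonneg _), norm_sq_L2, norm_sq_L2]
  refine integral_congr_ae ?_
  filter_upwards [(ae_diskMeasure_iff γ).1 (coeFn_weightMul γ u),
    ae_restrict_mem isOpen_ball.measurableSet] with z hz hzb
  have hp := Real.rpow_pos_of_pos (bdf_pos hzb) (-γ)
  have hpp : bdf z ^ γ * bdf z ^ (-γ) = 1 := by rw [← Real.rpow_add (bdf_pos hzb)]; simp
  rw [hz, norm_mul, Complex.norm_real, Real.norm_of_nonneg hp.le, mul_pow]
  linear_combination (bdf z ^ (-γ) * ‖u z‖ ^ 2) * hpp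

/-- Multiplication by `d^{-γ}` as a linear isometry. -/
def weightIso (γ : ℝ) : L2 (-γ) →ₗᵢ[ℂ] L2 γ where
  toFun := weightMul γ
  map_add' u v := by
    refine Lp.ext ?_
    have h : ∀ {p : ℂ → Prop}, (∀ᵐ z ∂diskMeasure (-γ), p z) → ∀ᵐ z ∂diskMeasure γ, p z :=
      fun hp => (diskMeasure_ac γ (-γ)).ae_le hp
    filter_upwards [coeFn_weightMul γ (u + v), coeFn_weightMul γ u, coeFn_weightMul γ v,
      Lp.coeFn_add (weightMul γ u) (weightMul γ v), h (Lp.coeFn_add u v)] with z h1 h2 h3 h4 h5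
    rw [h1, h4, h5, Pi.add_apply, Pi.add_apply, h2, h3, mul_add]
  map_smul' c u := by
    refine Lp.ext ?_
    have h : ∀ {p : ℂ → Prop}, (∀ᵐ z ∂diskMeasure (-γ), p z) → ∀ᵐ z ∂diskMeasure γ, p z :=
      fun hp => (diskMeasure_ac γ (-γ)).ae_le hp
    filter_upwards [coeFn_weightMul γ (c • u), coeFn_weightMul γ u,
      Lp.coeFn_smul c (weightMul γ u), h (Lp.coeFn_smul c u)] with z h1 h2 h3 h4
    simp only [RingHom.id_apply]
    rw [h1, h3, h4, Pi.smul_apply, Pi.smul_apply, h2, smul_eq_mul, smul_eq_mul]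
    ring
  norm_map' := norm_weightMul γ

end Weighted

/-! ### The splitting `L²_γ = d^{-γ} ∂ H₀^{1,-γ} ⊕ ker ∂̄` and its conjugate -/

section Splitting

open Metric

/-- The pointwise operators `∂` (`ε = 1`) and `∂̄` (`ε = -1`) on smooth functions. -/
def wirtinger (ε : ℂ) (φ : ℂ → ℂ) (z : ℂ) : ℂ :=
  (1 / 2) * (fderiv ℝ φ z 1 - ε * Complex.I * fderiv ℝ φ z Complex.I)

lemma dbar_eq_wirtinger (φ : ℂ → ℂ) : dbar φ = wirtinger (-1) φ := by
  ext z
  simp only [dbar, wirtinger]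
  ring

/-- The operators `∂` (`ε = 1`) and `∂̄` (`ε = -1`) on pairs (function, gradient). -/
def wirtingerL (δ : ℝ) (ε : ℂ) : (L2 δ × (Fin 2 → L2 δ)) →L[ℂ] L2 δ :=
  (1 / 2 : ℂ) • ((ContinuousLinearMap.proj 0).comp (ContinuousLinearMap.snd ℂ _ _) -
    (ε * Complex.I) • (ContinuousLinearMap.proj 1).comp (ContinuousLinearMap.snd ℂ _ _))

lemma wirtingerL_apply (δ : ℝ) (ε : ℂ) (w : L2 δ × (Fin 2 → L2 δ)) :
    wirtingerL δ ε w = (1 / 2 : ℂ) • (w.2 0 - (ε * Complex.I) • w.2 1) := rfl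

/-- The operators `d^{-γ} ∂` (`ε = 1`) and `d^{-γ} ∂̄` (`ε = -1`). -/
def weightedD (γ : ℝ) (ε : ℂ) : (L2 (-γ) × (Fin 2 → L2 (-γ))) →L[ℂ] L2 γ :=
  (weightIso γ).toContinuousLinearMap.comp (wirtingerL (-γ) ε)

lemma norm_weightedD (γ : ℝ) (ε : ℂ) (w : L2 (-γ) × (Fin 2 → L2 (-γ))) :
    ‖weightedD γ ε w‖ = ‖wirtingerL (-γ) ε w‖ :=
  (weightIso γ).norm_map _

lemma wirtinger_eq_zero_off {φ : ℂ → ℂ} {z : ℂ} (hz : z ∉ tsupport φ) (ε : ℂ) :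
    wirtinger ε φ z = 0 := by
  rw [wirtinger, fderiv_eq_zero_off (isClosed_tsupport φ)
    (fun w hw => image_eq_zero_of_notMem_tsupport hw) hz]
  simp

lemma wirtingerL_ae {δ : ℝ} {w : L2 δ × (Fin 2 → L2 δ)} {φ : ℂ → ℂ}
    (h : ∀ i, w.2 i =ᵐ[diskMeasure δ] fun z => fderiv ℝ φ z (coordVec i)) (ε : ℂ) :
    wirtingerL δ ε w =ᵐ[diskMeasure δ] wirtinger ε φ := by
  rw [wirtingerL_apply]
  filter_upwards [h 0, h 1, Lp.coeFn_smul (1 / 2 : ℂ) (w.2 0 - (ε * Complex.I) • w.2 1),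
    Lp.coeFn_sub (w.2 0) ((ε * Complex.I) • w.2 1), Lp.coeFn_smul (ε * Complex.I) (w.2 1)]
    with z h0 h1 h2 h3 h4
  rw [h2, Pi.smul_apply, h3, Pi.sub_apply, h4, Pi.smul_apply, h0, h1]
  simp [wirtinger, coordVec]

/-- The a priori estimate: on `H₀^{1,δ}` with `δ < 1`, either of the operators `∂`, `∂̄` controls
the full norm. -/
lemma exists_norm_le_wirtingerL {δ : ℝ} (hδ : δ < 1) :
    ∃ C : ℝ, 0 ≤ C ∧ ∀ ε : ℂ, (ε = 1 ∨ ε = -1) → ∀ w ∈ H01 δ, ‖w‖ ≤ C * ‖wirtingerL δ ε w‖ := by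
  set A := (1 - δ) + (1 - δ)⁻¹ with hA
  set B := (1 - δ)⁻¹ * (1 + A) with hB
  have hpos : 0 < 1 - δ := by linarith
  have hA0 : 0 ≤ A := by positivity
  have hB0 : 0 ≤ B := by positivity
  have htest : ∀ ε : ℂ, (ε = 1 ∨ ε = -1) → ∀ w ∈ testPairs δ,
      ‖wirtingerL δ (-ε) w‖ ^ 2 ≤ A * ‖wirtingerL δ ε w‖ ^ 2 ∧
        ‖w.1‖ ^ 2 ≤ B * ‖wirtingerL δ ε w‖ ^ 2 := by
    rintro ε hε w ⟨φ, hφ, hc, hs, h1, h2⟩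
    have hφ2 : ContDiff ℝ 2 φ := hφ.of_le (show ((2 : ℕ∞) : WithTop ℕ∞) ≤ _ from WithTop.coe_le_coe.2 le_top)
    have hn : ∀ ε, ‖wirtingerL δ ε w‖ ^ 2 = ∫ z, bdf z ^ δ * ‖wirtinger ε φ z‖ ^ 2 := fun ε =>
      norm_sq_L2_of_ae hs (wirtingerL_ae h2 ε) fun z hz => wirtinger_eq_zero_off hz ε
    have hn1 : ‖w.1‖ ^ 2 = ∫ z, bdf z ^ δ * ‖φ z‖ ^ 2 :=
      norm_sq_L2_of_ae hs h1 fun z hz => image_eq_zero_of_notMem_tsupport hz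
    let a : ℂ → ℝ := fun z => (φ z).re
    let b : ℂ → ℝ := fun z => (φ z).im
    have ha : ContDiff ℝ 2 a := Complex.reCLM.contDiff.comp hφ2
    have hb : ContDiff ℝ 2 b := Complex.imCLM.contDiff.comp hφ2
    have ha0 : ∀ z, z ∉ tsupport φ → a z = 0 := fun z hz => by
      simp [a, image_eq_zero_of_notMem_tsupport hz]
    have hb0 : ∀ z, z ∉ tsupport φ → b z = 0 := fun z hz => by
      simp [b, image_eq_zero_of_notMem_tsupport hz]
    have hd : ∀ z, HasFDerivAt φ (fderiv ℝ φ z) z := fun z =>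
      (hφ2.differentiable two_ne_zero z).hasFDerivAt
    have hda : ∀ z v, fderiv ℝ a z v = (fderiv ℝ φ z v).re := fun z v => by
      have h : HasFDerivAt a _ z := Complex.reCLM.hasFDerivAt.comp z (hd z)
      rw [h.fderiv]
      rfl
    have hdb : ∀ z v, fderiv ℝ b z v = (fderiv ℝ φ z v).im := fun z v => by
      have h : HasFDerivAt b _ z := Complex.imCLM.hasFDerivAt.comp z (hd z)
      rw [h.fderiv]
      rfl
    have hsq : ∀ z, ‖φ z‖ ^ 2 = a z ^ 2 + b z ^ 2 := fun z => by
      rw [Complex.sq_norm, Complex.normSq_apply]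
      ring
    have hp : ∀ z, ‖wirtinger 1 φ z‖ ^ 2 = dzDensity a b z := fun z => by
      rw [Complex.sq_norm, Complex.normSq_apply]
      simp [wirtinger, dzDensity, hda, hdb]
      ring
    have hq : ∀ z, ‖wirtinger (-1) φ z‖ ^ 2 = dzDensity a (-b) z := fun z => by
      rw [Complex.sq_norm, Complex.normSq_apply]
      simp [wirtinger, dzDensity, hda, hdb, fderiv_neg]
      ring
    have e1 := energy_le hc hs ha hb ha0 hb0 hδ
    have e2 := energy_le (b := -b) hc hs ha hb.neg ha0 (fun z hz => by simp [hb0 z hz]) hδ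
    rcases hε with rfl | rfl
    · rw [hn, hn, hn1]
      simp only [hsq, hp, hq]
      exact e1
    · rw [neg_neg, hn, hn, hn1]
      simp only [hsq, hp, hq]
      simpa only [neg_neg, Pi.neg_apply, neg_sq] using e2
  refine ⟨√B + (1 + √A), by positivity, fun ε hε w hw => ?_⟩
  have hroot : ∀ {x y c : ℝ}, 0 ≤ c → 0 ≤ y → x ^ 2 ≤ c * y ^ 2 → x ≤ √c * y := by
    intro x y c hc hy h
    have := Real.le_sqrt_of_sq_le h
    rwa [Real.sqrt_mul hc, Real.sqrt_sq hy] at this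
  have hmem : w ∈ {w : L2 δ × (Fin 2 → L2 δ) | ‖wirtingerL δ (-ε) w‖ ≤ √A * ‖wirtingerL δ ε w‖ ∧
      ‖w.1‖ ≤ √B * ‖wirtingerL δ ε w‖} := by
    refine closure_minimal ?_ ?_ (show w ∈ closure (testPairs δ : Set _) from hw)
    · intro v hv
      obtain ⟨h1, h2⟩ := htest ε hε v hv
      exact ⟨hroot hA0 (norm_nonneg _) h1, hroot hB0 (norm_nonneg _) h2⟩
    · rw [Set.ofPred_and]
      refine (isClosed_le ?_ ?_).inter (isClosed_le ?_ ?_) <;> fun_prop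
  obtain ⟨h1, h2⟩ := hmem
  set N := ‖wirtingerL δ ε w‖ with hN
  have hN0 : 0 ≤ N := norm_nonneg _
  have hsA := Real.sqrt_nonneg A
  have hsB := Real.sqrt_nonneg B
  have hsq : ε * ε = 1 := by rcases hε with rfl | rfl <;> norm_num
  have hεn : ‖ε‖ = 1 := by rcases hε with rfl | rfl <;> simp
  have hx : w.2 0 = wirtingerL δ ε w + wirtingerL δ (-ε) w := by
    rw [wirtingerL_apply, wirtingerL_apply]
    module
  have hy : w.2 1 = (ε * Complex.I) • (wirtingerL δ ε w - wirtingerL δ (-ε) w) := by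
    rw [wirtingerL_apply, wirtingerL_apply]
    match_scalars
    · linear_combination Complex.I ^ 2 * hsq + Complex.I_sq
    · ring
  have hgrad : ∀ i, ‖w.2 i‖ ≤ (1 + √A) * N := by
    intro i
    fin_cases i
    · simp only [Fin.zero_eta]
      rw [hx]
      refine (norm_add_le _ _).trans ?_
      linarith
    · simp only [Fin.mk_one]
      rw [hy, norm_smul, norm_mul, hεn, Complex.norm_I, one_mul, one_mul]
      refine (norm_sub_le _ _).trans ?_
      linarith
  rw [Prod.norm_def]
  refine max_le ?_ ?_
  · nlinarith
  · refine (pi_norm_le_iff_of_nonneg (by positivity)).2 fun i => (hgrad i).trans ?_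
    nlinarith

lemma weightedD_injOn {γ : ℝ} (hγ : -1 < γ) {ε : ℂ} (hε : ε = 1 ∨ ε = -1) {u : H01 (-γ)}
    (h : weightedD γ ε u.1 = 0) : u = 0 := by
  obtain ⟨C, hC, hle⟩ := exists_norm_le_wirtingerL (δ := -γ) (by linarith)
  have := hle ε hε u.1 u.2
  rw [← norm_weightedD, h, norm_zero, mul_zero] at this
  exact Subtype.ext (norm_le_zero_iff.1 this)

/-- Orthogonal decomposition with respect to the range of `d^{-γ} ∂` or `d^{-γ} ∂̄`, which is
closed by the a priori estimate. -/
lemma exists_weightedD_add_orthogonal {γ : ℝ} (hγ : -1 < γ) {ε : ℂ} (hε : ε = 1 ∨ ε = -1)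
    (f : L2 γ) : ∃ u : H01 (-γ), ∃ a : L2 γ,
      (∀ v : H01 (-γ), inner ℂ (weightedD γ ε v.1) a = 0) ∧ f = weightedD γ ε u.1 + a := by
  obtain ⟨C, hC, hle⟩ := exists_norm_le_wirtingerL (δ := -γ) (by linarith)
  let D : H01 (-γ) →L[ℂ] L2 γ := (weightedD γ ε).comp (H01 (-γ)).subtypeL
  have hanti : AntilipschitzWith ⟨C, hC⟩ D := D.antilipschitz_of_bound fun u => by
    have := hle ε hε u.1 u.2
    rw [← norm_weightedD] at this
    exact this
  have : CompleteSpace (H01 (-γ)) :=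
    ((testPairs (-γ)).isClosed_topologicalClosure).completeSpace_coe
  have hcl : IsClosed (LinearMap.range D.toLinearMap : Set (L2 γ)) := by
    rw [LinearMap.coe_range]
    exact hanti.isClosed_range D.uniformContinuous
  have : CompleteSpace (LinearMap.range D.toLinearMap) := hcl.completeSpace_coe
  obtain ⟨y, ⟨u, rfl⟩, a, ha, hf⟩ :=
    Submodule.exists_add_mem_mem_orthogonal (K := LinearMap.range D.toLinearMap) f
  exact ⟨u, a, fun v => (Submodule.mem_orthogonal _ _).1 ha _ ⟨v, rfl⟩, hf⟩

lemma exists_testPair {δ : ℝ} (hδ : -1 < δ) {φ : ℂ → ℂ} (hφ : ContDiff ℝ (⊤ : ℕ∞) φ)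
    (hc : HasCompactSupport φ) (hs : tsupport φ ⊆ ball 0 1) :
    ∃ w ∈ testPairs δ, ∀ i, w.2 i =ᵐ[diskMeasure δ] fun z => fderiv ℝ φ z (coordVec i) := by
  have h1 := memLp_of_continuous hδ hφ.continuous hc
  have h2 : ∀ i, MemLp (fun z => fderiv ℝ φ z (coordVec i)) 2 (diskMeasure δ) := fun i =>
    memLp_of_continuous hδ ((hφ.continuous_fderiv (by simp)).clm_apply continuous_const)
      (hc.fderiv_apply ℝ _)
  exact ⟨(h1.toLp, fun i => (h2 i).toLp), ⟨φ, hφ, hc, hs, h1.coeFn_toLp, fun i => (h2 i).coeFn_toLp⟩,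
    fun i => (h2 i).coeFn_toLp⟩

/-- The pairing of `d^{-γ} ∂φ` or `d^{-γ} ∂̄φ` with `a` in `L²_γ`: the weights cancel. -/
lemma inner_weightedD {γ : ℝ} {w : L2 (-γ) × (Fin 2 → L2 (-γ))} {φ : ℂ → ℂ}
    (h : ∀ i, w.2 i =ᵐ[diskMeasure (-γ)] fun z => fderiv ℝ φ z (coordVec i)) (ε : ℂ) (a : L2 γ) :
    inner ℂ (weightedD γ ε w) a =
      ∫ z in ball (0 : ℂ) 1, a z * (starRingEnd ℂ) (wirtinger ε φ z) := by
  rw [L2.inner_def, integral_diskMeasure]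
  refine integral_congr_ae ?_
  have h1 : weightedD γ ε w = weightMul γ (wirtingerL (-γ) ε w) := rfl
  rw [h1]
  filter_upwards [(ae_diskMeasure_iff γ).1 (coeFn_weightMul γ (wirtingerL (-γ) ε w)),
    (ae_diskMeasure_iff (-γ)).1 (wirtingerL_ae h ε), ae_restrict_mem isOpen_ball.measurableSet]
    with z h2 h3 hz
  have hpp : bdf z ^ γ * bdf z ^ (-γ) = 1 := by rw [← Real.rpow_add (bdf_pos hz)]; simp
  rw [h2, h3, RCLike.inner_apply, map_mul, Complex.conj_ofReal, Complex.real_smul]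
  have hpp' : ((bdf z ^ γ : ℝ) : ℂ) * ((bdf z ^ (-γ) : ℝ) : ℂ) = 1 := by
    rw [← Complex.ofReal_mul, hpp, Complex.ofReal_one]
  linear_combination (a z * (starRingEnd ℂ) (wirtinger ε φ z)) * hpp'

lemma conj_wirtinger (ε : ℝ) {φ : ℂ → ℂ} {z : ℂ} (hφ : DifferentiableAt ℝ φ z) :
    (starRingEnd ℂ) (wirtinger ε φ z) = wirtinger (-ε) (fun w => (starRingEnd ℂ) (φ w)) z := by
  have h : HasFDerivAt (fun w => (starRingEnd ℂ) (φ w)) _ z :=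
    Complex.conjCLE.toContinuousLinearMap.hasFDerivAt.comp z hφ.hasFDerivAt
  simp only [wirtinger, h.fderiv]
  simp [Complex.conj_ofNat]

lemma contDiff_conj_comp {φ : ℂ → ℂ} {n : WithTop ℕ∞} (hφ : ContDiff ℝ n φ) :
    ContDiff ℝ n fun w => (starRingEnd ℂ) (φ w) :=
  Complex.conjCLE.toContinuousLinearMap.contDiff.comp hφ

lemma tsupport_conj_comp (φ : ℂ → ℂ) : tsupport (fun w => (starRingEnd ℂ) (φ w)) = tsupport φ := by
  rw [tsupport, tsupport]
  congr 1
  ext w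
  simp

lemma hasCompactSupport_conj_comp {φ : ℂ → ℂ} (h : HasCompactSupport φ) :
    HasCompactSupport fun w => (starRingEnd ℂ) (φ w) := by
  rwa [HasCompactSupport, tsupport_conj_comp]

lemma integrable_indicator_L2_self {γ : ℝ} (hγ : γ < 1) (a : L2 γ) :
    Integrable ((ball (0 : ℂ) 1).indicator a) := by
  have := integrable_indicator_L2 (a := 0) (δ := γ) (by linarith) a
  simpa using this

/-- Functions orthogonal to the range of `d^{-γ} ∂` are weak solutions of `∂̄a = 0`. -/
lemma isAnalytic_of_orthogonal {γ : ℝ} (hγ : γ ∈ Set.Ioo (-1 : ℝ) 1) {a : L2 γ}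
    (h : ∀ v : H01 (-γ), inner ℂ (weightedD γ 1 v.1) a = 0) : IsAnalytic a := by
  obtain ⟨g, hg, hga⟩ := exists_analytic_of_weak (integrable_indicator_L2_self hγ.2 a)
    fun φ hφ hc hs => by
    obtain ⟨w, hw, hwd⟩ := exists_testPair (δ := -γ) (by linarith [hγ.2]) (contDiff_conj_comp hφ)
      (hasCompactSupport_conj_comp hc) (by rwa [tsupport_conj_comp])
    have h1 := h ⟨w, subset_closure hw⟩
    rw [inner_weightedD hwd] at h1
    rw [← integral_indicator isOpen_ball.measurableSet] at h1
    refine Eq.trans ?_ h1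
    refine integral_congr_ae (Filter.Eventually.of_forall fun z => ?_)
    by_cases hz : z ∈ ball (0 : ℂ) 1
    · have h2 := conj_wirtinger 1 ((contDiff_conj_comp hφ).differentiable (by simp) z)
      simp only [Complex.conj_conj, Complex.ofReal_one] at h2
      simp only [Set.indicator_of_mem hz, h2, dbar_eq_wirtinger]
    · simp only [Set.indicator_of_notMem hz, zero_mul]
  refine ⟨g, hg, (ae_diskMeasure_iff γ).2 ?_⟩
  filter_upwards [hga, ae_restrict_mem isOpen_ball.measurableSet] with z hz hzb
  rwa [Set.indicator_of_mem hzb] at hz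

/-- Functions orthogonal to the range of `d^{-γ} ∂̄` have complex conjugates that are weak solutions
of the Cauchy–Riemann equation. -/
lemma isAntianalytic_of_orthogonal {γ : ℝ} (hγ : γ ∈ Set.Ioo (-1 : ℝ) 1) {a : L2 γ}
    (h : ∀ v : H01 (-γ), inner ℂ (weightedD γ (-1) v.1) a = 0) : IsAntianalytic a := by
  have hint : Integrable fun z => (starRingEnd ℂ) ((ball (0 : ℂ) 1).indicator a z) :=
    Complex.conjCLE.toContinuousLinearMap.integrable_comp (integrable_indicator_L2_self hγ.2 a)
  obtain ⟨g, hg, hga⟩ := exists_analytic_of_weak hint fun φ hφ hc hs => by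
    obtain ⟨w, hw, hwd⟩ := exists_testPair (δ := -γ) (by linarith [hγ.2]) hφ hc hs
    have h1 := h ⟨w, subset_closure hw⟩
    rw [inner_weightedD hwd] at h1
    have h3 := congrArg (starRingEnd ℂ) h1
    rw [map_zero, ← integral_conj, ← integral_indicator isOpen_ball.measurableSet] at h3
    refine Eq.trans ?_ h3
    refine integral_congr_ae (Filter.Eventually.of_forall fun z => ?_)
    by_cases hz : z ∈ ball (0 : ℂ) 1
    · simp [Set.indicator_of_mem hz, dbar_eq_wirtinger]
    · simp [Set.indicator_of_notMem hz]
  refine ⟨g, hg, (ae_diskMeasure_iff γ).2 ?_⟩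
  filter_upwards [hga, ae_restrict_mem isOpen_ball.measurableSet] with z hz hzb
  rw [Set.indicator_of_mem hzb] at hz
  rw [← hz, Complex.conj_conj]

/-- Analytic functions are weak solutions of `∂̄g = 0`. -/
lemma integral_mul_dbar_eq_zero {g φ : ℂ → ℂ} (hg : DifferentiableOn ℂ g (ball 0 1))
    (hφ : ContDiff ℝ (⊤ : ℕ∞) φ) (hc : HasCompactSupport φ) (hs : tsupport φ ⊆ ball 0 1) :
    ∫ z in ball (0 : ℂ) 1, g z * dbar φ z = 0 := by
  let ψ : ℂ → ℂ := fun z => g z * φ z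
  have hψ0 : ∀ z, z ∉ tsupport φ → ψ z = 0 := fun z hz => by
    simp [ψ, image_eq_zero_of_notMem_tsupport hz]
  have hψ : ContDiff ℝ 1 ψ := by
    rw [contDiff_iff_contDiffAt]
    intro z
    by_cases hz : z ∈ tsupport φ
    · have h1 : ContDiffAt ℂ 1 g z :=
        (hg.contDiffOn isOpen_ball).contDiffAt (isOpen_ball.mem_nhds (hs hz))
      exact (h1.restrict_scalars ℝ).mul (hφ.contDiffAt.of_le (by exact_mod_cast le_top))
    · have : ψ =ᶠ[nhds z] fun _ => 0 := by
        filter_upwards [(isClosed_tsupport φ).isOpen_compl.mem_nhds hz] with w hw using hψ0 w hw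
      exact contDiffAt_const.congr_of_eventuallyEq this
  have hcψ : HasCompactSupport ψ := HasCompactSupport.intro hc hψ0
  have hi : ∀ v : ℂ, Integrable fun z => fderiv ℝ ψ z v := fun v =>
    ((hψ.continuous_fderiv one_ne_zero).clm_apply continuous_const).integrable_of_hasCompactSupport
      (hcψ.fderiv_apply ℝ v)
  have hz : ∀ v : ℂ, ∫ z, fderiv ℝ ψ z v = 0 := fun v => by
    have := integral_smul_fderiv_eq_neg_fderiv_smul_of_integrable (μ := volume) (𝕜 := ℝ)
      (f := fun _ : ℂ => (1 : ℝ)) (g := ψ) (v := v) (by simp) (by simpa using hi v)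
      (by simpa using hψ.continuous.integrable_of_hasCompactSupport hcψ)
      (fun z _ => by fun_prop) (fun z _ => hψ.differentiable one_ne_zero z)
    simpa using this
  have h0 : ∫ z, dbar ψ z = 0 := by
    simp only [dbar]
    rw [integral_const_mul, integral_add (hi 1) ((hi Complex.I).const_mul _), integral_const_mul,
      hz, hz]
    simp
  have hset := setIntegral_eq_integral_of_forall_compl_eq_zero (μ := volume)
    (s := ball (0 : ℂ) 1) (f := fun z => dbar ψ z) ?_
  · refine Eq.trans ?_ (hset.trans h0)
    refine setIntegral_congr_fun isOpen_ball.measurableSet fun z hz => ?_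
    have hgz : DifferentiableAt ℂ g z := hg.differentiableAt (isOpen_ball.mem_nhds hz)
    simp only [ψ]
    rw [dbar_mul (hgz.restrictScalars ℝ) (hφ.differentiable (by simp) z),
      dbar_eq_zero_of_differentiableAt hgz, zero_mul, zero_add]
  · intro z hz
    rw [dbar_eq_wirtinger]
    refine wirtinger_eq_zero_off (fun h => hz (hs ?_)) _
    exact closure_minimal (fun w hw => by
      by_contra hw'
      exact hw (hψ0 w hw')) (isClosed_tsupport φ) h

lemma inner_weightedD_eq_zero_of_test {γ : ℝ} {ε : ℂ} {a : L2 γ}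
    (h : ∀ φ : ℂ → ℂ, ContDiff ℝ (⊤ : ℕ∞) φ → HasCompactSupport φ → tsupport φ ⊆ ball 0 1 →
      ∫ z in ball (0 : ℂ) 1, a z * (starRingEnd ℂ) (wirtinger ε φ z) = 0) (v : H01 (-γ)) :
    inner ℂ (weightedD γ ε v.1) a = 0 := by
  have hcl : IsClosed {w | inner ℂ (weightedD γ ε w) a = 0} :=
    isClosed_eq (by fun_prop) continuous_const
  refine closure_minimal (fun w hw => ?_) hcl v.2
  obtain ⟨φ, hφ, hc, hs, h1, h2⟩ := hw
  exact (inner_weightedD h2 ε a).trans (h φ hφ hc hs)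

lemma IsAnalytic.orthogonal {γ : ℝ} {a : L2 γ} (ha : IsAnalytic a) (v : H01 (-γ)) :
    inner ℂ (weightedD γ 1 v.1) a = 0 := by
  obtain ⟨g, hg, hga⟩ := ha
  refine inner_weightedD_eq_zero_of_test (fun φ hφ hc hs => ?_) v
  refine Eq.trans ?_ (integral_mul_dbar_eq_zero hg (contDiff_conj_comp hφ)
    (hasCompactSupport_conj_comp hc) (by rwa [tsupport_conj_comp]))
  refine integral_congr_ae ?_
  filter_upwards [(ae_diskMeasure_iff γ).1 hga] with z hz
  have h2 := conj_wirtinger 1 (hφ.differentiable (by simp) z)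
  rw [Complex.ofReal_one] at h2
  rw [hz, h2, dbar_eq_wirtinger]

lemma IsAntianalytic.orthogonal {γ : ℝ} {a : L2 γ} (ha : IsAntianalytic a) (v : H01 (-γ)) :
    inner ℂ (weightedD γ (-1) v.1) a = 0 := by
  obtain ⟨g, hg, hga⟩ := ha
  refine inner_weightedD_eq_zero_of_test (fun φ hφ hc hs => ?_) v
  have h0 := congrArg (starRingEnd ℂ) (integral_mul_dbar_eq_zero hg hφ hc hs)
  rw [map_zero, ← integral_conj] at h0
  refine Eq.trans ?_ h0
  refine integral_congr_ae ?_
  filter_upwards [(ae_diskMeasure_iff γ).1 hga] with z hz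
  rw [hz, map_mul, dbar_eq_wirtinger]

/-- The kernel of `∂̄` (`ε = 1`) or of `∂` (`ε = -1`) in `L²_γ`: the orthogonal complement of
`d^{-γ} ∂ H₀^{1,-γ}`, respectively `d^{-γ} ∂̄ H₀^{1,-γ}`. -/
def kerSpace (γ : ℝ) (ε : ℂ) : Submodule ℂ (L2 γ) :=
  (LinearMap.range ((weightedD γ ε).toLinearMap.comp (H01 (-γ)).subtype))ᗮ

lemma mem_kerSpace {γ : ℝ} {ε : ℂ} {a : L2 γ} :
    a ∈ kerSpace γ ε ↔ ∀ v : H01 (-γ), inner ℂ (weightedD γ ε v.1) a = 0 := by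
  rw [kerSpace, Submodule.mem_orthogonal]
  constructor
  · exact fun h v => h _ ⟨v, rfl⟩
  · rintro h _ ⟨v, rfl⟩
    exact h v

lemma mem_kerSpace_one {γ : ℝ} (hγ : γ ∈ Set.Ioo (-1 : ℝ) 1) {a : L2 γ} :
    a ∈ kerSpace γ 1 ↔ IsAnalytic a :=
  mem_kerSpace.trans ⟨isAnalytic_of_orthogonal hγ, IsAnalytic.orthogonal⟩

lemma mem_kerSpace_neg_one {γ : ℝ} (hγ : γ ∈ Set.Ioo (-1 : ℝ) 1) {a : L2 γ} :
    a ∈ kerSpace γ (-1) ↔ IsAntianalytic a :=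
  mem_kerSpace.trans ⟨isAntianalytic_of_orthogonal hγ, IsAntianalytic.orthogonal⟩

/-- Existence in the splitting of `L²_γ`. -/
lemma exists_sub_mem_kerSpace {γ : ℝ} (hγ : -1 < γ) {ε : ℂ} (hε : ε = 1 ∨ ε = -1) (f : L2 γ) :
    ∃ u : H01 (-γ), f - weightedD γ ε u.1 ∈ kerSpace γ ε := by
  obtain ⟨u, a, ha, rfl⟩ := exists_weightedD_add_orthogonal hγ hε f
  exact ⟨u, by rw [add_sub_cancel_left]; exact mem_kerSpace.2 ha⟩

/-- Uniqueness in the splitting of `L²_γ`. -/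
lemma eq_zero_of_weightedD_mem_kerSpace {γ : ℝ} (hγ : -1 < γ) {ε : ℂ} (hε : ε = 1 ∨ ε = -1)
    {u : H01 (-γ)} (h : weightedD γ ε u.1 ∈ kerSpace γ ε) : u = 0 :=
  weightedD_injOn hγ hε (inner_self_eq_zero.1 (mem_kerSpace.1 h u))

end Splitting

/-! ### Components of the tensors in the decomposition -/

section TensorComponents

variable {γ : ℝ}

/-- The operators `d^{-γ} ∂` (`ε = 1`) and `d^{-γ} ∂̄` (`ε = -1`) on `H₀^{1,-γ}`. -/
def wD (γ : ℝ) (ε : ℂ) : H01 (-γ) →ₗ[ℂ] L2 γ :=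
  (weightedD γ ε).toLinearMap.comp (H01 (-γ)).subtype

lemma wD_apply (ε : ℂ) (u : H01 (-γ)) :
    wD γ ε u = (1 / 2 : ℂ) • (weightMul γ (H01.pderiv 0 u) -
      (ε * Complex.I) • weightMul γ (H01.pderiv 1 u)) := by
  change weightIso γ (wirtingerL (-γ) ε u.1) = _
  rw [wirtingerL_apply, map_smul, map_sub, map_smul]
  rfl

/-- The partial derivatives as linear maps, followed by multiplication by `d^{-γ}`. -/
def weightPderiv (γ : ℝ) (i : Fin 2) : H01 (-γ) →ₗ[ℂ] L2 γ :=
  (weightIso γ).toLinearMap ∘ₗ LinearMap.proj i ∘ₗ LinearMap.snd ℂ _ _ ∘ₗ (H01 (-γ)).subtype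

lemma comp_tensorWeightMul {m : ℕ} (T : TensorL2 (-γ) m) (k : ℕ) :
    comp (tensorWeightMul γ T).1 k = weightMul γ (comp T.1 k) :=
  comp_map (weightIso γ).toLinearMap T.1 k

/-- The components of `d^{-γ} d^s q` are `d^{-γ} (∂q_{k-1} + ∂̄q_k)`. -/
lemma comp_innerDeriv {m : ℕ} (q : TensorH01 (-γ) m) (k : ℕ) :
    comp (tensorWeightMul γ (innerDeriv q)).1 k =
      shift (fun l => wD γ 1 (comp q.1 l)) k + wD γ (-1) (comp q.1 k) := by
  have h0 : comp (tensorWeightMul γ (innerDeriv q)).1 k =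
      comp (fun I : Fin (m + 1) → Fin 2 => weightPderiv γ (I 0) (q.1 fun k => I k.succ)) k := by
    rw [comp_tensorWeightMul, innerDeriv, comp_symmetrize]
    exact (comp_map (weightIso γ).toLinearMap _ k).symm
  have h1 : ∀ (i : Fin 2) (l : ℕ), comp (fun J : Fin m → Fin 2 => weightPderiv γ i (q.1 J)) l =
      weightMul γ (H01.pderiv i (comp q.1 l)) := fun i l => comp_map (weightPderiv γ i) q.1 l
  rw [h0]
  cases k <;> simp only [comp, Fin.cons_zero, Fin.cons_succ, h1, shift_zero, shift_succ, wD_apply]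
    <;> module

/-- In complex notation, `⋆dh = i (∂̄h dz̄ - ∂h dz)`. -/
lemma comp_starDeriv (h : H01 (-γ)) (k : ℕ) :
    comp (tensorWeightMul γ (starDeriv h)).1 k =
      if k = 0 then Complex.I • wD γ (-1) h else if k = 1 then -Complex.I • wD γ 1 h else 0 := by
  have h0 : ∀ I : Fin 1 → Fin 2, (tensorWeightMul γ (starDeriv h)).1 I =
      ![-weightMul γ (H01.pderiv 1 h), weightMul γ (H01.pderiv 0 h)] (I 0) := fun I => by
    have hneg : weightMul γ (-H01.pderiv 1 h) = -weightMul γ (H01.pderiv 1 h) :=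
      map_neg (weightIso γ) _
    simp only [tensorWeightMul, starDeriv]
    generalize I 0 = i
    fin_cases i <;> simp [hneg]
  rcases k with _ | _ | k
  · simp only [comp, h0, Fin.cons_zero, shift_zero, wD_apply, if_true, Matrix.cons_val_zero,
      Matrix.cons_val_one]
    match_scalars <;> simp
    all_goals first | ring1 | linear_combination -Complex.I_sq / 2
  · simp only [comp, h0, Fin.cons_zero, shift_succ, wD_apply, Matrix.cons_val_zero,
      Matrix.cons_val_one]
    simp
    match_scalars <;> simp
    all_goals first | ring1 | linear_combination -Complex.I_sq / 2
  · rw [comp_of_lt _ (by omega)]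
    simp

/-- The tensor `a dz^m + b dz̄^m`. -/
def ttTensor (m : ℕ) {V : Type*} [AddCommGroup V] [Module ℂ V] (a b : V) : SymTensor m V :=
  ⟨fun I => (∏ k, coordVec (I k)) • a + (∏ k, (starRingEnd ℂ) (coordVec (I k))) • b,
    fun π I => by
      simp only [Function.comp_apply]
      rw [Equiv.prod_comp π fun k => coordVec (I k),
        Equiv.prod_comp π fun k => (starRingEnd ℂ) (coordVec (I k))]⟩

lemma comp_ttTensor {m : ℕ} (hm : 1 ≤ m) {V : Type*} [AddCommGroup V] [Module ℂ V] (a b : V)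
    {k : ℕ} (hk : k ≤ m) :
    comp (ttTensor m a b).1 k = if k = m then a else if k = 0 then b else 0 := by
  refine comp_eq_of_polyEval (c := fun k => if k = m then a else if k = 0 then b else 0)
    (fun v => ?_) hk
  have h1 : ∀ e : Fin 2 → ℂ, ∑ I : Fin m → Fin 2, (∏ k, v (I k)) * ∏ k, e (I k) =
      (v 0 * e 0 + v 1 * e 1) ^ m := fun e => by
    have := Fintype.sum_pow (fun i => v i * e i) m
    rw [Fin.sum_univ_two] at this
    rw [this]
    simp only [Finset.prod_mul_distrib]
  simp only [polyEval, ttTensor, smul_add, smul_smul, Finset.sum_add_distrib, ← Finset.sum_smul]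
  rw [h1, h1 fun i => (starRingEnd ℂ) (coordVec i)]
  obtain ⟨n, rfl⟩ : ∃ n, m = n + 1 := ⟨m - 1, by omega⟩
  rw [Finset.sum_range_succ, Finset.sum_range_succ', Finset.sum_eq_zero]
  · simp [coordVec, dzVal, dzbarVal, add_comm, mul_comm, sub_eq_add_neg]
  · intro k hk
    have := Finset.mem_range.1 hk
    rw [if_neg (by omega), if_neg (by omega), smul_zero]

/-- Tensors are tt when only their extreme components are nonzero, the one of `dz^m` being analytic
and the one of `dz̄^m` antianalytic. -/
lemma isTT_iff {m : ℕ} (hm : 1 ≤ m) (T : TensorL2 γ m) :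
    IsTT T ↔ IsAnalytic (comp T.1 m) ∧ IsAntianalytic (comp T.1 0) ∧
      ∀ k, k ≠ 0 → k ≠ m → comp T.1 k = 0 := by
  constructor
  · rintro ⟨a, b, ha, hb, h⟩
    have hT : T = ttTensor m a b := Subtype.ext (funext h)
    refine ⟨?_, ?_, fun k h0 h1 => ?_⟩
    · rw [hT, comp_ttTensor hm _ _ le_rfl, if_pos rfl]
      exact ha
    · rw [hT, comp_ttTensor hm _ _ (Nat.zero_le m), if_neg (by omega), if_pos rfl]
      exact hb
    · rcases le_or_gt k m with hk | hk
      · rw [hT, comp_ttTensor hm _ _ hk, if_neg h1, if_neg h0]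
      · exact comp_of_lt _ hk
  · rintro ⟨ha, hb, h⟩
    refine ⟨_, _, ha, hb, fun I => ?_⟩
    have hT : T = ttTensor m (comp T.1 m) (comp T.1 0) := by
      refine SymTensor.ext_comp fun k hk => ?_
      rw [comp_ttTensor hm _ _ hk]
      split_ifs with h1 h2
      · rw [h1]
      · rw [h2]
      · exact h k h2 h1
    exact congrFun (congrArg Subtype.val hT) I

/-- In an iterated tt sum of rank `2p + s` the component of index `p + s + i` only comes from the
`i`-th summand. -/
lemma sum_itt_upper {V : Type*} [AddCommGroup V] {p s : ℕ} (d : Fin (p + 1) → ℕ → V)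
    (hd : ∀ (j : Fin (p + 1)) (k : ℕ), k ≠ 0 → k ≠ 2 * (j : ℕ) + s → d j k = 0) (i : Fin (p + 1)) :
    (∑ j : Fin (p + 1), if p - (j : ℕ) ≤ p + s + i then d j (p + s + i - (p - j)) else 0) =
      d i (2 * i + s) := by
  rw [Finset.sum_eq_single i]
  · rw [if_pos (by omega)]
    congr 1
    omega
  · intro j _ hj
    have hj' : (j : ℕ) ≠ i := fun h => hj (Fin.ext h)
    rw [if_pos (by omega), hd j _ (by omega) (by omega)]
  · simp

/-- In an iterated tt sum of rank `2p + s` the component of index `p - i` only comes from the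
`i`-th summand. -/
lemma sum_itt_lower {V : Type*} [AddCommGroup V] {p s : ℕ} (d : Fin (p + 1) → ℕ → V)
    (hd : ∀ (j : Fin (p + 1)) (k : ℕ), k ≠ 0 → k ≠ 2 * (j : ℕ) + s → d j k = 0) (i : Fin (p + 1)) :
    (∑ j : Fin (p + 1), if p - (j : ℕ) ≤ p - i then d j (p - i - (p - j)) else 0) = d i 0 := by
  rw [Finset.sum_eq_single i]
  · rw [if_pos le_rfl, Nat.sub_self]
  · intro j _ hj
    have hj' : (j : ℕ) ≠ i := fun h => hj (Fin.ext h)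
    split_ifs with h
    · rw [hd j _ (by omega) (by omega)]
    · rfl
  · simp

end TensorComponents

/-! ### Solving the triangular systems -/

section Triangular

variable {γ : ℝ}

lemma sub_add_sub_eq {V : Type*} [AddCommGroup V] {a b c a' b' c' : V}
    (h : a + b + c = a' + b' + c') : a - a' + (b - b') = c' - c := by
  rw [← sub_eq_zero] at h ⊢
  rw [← h]
  abel

/-- The system `g_i = D_ε x_i + D_{-ε} x_{i-1}` modulo the kernel can be solved recursively, where
`D_ε` is `d^{-γ} ∂` or `d^{-γ} ∂̄`. -/
lemma exists_triangular (hγ : -1 < γ) {ε : ℂ} (hε : ε = 1 ∨ ε = -1) (g : ℕ → L2 γ) :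
    ∃ x : ℕ → H01 (-γ), ∀ i,
      g i - wD γ ε (x i) - shift (fun l => wD γ (-ε) (x l)) i ∈ kerSpace γ ε := by
  choose sol hsol using fun f : L2 γ => exists_sub_mem_kerSpace hγ hε f
  let x : ℕ → H01 (-γ) := fun i =>
    Nat.rec (sol (g 0)) (fun i u => sol (g (i + 1) - wD γ (-ε) u)) i
  refine ⟨x, fun i => ?_⟩
  cases i with
  | zero =>
    rw [shift_zero, sub_zero]
    exact hsol (g 0)
  | succ i =>
    rw [shift_succ, sub_right_comm]
    exact hsol (g (i + 1) - wD γ (-ε) (x i))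

lemma triangular_unique (hγ : -1 < γ) {ε : ℂ} (hε : ε = 1 ∨ ε = -1) {n : ℕ} {x : ℕ → H01 (-γ)}
    (h : ∀ i < n, wD γ ε (x i) + shift (fun l => wD γ (-ε) (x l)) i ∈ kerSpace γ ε) :
    ∀ i < n, x i = 0 := by
  intro i hi
  induction i with
  | zero =>
    have := h 0 hi
    rw [shift_zero, add_zero] at this
    exact eq_zero_of_weightedD_mem_kerSpace hγ hε this
  | succ i ih =>
    have := h (i + 1) hi
    rw [shift_succ, ih (by omega), map_zero, add_zero] at this
    exact eq_zero_of_weightedD_mem_kerSpace hγ hε this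

end Triangular

/-! ### The decomposition in even rank -/

section Even

variable {γ : ℝ} {p : ℕ}

lemma comp_ittEven (ft : (j : Fin (p + 1)) → TensorL2 γ (2 * j)) (k : ℕ) :
    comp (ittEven p ft).1 k = ∑ j : Fin (p + 1),
      if p - (j : ℕ) ≤ k then comp (ft j).1 (k - (p - j)) else 0 := by
  rw [ittEven, comp_sum]
  exact Finset.sum_congr rfl fun j _ => by rw [comp_cast, comp_metricMulPow]

lemma tt_even_comp {ft : (j : Fin (p + 1)) → TensorL2 γ (2 * j)}
    (h : ∀ j : Fin (p + 1), 1 ≤ (j : ℕ) → IsTT (ft j)) (j : Fin (p + 1)) (k : ℕ) (h0 : k ≠ 0)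
    (h1 : k ≠ 2 * (j : ℕ) + 0) : comp (ft j).1 k = 0 := by
  rcases Nat.eq_zero_or_pos (j : ℕ) with hj | hj
  · exact comp_of_lt _ (by omega)
  · exact ((isTT_iff (by omega) _).1 (h j hj)).2.2 k h0 h1

/-- The equation of the decomposition in even rank, read off component by component. -/
lemma isDecompEven_iff (hp : 1 ≤ p) (f : TensorL2 γ (2 * p)) (q : TensorH01 (-γ) (2 * p - 1))
    (ft : (j : Fin (p + 1)) → TensorL2 γ (2 * j)) :
    IsDecompEven hp f q ft ↔ (∀ j : Fin (p + 1), 1 ≤ (j : ℕ) → IsTT (ft j)) ∧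
      (∀ i : Fin (p + 1), comp f.1 (p + i) = shift (fun l => wD γ 1 (comp q.1 l)) (p + i) +
        wD γ (-1) (comp q.1 (p + i)) + comp (ft i).1 (2 * i)) ∧
      ∀ i : Fin (p + 1), comp f.1 (p - i) = shift (fun l => wD γ 1 (comp q.1 l)) (p - i) +
        wD γ (-1) (comp q.1 (p - i)) + comp (ft i).1 0 := by
  refine and_congr_right fun htt => ?_
  have hd := tt_even_comp htt
  have hu : ∀ i : Fin (p + 1), (∑ j : Fin (p + 1), if p - (j : ℕ) ≤ p + i then
      comp (ft j).1 (p + i - (p - j)) else 0) = comp (ft i).1 (2 * i) :=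
    fun i => sum_itt_upper (s := 0) (fun j => comp (ft j).1) hd i
  have hl := fun i => sum_itt_lower (s := 0) (fun j => comp (ft j).1) hd i
  have hcomp : ∀ k, comp (SymTensor.cast (by omega) (tensorWeightMul γ (innerDeriv q)) +
      ittEven p ft : TensorL2 γ (2 * p)).1 k = shift (fun l => wD γ 1 (comp q.1 l)) k +
        wD γ (-1) (comp q.1 k) + comp (ittEven p ft).1 k := fun k => by
    rw [← comp_innerDeriv, ← comp_cast (show 2 * p - 1 + 1 = 2 * p by omega)]
    exact comp_add _ _ k
  constructor
  · intro h
    refine ⟨fun i => ?_, fun i => ?_⟩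
    · rw [← hu i, ← comp_ittEven, ← hcomp, ← h]
    · rw [← hl i, ← comp_ittEven, ← hcomp, ← h]
  · rintro ⟨h1, h2⟩
    refine SymTensor.ext_comp fun k hk => ?_
    rw [hcomp]
    rcases le_total p k with h | h
    · obtain ⟨i, rfl⟩ : ∃ i : Fin (p + 1), k = p + i := ⟨⟨k - p, by omega⟩, by simp; omega⟩
      rw [h1 i, ← hu i, ← comp_ittEven]
    · obtain ⟨i, rfl⟩ : ∃ i : Fin (p + 1), k = p - i := ⟨⟨p - k, by omega⟩, by simp; omega⟩
      rw [h2 i, ← hl i, ← comp_ittEven]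

/-- Existence in even rank: the lower half of `q` solves the system for `∂̄` from below, and its
upper half the system for `∂` from above. -/
lemma exists_decompEven (hγ : γ ∈ Set.Ioo (-1 : ℝ) 1) (hp : 1 ≤ p) (f : TensorL2 γ (2 * p)) :
    ∃ q ft, IsDecompEven hp f q ft := by
  obtain ⟨x, hx⟩ := exists_triangular hγ.1 (Or.inl rfl) fun i => comp f.1 (2 * p - i)
  obtain ⟨y, hy⟩ := exists_triangular hγ.1 (Or.inr rfl) (comp f.1)
  obtain ⟨q, hq⟩ := SymTensor.exists_comp (2 * p - 1) fun k => if k < p then y k else x (2 * p - 1 - k)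
  let r : ℕ → L2 γ := fun k => comp f.1 k - shift (fun l => wD γ 1 (comp q.1 l)) k -
    wD γ (-1) (comp q.1 k)
  choose ft hft using fun j : Fin (p + 1) => SymTensor.exists_comp (2 * (j : ℕ)) fun k =>
    if k = 2 * (j : ℕ) then r (p + j) else if k = 0 then r (p - j) else 0
  -- `i = 0` is excluded: the middle component `r p` is the unconstrained `f̃_0`
  have hr1 : ∀ i : ℕ, 1 ≤ i → i ≤ p → r (p + i) ∈ kerSpace γ 1 := by
    intro i hi hip
    have h := hx (p - i)
    obtain ⟨k, hk⟩ : ∃ k, p + i = k + 1 := ⟨p + i - 1, by omega⟩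
    simp only [r, hk, shift_succ]
    rw [hq k (by omega), if_neg (by omega), show 2 * p - 1 - k = p - i by omega]
    rw [show 2 * p - (p - i) = k + 1 by omega] at h
    rcases Nat.lt_or_ge i p with h' | h'
    · rw [hq (k + 1) (by omega), if_neg (by omega)]
      obtain ⟨l, hl⟩ : ∃ l, p - i = l + 1 := ⟨p - i - 1, by omega⟩
      rw [hl, shift_succ] at h
      rw [hl, show 2 * p - 1 - (k + 1) = l by omega]
      exact h
    · rw [comp_of_lt q.1 (show 2 * p - 1 < k + 1 by omega), map_zero, sub_zero]
      rw [show p - i = 0 by omega, shift_zero, sub_zero] at h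
      rw [show p - i = 0 by omega]
      exact h
  have hr2 : ∀ i : ℕ, 1 ≤ i → i ≤ p → r (p - i) ∈ kerSpace γ (-1) := by
    intro i hi hip
    have h := hy (p - i)
    rw [sub_right_comm, neg_neg] at h
    simp only [r]
    rw [hq (p - i) (by omega), if_pos (by omega)]
    rcases Nat.eq_zero_or_pos (p - i) with h' | h'
    · rw [h', shift_zero] at h ⊢
      exact h
    · obtain ⟨l, hl⟩ : ∃ l, p - i = l + 1 := ⟨p - i - 1, by omega⟩
      rw [hl, shift_succ] at h ⊢
      rw [hq l (by omega), if_pos (by omega)]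
      exact h
  refine ⟨q, ft, (isDecompEven_iff hp f q ft).2 ⟨fun j hj => ?_, fun i => ?_, fun i => ?_⟩⟩
  · refine (isTT_iff (by omega) _).2 ⟨?_, ?_, fun k h0 h1 => ?_⟩
    · rw [hft j _ le_rfl, if_pos rfl]
      exact (mem_kerSpace_one hγ).1 (hr1 j hj (by omega))
    · rw [hft j _ (Nat.zero_le _), if_neg (by omega), if_pos rfl]
      exact (mem_kerSpace_neg_one hγ).1 (hr2 j hj (by omega))
    · rcases le_or_gt k (2 * (j : ℕ)) with h | h
      · rw [hft j k h, if_neg h1, if_neg h0]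
      · exact comp_of_lt _ h
  · rw [hft i _ le_rfl, if_pos rfl]
    simp only [r]
    abel
  · have : comp (ft i).1 0 = r (p - i) := by
      rw [hft i 0 (Nat.zero_le _)]
      split_ifs with h h'
      · rw [show (i : ℕ) = 0 by omega, Nat.add_zero, Nat.sub_zero]
      · rfl
      · exact absurd rfl h'
    rw [this]
    simp only [r]
    abel

lemma decompEven_unique (hγ : γ ∈ Set.Ioo (-1 : ℝ) 1) (hp : 1 ≤ p) {f : TensorL2 γ (2 * p)}
    {q q' : TensorH01 (-γ) (2 * p - 1)} {ft ft' : (j : Fin (p + 1)) → TensorL2 γ (2 * j)}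
    (h : IsDecompEven hp f q ft) (h' : IsDecompEven hp f q' ft') : q = q' ∧ ft = ft' := by
  obtain ⟨htt, hu, hl⟩ := (isDecompEven_iff hp f q ft).1 h
  obtain ⟨htt', hu', hl'⟩ := (isDecompEven_iff hp f q' ft').1 h'
  have hx : ∀ i < p, comp q.1 (2 * p - 1 - i) - comp q'.1 (2 * p - 1 - i) = 0 := by
    refine triangular_unique hγ.1 (Or.inl rfl)
      (x := fun i => comp q.1 (2 * p - 1 - i) - comp q'.1 (2 * p - 1 - i)) fun i hi => ?_
    let j : Fin (p + 1) := ⟨p - i, by omega⟩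
    have hj : (j : ℕ) = p - i := rfl
    have e1 := hu j
    have e2 := hu' j
    have k1 := (mem_kerSpace_one hγ).2 ((isTT_iff (by omega) _).1 (htt j (by omega))).1
    have k2 := (mem_kerSpace_one hγ).2 ((isTT_iff (by omega) _).1 (htt' j (by omega))).1
    rw [show p + (j : ℕ) = (2 * p - 1 - i) + 1 by omega, shift_succ] at e1 e2
    have key : wD γ 1 (comp q.1 (2 * p - 1 - i) - comp q'.1 (2 * p - 1 - i)) +
        (wD γ (-1) (comp q.1 (2 * p - 1 - i + 1) - comp q'.1 (2 * p - 1 - i + 1))) =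
        comp (ft' j).1 (2 * j) - comp (ft j).1 (2 * j) := by
      rw [map_sub, map_sub]
      exact sub_add_sub_eq (e1.symm.trans e2)
    convert (kerSpace γ 1).sub_mem k2 k1 using 1
    rw [← key]
    congr 1
    cases i with
    | zero =>
      rw [shift_zero, comp_of_lt _ (by omega), comp_of_lt _ (by omega), sub_zero, map_zero]
    | succ i =>
      rw [shift_succ, show 2 * p - 1 - (i + 1) + 1 = 2 * p - 1 - i by omega]
  have hy : ∀ i < p, comp q.1 i - comp q'.1 i = 0 := by
    refine triangular_unique hγ.1 (Or.inr rfl) (x := fun i => comp q.1 i - comp q'.1 i)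
      fun i hi => ?_
    let j : Fin (p + 1) := ⟨p - i, by omega⟩
    have hj : (j : ℕ) = p - i := rfl
    have e1 := hl j
    have e2 := hl' j
    have k1 := (mem_kerSpace_neg_one hγ).2 ((isTT_iff (by omega) _).1 (htt j (by omega))).2.1
    have k2 := (mem_kerSpace_neg_one hγ).2 ((isTT_iff (by omega) _).1 (htt' j (by omega))).2.1
    rw [show p - (j : ℕ) = i by omega] at e1 e2
    have key : wD γ (-1) (comp q.1 i - comp q'.1 i) +
        (shift (fun l => wD γ 1 (comp q.1 l)) i - shift (fun l => wD γ 1 (comp q'.1 l)) i) =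
        comp (ft' j).1 0 - comp (ft j).1 0 := by
      rw [map_sub, add_comm]
      exact sub_add_sub_eq (e1.symm.trans e2)
    convert (kerSpace γ (-1)).sub_mem k2 k1 using 1
    rw [← key]
    congr 1
    cases i with
    | zero => simp
    | succ i => simp only [shift_succ, neg_neg, map_sub]
  have hq : q = q' := by
    refine SymTensor.ext_comp fun k hk => sub_eq_zero.1 ?_
    rcases Nat.lt_or_ge k p with h | h
    · exact hy k h
    · have := hx (2 * p - 1 - k) (by omega)
      rwa [show 2 * p - 1 - (2 * p - 1 - k) = k by omega] at this
  subst hq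
  refine ⟨rfl, funext fun j => SymTensor.ext_comp fun k hk => ?_⟩
  by_cases h0 : k = 0
  · rw [h0]
    exact add_left_cancel ((hl j).symm.trans (hl' j))
  by_cases h1 : k = 2 * (j : ℕ)
  · rw [h1]
    exact add_left_cancel ((hu j).symm.trans (hu' j))
  · rw [tt_even_comp htt j k h0 h1, tt_even_comp htt' j k h0 h1]

end Even

/-! ### The decomposition in odd rank -/

section Odd

variable {γ : ℝ} {p : ℕ}

lemma comp_ittOdd (h : H01 (-γ)) (ft : (j : Fin (p + 1)) → TensorL2 γ (2 * j + 1)) (k : ℕ) :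
    comp (ittOdd p h ft).1 k =
      (if k = p then Complex.I • wD γ (-1) h else if k = p + 1 then -Complex.I • wD γ 1 h else 0) +
      ∑ j : Fin (p + 1), if p - (j : ℕ) ≤ k then comp (ft j).1 (k - (p - j)) else 0 := by
  have h1 : comp (ittOdd p h ft).1 k =
      comp (SymTensor.cast (show 1 + 2 * p = 2 * p + 1 by omega)
        (metricMulPow (tensorWeightMul γ (starDeriv h)) p)).1 k +
      comp (∑ j : Fin (p + 1), SymTensor.cast (show 2 * (j : ℕ) + 1 + 2 * (p - j) = 2 * p + 1 by omega)
        (metricMulPow (ft j) (p - j))).1 k := comp_add _ _ k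
  rw [h1, comp_sum, comp_cast, comp_metricMulPow, comp_starDeriv]
  congr 1
  · by_cases hk : p ≤ k
    · simp only [if_pos hk, show k - p = 0 ↔ k = p by omega, show k - p = 1 ↔ k = p + 1 by omega]
    · rw [if_neg hk, if_neg (by omega), if_neg (by omega)]
  · exact Finset.sum_congr rfl fun j _ => by rw [comp_cast, comp_metricMulPow]

lemma tt_odd_comp {ft : (j : Fin (p + 1)) → TensorL2 γ (2 * j + 1)}
    (h : ∀ j : Fin (p + 1), IsTT (ft j)) (j : Fin (p + 1)) (k : ℕ) (h0 : k ≠ 0)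
    (h1 : k ≠ 2 * (j : ℕ) + 1) : comp (ft j).1 k = 0 :=
  ((isTT_iff (by omega) _).1 (h j)).2.2 k h0 h1

/-- The equation of the decomposition in odd rank, read off component by component. The function
`h` only enters the two middle components, where it combines with the middle component `q_p` of
`q` to `∂(q_p - ih)` and `∂̄(q_p + ih)`. -/
lemma isDecompOdd_iff (f : TensorL2 γ (2 * p + 1)) (q : TensorH01 (-γ) (2 * p)) (h : H01 (-γ))
    (ft : (j : Fin (p + 1)) → TensorL2 γ (2 * j + 1)) :
    IsDecompOdd f q h ft ↔ (∀ j : Fin (p + 1), IsTT (ft j)) ∧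
      (∀ i : Fin (p + 1), comp f.1 (p + 1 + i) =
        wD γ 1 (comp q.1 (p + i) - if (i : ℕ) = 0 then Complex.I • h else 0) +
        wD γ (-1) (comp q.1 (p + 1 + i)) + comp (ft i).1 (2 * i + 1)) ∧
      ∀ i : Fin (p + 1), comp f.1 (p - i) = shift (fun l => wD γ 1 (comp q.1 l)) (p - i) +
        wD γ (-1) (comp q.1 (p - i) + if (i : ℕ) = 0 then Complex.I • h else 0) +
        comp (ft i).1 0 := by
  refine and_congr_right fun htt => ?_
  have hd := tt_odd_comp htt
  have hu := fun i => sum_itt_upper (s := 1) (fun j => comp (ft j).1) hd i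
  have hl := fun i => sum_itt_lower (s := 1) (fun j => comp (ft j).1) hd i
  have hcomp : ∀ k, comp (tensorWeightMul γ (innerDeriv q) +
      ittOdd p h ft : TensorL2 γ (2 * p + 1)).1 k = shift (fun l => wD γ 1 (comp q.1 l)) k +
        wD γ (-1) (comp q.1 k) + comp (ittOdd p h ft).1 k := fun k => by
    rw [← comp_innerDeriv]
    exact comp_add _ _ k
  have hup : ∀ i : Fin (p + 1), comp (tensorWeightMul γ (innerDeriv q) +
      ittOdd p h ft : TensorL2 γ (2 * p + 1)).1 (p + 1 + i) =
      wD γ 1 (comp q.1 (p + i) - if (i : ℕ) = 0 then Complex.I • h else 0) +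
        wD γ (-1) (comp q.1 (p + 1 + i)) + comp (ft i).1 (2 * i + 1) := fun i => by
    rw [hcomp, comp_ittOdd, hu i, show p + 1 + (i : ℕ) = (p + i) + 1 by omega, shift_succ,
      if_neg (by omega)]
    by_cases hi : (i : ℕ) = 0
    · rw [if_pos (by omega), if_pos hi, map_sub, map_smul]
      module
    · rw [if_neg (by omega), if_neg hi, sub_zero, zero_add]
  have hlo : ∀ i : Fin (p + 1), comp (tensorWeightMul γ (innerDeriv q) +
      ittOdd p h ft : TensorL2 γ (2 * p + 1)).1 (p - i) =
      shift (fun l => wD γ 1 (comp q.1 l)) (p - i) +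
        wD γ (-1) (comp q.1 (p - i) + if (i : ℕ) = 0 then Complex.I • h else 0) +
        comp (ft i).1 0 := fun i => by
    rw [hcomp, comp_ittOdd, hl i]
    by_cases hi : (i : ℕ) = 0
    · rw [if_pos (by omega), if_pos hi, map_add, map_smul]
      module
    · rw [if_neg (by omega), if_neg (by omega), if_neg hi, add_zero, zero_add]
  constructor
  · intro h
    exact ⟨fun i => by rw [← hup, ← h], fun i => by rw [← hlo, ← h]⟩
  · rintro ⟨h1, h2⟩
    refine SymTensor.ext_comp fun k hk => ?_
    rcases Nat.lt_or_ge p k with h | h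
    · obtain ⟨i, rfl⟩ : ∃ i : Fin (p + 1), k = p + 1 + i :=
        ⟨⟨k - p - 1, by omega⟩, by simp; omega⟩
      rw [h1 i, hup]
    · obtain ⟨i, rfl⟩ : ∃ i : Fin (p + 1), k = p - i := ⟨⟨p - k, by omega⟩, by simp; omega⟩
      rw [h2 i, hlo]

/-- Existence in odd rank: the two systems, for `∂̄` from below and for `∂` from above, meet in the
middle component with solutions `y_p` and `x_p`; `q_p` and `h` are found from `q_p + ih = y_p` and
`q_p - ih = x_p`. -/
lemma exists_decompOdd (hγ : γ ∈ Set.Ioo (-1 : ℝ) 1) (f : TensorL2 γ (2 * p + 1)) :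
    ∃ q h ft, IsDecompOdd f q h ft := by
  obtain ⟨x, hx⟩ := exists_triangular hγ.1 (Or.inl rfl) fun i => comp f.1 (2 * p + 1 - i)
  obtain ⟨y, hy⟩ := exists_triangular hγ.1 (Or.inr rfl) (comp f.1)
  obtain ⟨q, hq⟩ := SymTensor.exists_comp (2 * p) fun k =>
    if k < p then y k else if k = p then (1 / 2 : ℂ) • (x p + y p) else x (2 * p - k)
  let h : H01 (-γ) := (-Complex.I / 2) • (y p - x p)
  have hI : Complex.I • h = (1 / 2 : ℂ) • (y p - x p) := by
    simp only [h, smul_smul]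
    congr 1
    linear_combination -Complex.I_sq / 2
  have hqx : ∀ i ≤ p, comp q.1 (p + i) - (if i = 0 then Complex.I • h else 0) = x (p - i) := by
    intro i hi
    rw [hq _ (by omega), if_neg (by omega)]
    by_cases h0 : i = 0
    · rw [if_pos (by omega), if_pos h0, hI, h0, Nat.sub_zero]
      module
    · rw [if_neg (by omega), if_neg h0, sub_zero, show 2 * p - (p + i) = p - i by omega]
  have hqy : ∀ i ≤ p, comp q.1 (p - i) + (if i = 0 then Complex.I • h else 0) = y (p - i) := by
    intro i hi
    rw [hq _ (by omega)]
    by_cases h0 : i = 0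
    · rw [if_neg (by omega), if_pos (by omega), if_pos h0, hI, h0, Nat.sub_zero]
      module
    · rw [if_pos (by omega), if_neg h0, add_zero]
  let u : ℕ → L2 γ := fun i => comp f.1 (p + 1 + i) - wD γ 1 (x (p - i)) -
    wD γ (-1) (comp q.1 (p + 1 + i))
  let l : ℕ → L2 γ := fun i => comp f.1 (p - i) - shift (fun l => wD γ 1 (comp q.1 l)) (p - i) -
    wD γ (-1) (y (p - i))
  choose ft hft using fun j : Fin (p + 1) => SymTensor.exists_comp (2 * (j : ℕ) + 1) fun k =>
    if k = 2 * (j : ℕ) + 1 then u j else if k = 0 then l j else 0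
  have hr1 : ∀ i ≤ p, u i ∈ kerSpace γ 1 := by
    intro i hip
    have h := hx (p - i)
    rw [show 2 * p + 1 - (p - i) = p + 1 + i by omega] at h
    simp only [u]
    rcases Nat.lt_or_ge i p with h' | h'
    · rw [hq (p + 1 + i) (by omega), if_neg (by omega), if_neg (by omega)]
      obtain ⟨l, hl⟩ : ∃ l, p - i = l + 1 := ⟨p - i - 1, by omega⟩
      rw [hl, shift_succ] at h
      rw [hl, show 2 * p - (p + 1 + i) = l by omega]
      exact h
    · rw [comp_of_lt q.1 (show 2 * p < p + 1 + i by omega), map_zero, sub_zero]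
      rw [show p - i = 0 by omega, shift_zero, sub_zero] at h
      rw [show p - i = 0 by omega]
      exact h
  have hr2 : ∀ i ≤ p, l i ∈ kerSpace γ (-1) := by
    intro i hip
    have h := hy (p - i)
    rw [sub_right_comm, neg_neg] at h
    simp only [l]
    rcases Nat.eq_zero_or_pos (p - i) with h' | h'
    · rw [h', shift_zero] at h ⊢
      exact h
    · obtain ⟨l, hl⟩ : ∃ l, p - i = l + 1 := ⟨p - i - 1, by omega⟩
      rw [hl, shift_succ] at h ⊢
      rw [hq l (by omega), if_pos (by omega)]
      exact h
  refine ⟨q, h, ft, (isDecompOdd_iff f q h ft).2 ⟨fun j => ?_, fun i => ?_, fun i => ?_⟩⟩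
  · refine (isTT_iff (by omega) _).2 ⟨?_, ?_, fun k h0 h1 => ?_⟩
    · rw [hft j _ le_rfl, if_pos rfl]
      exact (mem_kerSpace_one hγ).1 (hr1 j (by omega))
    · rw [hft j _ (Nat.zero_le _), if_neg (by omega), if_pos rfl]
      exact (mem_kerSpace_neg_one hγ).1 (hr2 j (by omega))
    · rcases le_or_gt k (2 * (j : ℕ) + 1) with h | h
      · rw [hft j k h, if_neg h1, if_neg h0]
      · exact comp_of_lt _ h
  · rw [show comp (ft i).1 (2 * i + 1) = u i by rw [hft i _ le_rfl, if_pos rfl], hqx i (by omega)]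
    simp only [u]
    abel
  · rw [show comp (ft i).1 0 = l i by rw [hft i 0 (Nat.zero_le _), if_neg (by omega), if_pos rfl],
      hqy i (by omega)]
    simp only [l]
    abel

lemma decompOdd_unique (hγ : γ ∈ Set.Ioo (-1 : ℝ) 1) {f : TensorL2 γ (2 * p + 1)}
    {q q' : TensorH01 (-γ) (2 * p)} {h h' : H01 (-γ)}
    {ft ft' : (j : Fin (p + 1)) → TensorL2 γ (2 * j + 1)}
    (hd : IsDecompOdd f q h ft) (hd' : IsDecompOdd f q' h' ft') : q = q' ∧ h = h' ∧ ft = ft' := by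
  obtain ⟨htt, hu, hl⟩ := (isDecompOdd_iff f q h ft).1 hd
  obtain ⟨htt', hu', hl'⟩ := (isDecompOdd_iff f q' h' ft').1 hd'
  let x : TensorH01 (-γ) (2 * p) → H01 (-γ) → ℕ → H01 (-γ) := fun q h i =>
    comp q.1 (2 * p - i) - if i = p then Complex.I • h else 0
  let y : TensorH01 (-γ) (2 * p) → H01 (-γ) → ℕ → H01 (-γ) := fun q h i =>
    comp q.1 i + if i = p then Complex.I • h else 0
  have hx : ∀ i < p + 1, x q h i - x q' h' i = 0 := by
    refine triangular_unique hγ.1 (Or.inl rfl)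
      (x := fun i => x q h i - x q' h' i) fun i hi => ?_
    let j : Fin (p + 1) := ⟨p - i, by omega⟩
    have hj : (j : ℕ) = p - i := rfl
    have e1 := hu j
    have e2 := hu' j
    have k1 := (mem_kerSpace_one hγ).2 ((isTT_iff (by omega) _).1 (htt j)).1
    have k2 := (mem_kerSpace_one hγ).2 ((isTT_iff (by omega) _).1 (htt' j)).1
    have hxj : ∀ q h, comp q.1 (p + j) -
        (if (j : ℕ) = 0 then Complex.I • h else 0) = x q h i := fun q h => by
      simp only [x]
      rw [show p + (j : ℕ) = 2 * p - i by omega]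
      simp only [show (j : ℕ) = 0 ↔ i = p by omega]
    rw [hxj] at e1 e2
    have key : wD γ 1 (x q h i - x q' h' i) +
        (wD γ (-1) (comp q.1 (p + 1 + j)) - wD γ (-1) (comp q'.1 (p + 1 + j))) =
        comp (ft' j).1 (2 * j + 1) - comp (ft j).1 (2 * j + 1) := by
      rw [map_sub]
      exact sub_add_sub_eq (e1.symm.trans e2)
    convert (kerSpace γ 1).sub_mem k2 k1 using 1
    rw [← key]
    congr 1
    cases i with
    | zero =>
      rw [shift_zero, comp_of_lt _ (by omega), comp_of_lt _ (by omega), map_zero, sub_zero]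
    | succ i =>
      rw [shift_succ, map_sub]
      simp only [x]
      rw [if_neg (by omega), if_neg (by omega), sub_zero, sub_zero,
        show p + 1 + (j : ℕ) = 2 * p - i by omega]
  have hy : ∀ i < p + 1, y q h i - y q' h' i = 0 := by
    refine triangular_unique hγ.1 (Or.inr rfl) (x := fun i => y q h i - y q' h' i)
      fun i hi => ?_
    let j : Fin (p + 1) := ⟨p - i, by omega⟩
    have hj : (j : ℕ) = p - i := rfl
    have e1 := hl j
    have e2 := hl' j
    have k1 := (mem_kerSpace_neg_one hγ).2 ((isTT_iff (by omega) _).1 (htt j)).2.1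
    have k2 := (mem_kerSpace_neg_one hγ).2 ((isTT_iff (by omega) _).1 (htt' j)).2.1
    rw [show p - (j : ℕ) = i by omega] at e1 e2
    simp only [show (j : ℕ) = 0 ↔ i = p by omega] at e1 e2
    have key : wD γ (-1) (y q h i - y q' h' i) +
        (shift (fun l => wD γ 1 (comp q.1 l)) i - shift (fun l => wD γ 1 (comp q'.1 l)) i) =
        comp (ft' j).1 0 - comp (ft j).1 0 := by
      rw [map_sub, add_comm]
      exact sub_add_sub_eq (e1.symm.trans e2)
    convert (kerSpace γ (-1)).sub_mem k2 k1 using 1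
    rw [← key]
    congr 1
    cases i with
    | zero => simp
    | succ i =>
      simp only [shift_succ, neg_neg, map_sub, y]
      rw [if_neg (by omega), if_neg (by omega), add_zero, add_zero]
  have hxp := hx p (by omega)
  have hyp := hy p (by omega)
  simp only [x, y, if_true, show 2 * p - p = p by omega] at hxp hyp
  have hqp : comp q.1 p - comp q'.1 p = 0 := by
    have e : comp q.1 p - comp q'.1 p = (1 / 2 : ℂ) •
        (comp q.1 p - Complex.I • h - (comp q'.1 p - Complex.I • h')) +
        (1 / 2 : ℂ) • (comp q.1 p + Complex.I • h - (comp q'.1 p + Complex.I • h')) := by module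
    rw [e, hxp, hyp, smul_zero, add_zero]
  have hh : h - h' = 0 := by
    have : Complex.I • (h - h') = 0 := by
      have e : Complex.I • (h - h') = (1 / 2 : ℂ) •
          (comp q.1 p + Complex.I • h - (comp q'.1 p + Complex.I • h')) -
          (1 / 2 : ℂ) • (comp q.1 p - Complex.I • h - (comp q'.1 p - Complex.I • h')) := by
        module
      rw [e, hxp, hyp, smul_zero, sub_zero]
    exact (smul_eq_zero.1 this).resolve_left Complex.I_ne_zero
  have hq : q = q' := by
    refine SymTensor.ext_comp fun k hk => sub_eq_zero.1 ?_
    rcases lt_trichotomy k p with h | h | h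
    · have := hy k (by omega)
      simp only [y] at this
      rwa [if_neg (by omega), if_neg (by omega), add_zero, add_zero] at this
    · rw [h]
      exact hqp
    · have := hx (2 * p - k) (by omega)
      simp only [x] at this
      rwa [if_neg (by omega), if_neg (by omega), sub_zero, sub_zero,
        show 2 * p - (2 * p - k) = k by omega] at this
  have hh' := sub_eq_zero.1 hh
  subst hq hh'
  refine ⟨rfl, rfl, funext fun j => SymTensor.ext_comp fun k hk => ?_⟩
  by_cases h0 : k = 0
  · rw [h0]
    exact add_left_cancel ((hl j).symm.trans (hl' j))
  by_cases h1 : k = 2 * (j : ℕ) + 1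
  · rw [h1]
    exact add_left_cancel ((hu j).symm.trans (hu' j))
  · rw [tt_odd_comp htt j k h0 h1, tt_odd_comp htt' j k h0 h1]

end Odd

/-! ### Oriented lines -/

section Lines

open Metric Filter
open scoped Topology

/-- The oriented lines of direction `e^{iθ}`: the point at arc length `τ` on the line at signed
distance `s` from the origin. -/
def ray (θ s τ : ℝ) : ℂ := Complex.exp (θ * Complex.I) * (τ + s * Complex.I)

lemma continuous_ray : Continuous fun x : (ℝ × ℝ) × ℝ => ray x.1.1 x.1.2 x.2 := by
  unfold ray
  fun_prop

lemma chord_eq_ray (β α t : ℝ) :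
    chord β α t = ray (β + Real.pi + α) (Real.sin α) (t - Real.cos α) := by
  have h1 : Complex.exp ((β + Real.pi + α : ℝ) * Complex.I) =
      -(Complex.exp (β * Complex.I) * Complex.exp (α * Complex.I)) := by
    rw [← Complex.exp_add, ← mul_neg_one, ← Complex.exp_pi_mul_I, ← Complex.exp_add]
    congr 1
    push_cast
    ring
  have h2 : Complex.exp (α * Complex.I) = Complex.cos α + Complex.sin α * Complex.I :=
    Complex.exp_mul_I _
  have h3 := Complex.sin_sq_add_cos_sq (α : ℂ)
  unfold chord ray
  rw [h1, h2]
  push_cast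
  linear_combination (-Complex.exp (β * Complex.I)) * h3 +
    Complex.exp (β * Complex.I) * Complex.sin α ^ 2 * Complex.I_sq

lemma norm_sq_ray (θ s τ : ℝ) : ‖ray θ s τ‖ ^ 2 = τ ^ 2 + s ^ 2 := by
  rw [ray, norm_mul, Complex.norm_exp_ofReal_mul_I, one_mul, Complex.sq_norm]
  simp [Complex.normSq_apply]
  ring

/-- The geodesic lies in the open disk exactly for `0 < t < 2 cos α`. -/
lemma chord_mem_ball {β α t : ℝ} (hα : 0 ≤ Real.cos α) :
    chord β α t ∈ ball (0 : ℂ) 1 ↔ t ∈ Set.Ioo 0 (2 * Real.cos α) := by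
  have h1 := norm_sq_ray (β + Real.pi + α) (Real.sin α) (t - Real.cos α)
  have h2 := Real.sin_sq_add_cos_sq α
  have h3 : chord β α t ∈ ball (0 : ℂ) 1 ↔ ‖chord β α t‖ ^ 2 < 1 := by
    rw [mem_ball_zero_iff, sq_lt_one_iff₀ (norm_nonneg _)]
  rw [h3, chord_eq_ray, h1, Set.mem_Ioo]
  constructor
  · intro h
    constructor <;> nlinarith
  · rintro ⟨h4, h5⟩
    nlinarith [mul_pos h4 (sub_pos.2 h5)]

/-- The lines of a fixed direction foliate the plane, preserving Lebesgue measure. -/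
lemma measurePreserving_ray (θ : ℝ) :
    MeasurePreserving (fun x : ℝ × ℝ => ray θ x.1 x.2) (volume.prod volume) volume := by
  have h1 : MeasurePreserving (Prod.swap : ℝ × ℝ → ℝ × ℝ) (volume.prod volume)
      (volume.prod volume) := Measure.measurePreserving_swap
  have h2 := (Complex.volume_preserving_equiv_real_prod.symm Complex.measurableEquivRealProd)
  have h3 := (rotation (Circle.exp θ)).measurePreserving
  suffices h4 : (fun x : ℝ × ℝ => ray θ x.1 x.2) =
      (rotation (Circle.exp θ) ∘ Complex.measurableEquivRealProd.symm) ∘ Prod.swap by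
    rw [h4]
    exact (h3.comp h2).comp h1
  funext x
  simp only [Function.comp_apply, rotation_apply, Circle.coe_exp, ray]
  congr 1
  apply Complex.ext <;> simp [Complex.measurableEquivRealProd]

lemma ae_ray_of_ae (θ : ℝ) {P : ℂ → Prop} (h : ∀ᵐ z, P z) : ∀ᵐ s, ∀ᵐ τ, P (ray θ s τ) :=
  Measure.ae_ae_of_ae_prod ((measurePreserving_ray θ).quasiMeasurePreserving.ae h)

lemma integrable_ray {K : ℂ → ℂ} (hK : Integrable K) (θ : ℝ) :
    ∀ᵐ s, Integrable fun τ => K (ray θ s τ) :=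
  ((measurePreserving_ray θ).integrable_comp_of_integrable hK).prod_right_ae

lemma lintegral_ray {F : ℂ → ENNReal} (hF : Measurable F) (θ : ℝ) :
    ∫⁻ s, ∫⁻ τ, F (ray θ s τ) = ∫⁻ z, F z := by
  rw [← (measurePreserving_ray θ).lintegral_comp hF]
  exact (lintegral_prod _ (hF.comp (measurePreserving_ray θ).measurable).aemeasurable).symm

/-- A property that holds, for every direction, on almost every line of that direction holds
on almost every geodesic in fan-beam coordinates. -/
lemma ae_fanMeasure {γ : ℝ} {S : Set (ℝ × ℝ)} (hS : MeasurableSet S)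
    (h : ∀ θ, ∀ᵐ s, (θ, s) ∈ S) :
    ∀ᵐ w ∂fanMeasure γ, (w.1 + Real.pi + w.2, Real.sin w.2) ∈ S := by
  refine (withDensity_absolutelyContinuous _ _).ae_le ?_
  set A := Set.Icc (-(Real.pi / 2)) (Real.pi / 2)
  have hsub : Set.Ioc 0 (2 * Real.pi) ×ˢ A ⊆ Set.univ ×ˢ A :=
    Set.prod_mono (Set.subset_univ _) le_rfl
  refine ae_restrict_of_ae_restrict_of_subset hsub ?_
  rw [Measure.volume_eq_prod, ← Measure.prod_restrict, Measure.restrict_univ]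
  have hm : Measurable fun w : ℝ × ℝ => (w.1 + Real.pi + w.2, Real.sin w.2) := by fun_prop
  refine (Measure.ae_prod_iff_ae_ae (hm hS)).2 ((Measure.ae_ae_comm (p := fun β α =>
    (β + Real.pi + α, Real.sin α) ∈ S) (hm hS)).2 ?_)
  have h1 : ∀ᵐ s : ℝ, ∀ᵐ θ : ℝ, (θ, s) ∈ S :=
    (Measure.ae_ae_comm (p := fun θ s => (θ, s) ∈ S) hS).1 (Eventually.of_forall h)
  -- `sin` pulls null sets of `ℝ` back to null sets of `[-π/2, π/2]`
  have h2 : ∀ᵐ α ∂volume.restrict A, ∀ᵐ θ : ℝ, (θ, Real.sin α) ∈ S := by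
    set B := {s : ℝ | ¬ ∀ᵐ θ : ℝ, (θ, s) ∈ S}
    have hB : volume (Real.arcsin '' (B ∩ Set.Ioo (-1) 1)) = 0 := by
      refine addHaar_image_eq_zero_of_differentiableOn_of_addHaar_eq_zero _ (fun s hs => ?_)
        (measure_mono_null Set.inter_subset_left h1)
      exact (Real.differentiableAt_arcsin.2 ⟨hs.2.1.ne', hs.2.2.ne⟩).differentiableWithinAt
    have hIoo : (volume.restrict A) = volume.restrict (Set.Ioo (-(Real.pi / 2)) (Real.pi / 2)) :=
      (Measure.restrict_congr_set Ioo_ae_eq_Icc).symm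
    rw [hIoo, ae_restrict_iff' measurableSet_Ioo]
    refine measure_mono_null (fun α hα => ?_) hB
    simp only [Set.mem_compl_iff, Set.mem_ofPred_eq, Classical.not_imp] at hα
    obtain ⟨hI, hα⟩ := hα
    refine ⟨Real.sin α, ⟨hα, ?_, ?_⟩, Real.arcsin_sin hI.1.le hI.2.le⟩
    · simpa using Real.sin_lt_sin_of_lt_of_le_pi_div_two le_rfl hI.2.le hI.1
    · simpa using Real.sin_lt_sin_of_lt_of_le_pi_div_two hI.1.le le_rfl hI.2
  filter_upwards [h2] with α hα
  have := (measurePreserving_add_right (volume : Measure ℝ)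
    (Real.pi + α)).quasiMeasurePreserving.ae hα
  filter_upwards [this] with β hβ
  simpa [add_assoc] using hβ

lemma ae_fanMeasure_cos_nonneg (γ : ℝ) : ∀ᵐ w ∂fanMeasure γ, 0 ≤ Real.cos w.2 := by
  refine (withDensity_absolutelyContinuous _ _).ae_le ?_
  filter_upwards [ae_restrict_mem (measurableSet_Ioc.prod measurableSet_Icc)] with w hw
  exact Real.cos_nonneg_of_mem_Icc hw.2

end Lines

/-! ### Line integrals of `L²_δ` functions -/

section LineIntegrals

open Metric Filter
open scoped Topology

/-- `u d^a` on the open disk, extended by zero. -/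
def cutoff (a : ℝ) (u : ℂ → ℂ) : ℂ → ℂ :=
  (ball (0 : ℂ) 1).indicator fun z => u z * ((bdf z ^ a : ℝ) : ℂ)

/-- The integrals of `u d^a` over the oriented lines, restricted to the disk. -/
def lineInt (a : ℝ) (u : ℂ → ℂ) (θ s : ℝ) : ℂ := ∫ τ, cutoff a u (ray θ s τ)

lemma cutoff_congr_ae {a b δ : ℝ} {u v : ℂ → ℂ}
    (h : ∀ᵐ z ∂diskMeasure δ, u z * ((bdf z ^ a : ℝ) : ℂ) = v z * ((bdf z ^ b : ℝ) : ℂ)) :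
    cutoff a u =ᵐ[volume] cutoff b v := by
  have h1 := (ae_restrict_iff' isOpen_ball.measurableSet).1 ((ae_diskMeasure_iff δ).1 h)
  filter_upwards [h1] with z hz
  by_cases hb : z ∈ ball (0 : ℂ) 1
  · rw [cutoff, cutoff, Set.indicator_of_mem hb, Set.indicator_of_mem hb, hz hb]
  · rw [cutoff, cutoff, Set.indicator_of_notMem hb, Set.indicator_of_notMem hb]

lemma cutoff_congr {a δ : ℝ} {u v : ℂ → ℂ} (h : u =ᵐ[diskMeasure δ] v) :
    cutoff a u =ᵐ[volume] cutoff a v :=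
  cutoff_congr_ae (h.mono fun z hz => by rw [hz])

lemma lineInt_congr {a b : ℝ} {u v : ℂ → ℂ} (h : cutoff a u =ᵐ[volume] cutoff b v) (θ : ℝ) :
    lineInt a u θ =ᵐ[volume] lineInt b v θ :=
  (ae_ray_of_ae θ h).mono fun _ hs => integral_congr_ae hs

lemma stronglyMeasurable_cutoff (a : ℝ) {u : ℂ → ℂ} (hu : StronglyMeasurable u) :
    StronglyMeasurable (cutoff a u) :=
  (hu.mul (Complex.measurable_ofReal.comp (measurable_bdf_rpow a)).stronglyMeasurable).indicator
    isOpen_ball.measurableSet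

section L2

variable {a δ : ℝ} (ha : -1 < 2 * a - δ)

include ha

lemma integrable_cutoff (u : L2 δ) : Integrable (cutoff a u) := integrable_indicator_L2 ha u

lemma lineInt_add (u v : L2 δ) (θ : ℝ) :
    lineInt a (u + v : L2 δ) θ =ᵐ[volume] fun s => lineInt a u θ s + lineInt a v θ s := by
  have h : cutoff a (u + v : L2 δ) =ᵐ[volume] fun z => cutoff a u z + cutoff a v z := by
    refine (cutoff_congr (Lp.coeFn_add u v)).trans (.of_forall fun z => ?_)
    by_cases hz : z ∈ ball (0 : ℂ) 1
    · simp only [cutoff, Set.indicator_of_mem hz, Pi.add_apply, add_mul]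
    · simp only [cutoff, Set.indicator_of_notMem hz, add_zero]
  filter_upwards [ae_ray_of_ae θ h, integrable_ray (integrable_cutoff ha u) θ,
    integrable_ray (integrable_cutoff ha v) θ] with s hs h1 h2
  exact (integral_congr_ae hs).trans (integral_add h1 h2)

omit ha in
lemma lineInt_zero (θ : ℝ) : lineInt a (0 : L2 δ) θ =ᵐ[volume] 0 := by
  have h : cutoff a (0 : L2 δ) =ᵐ[volume] fun _ => (0 : ℂ) := by
    refine (cutoff_congr (Lp.coeFn_zero ℂ 2 (diskMeasure δ))).trans (.of_forall fun z => ?_)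
    simp [cutoff]
  filter_upwards [ae_ray_of_ae θ h] with s hs
  exact (integral_congr_ae hs).trans (integral_zero _ _)

lemma lineInt_sum {ι : Type*} (t : Finset ι) (u : ι → L2 δ) (θ : ℝ) :
    lineInt a (∑ j ∈ t, u j : L2 δ) θ =ᵐ[volume] fun s => ∑ j ∈ t, lineInt a (u j) θ s := by
  classical
  induction t using Finset.induction_on with
  | empty => exact lineInt_zero θ
  | insert j t hj ih =>
    rw [Finset.sum_insert hj]
    filter_upwards [lineInt_add ha (u j) (∑ j ∈ t, u j) θ, ih] with s h1 h2
    rw [h1, h2, Finset.sum_insert hj]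

/-- The functions in `L²_δ` whose integrals over almost all lines of a given direction vanish form
a closed set. -/
lemma isClosed_lineInt_eq_zero (θ : ℝ) :
    IsClosed {u : L2 δ | lineInt a u θ =ᵐ[volume] 0} := by
  obtain ⟨C, hC, hle⟩ := exists_lintegral_le_enorm ha
  have hbound : ∀ u : L2 δ, ∫⁻ s, ‖lineInt a u θ s‖ₑ ≤ ‖u‖ₑ * C := fun u => by
    refine le_trans (lintegral_mono fun s => enorm_integral_le_lintegral_enorm _) ?_
    have hm := (stronglyMeasurable_cutoff a (Lp.stronglyMeasurable u)).measurable.enorm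
    rw [lintegral_ray hm]
    refine le_trans (le_of_eq ?_) (hle u)
    rw [← lintegral_indicator isOpen_ball.measurableSet]
    refine lintegral_congr fun z => ?_
    by_cases hz : z ∈ ball (0 : ℂ) 1
    · rw [cutoff, Set.indicator_of_mem hz, Set.indicator_of_mem hz, enorm_mul]
      congr 1
      rw [← ofReal_norm, Complex.norm_real,
        Real.norm_of_nonneg (Real.rpow_pos_of_pos (bdf_pos hz) _).le]
    · rw [cutoff, Set.indicator_of_notMem hz, Set.indicator_of_notMem hz, enorm_zero]
  refine isClosed_of_closure_subset fun u hu => ?_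
  obtain ⟨v, hv, hlim⟩ := mem_closure_iff_seq_limit.1 hu
  have h1 : ∀ n, ∫⁻ s, ‖lineInt a u θ s‖ₑ ≤ ‖u - v n‖ₑ * C := fun n => by
    refine le_trans (le_of_eq (lintegral_congr_ae ?_)) (hbound (u - v n))
    have := lineInt_add ha (u - v n) (v n) θ
    rw [sub_add_cancel] at this
    filter_upwards [this, hv n] with s h2 h3
    rw [h2, h3, Pi.zero_apply, add_zero]
  have h2 : Tendsto (fun n => ‖u - v n‖ₑ * C) atTop (𝓝 0) := by
    have h3 : Tendsto (fun n => u - v n) atTop (𝓝 0) := by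
      simpa using (tendsto_const_nhds (x := u)).sub hlim
    have h4 := ENNReal.Tendsto.mul_const (b := C) h3.enorm (Or.inr hC)
    simpa using h4
  have h3 : ∫⁻ s, ‖lineInt a u θ s‖ₑ = 0 := le_antisymm (ge_of_tendsto' h2 h1) zero_le
  have hm : StronglyMeasurable fun s => lineInt a u θ s := by
    refine StronglyMeasurable.integral_prod_right (f := fun s τ => cutoff a u (ray θ s τ)) ?_
    exact (stronglyMeasurable_cutoff a (Lp.stronglyMeasurable u)).comp_measurable
      (measurePreserving_ray θ).measurable
  rw [lintegral_eq_zero_iff hm.measurable.enorm] at h3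
  filter_upwards [h3] with s hs
  simpa using hs

end L2

lemma hasDerivAt_ray (θ s τ : ℝ) :
    HasDerivAt (fun τ : ℝ => ray θ s τ) (Complex.exp (θ * Complex.I)) τ := by
  have h : HasDerivAt (fun τ : ℝ => ((τ : ℂ) + s * Complex.I)) 1 τ :=
    (Complex.ofRealCLM.hasDerivAt (x := τ)).add_const _
  simpa [ray] using h.const_mul (Complex.exp (θ * Complex.I))

/-- The directional derivative of a test function integrates to zero over every line of that
direction. -/
lemma integral_ray_fderiv {φ : ℂ → ℂ} (hφ : ContDiff ℝ (⊤ : ℕ∞) φ) (hc : HasCompactSupport φ)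
    (θ s : ℝ) : ∫ τ, fderiv ℝ φ (ray θ s τ) (Complex.exp (θ * Complex.I)) = 0 := by
  have hemb : Topology.IsClosedEmbedding fun τ : ℝ => ray θ s τ := by
    refine Isometry.isClosedEmbedding (Isometry.of_dist_eq fun x y => ?_)
    rw [dist_eq_norm, dist_eq_norm, ray, ray, ← mul_sub, norm_mul,
      Complex.norm_exp_ofReal_mul_I, one_mul, add_sub_add_right_eq_sub, ← Complex.ofReal_sub,
      Complex.norm_real]
  have hcont : Continuous fun τ : ℝ => ray θ s τ := hemb.continuous
  refine integral_eq_zero_of_hasDerivAt_of_integrable (f := fun τ => φ (ray θ s τ)) (fun τ => ?_)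
    ?_ ?_
  · exact ((hφ.differentiable (by simp)) _).hasFDerivAt.comp_hasDerivAt τ (hasDerivAt_ray θ s τ)
  · refine Continuous.integrable_of_hasCompactSupport ?_ ?_
    · exact ((hφ.continuous_fderiv (by simp)).comp hcont).clm_apply continuous_const
    · exact ((hc.fderiv_apply ℝ _).comp_isClosedEmbedding hemb)
  · exact (hφ.continuous.comp hcont).integrable_of_hasCompactSupport
      (hc.comp_isClosedEmbedding hemb)

lemma coordVec_combination (θ : ℝ) :
    Complex.exp (θ * Complex.I) = Real.cos θ • coordVec 0 + Real.sin θ • coordVec 1 := by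
  rw [Complex.exp_mul_I, ← Complex.ofReal_cos, ← Complex.ofReal_sin]
  simp [coordVec]

/-- For `u ∈ H₀^{1,δ}` and `δ < 1`, the derivative of `u` in the direction `e^{iθ}` integrates to
zero over almost every line of that direction. -/
lemma lineInt_pderiv {δ : ℝ} (hδ : δ < 1) (u : H01 δ) (θ : ℝ) :
    lineInt 0 (((Real.cos θ : ℝ) : ℂ) • H01.pderiv 0 u +
      ((Real.sin θ : ℝ) : ℂ) • H01.pderiv 1 u : L2 δ) θ =ᵐ[volume] 0 := by
  let D : L2 δ × (Fin 2 → L2 δ) → L2 δ := fun w =>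
    ((Real.cos θ : ℝ) : ℂ) • w.2 0 + ((Real.sin θ : ℝ) : ℂ) • w.2 1
  have hD : Continuous D := by fun_prop
  have hcl := (isClosed_lineInt_eq_zero (a := 0) (δ := δ) (by linarith) θ).preimage hD
  refine closure_minimal ?_ hcl (show u.1 ∈ closure (testPairs δ : Set _) from u.2)
  rintro w ⟨φ, hφ, hc, hs, -, h2⟩
  have h : cutoff 0 (D w) =ᵐ[volume]
      fun z => fderiv ℝ φ z (Complex.exp (θ * Complex.I)) := by
    have h1 : D w =ᵐ[diskMeasure δ] fun z => fderiv ℝ φ z (Complex.exp (θ * Complex.I)) := by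
      filter_upwards [Lp.coeFn_add (((Real.cos θ : ℝ) : ℂ) • w.2 0) (((Real.sin θ : ℝ) : ℂ) • w.2 1),
        Lp.coeFn_smul ((Real.cos θ : ℝ) : ℂ) (w.2 0), Lp.coeFn_smul ((Real.sin θ : ℝ) : ℂ) (w.2 1),
        h2 0, h2 1] with z e1 e2 e3 e4 e5
      rw [e1, Pi.add_apply, e2, e3, Pi.smul_apply, Pi.smul_apply, e4, e5, coordVec_combination,
        map_add, map_smul, map_smul]
      simp
    refine (cutoff_congr h1).trans (.of_forall fun z => ?_)
    by_cases hz : z ∈ ball (0 : ℂ) 1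
    · simp [cutoff, Set.indicator_of_mem hz]
    · rw [cutoff, Set.indicator_of_notMem hz]
      have h0 : fderiv ℝ φ z = 0 :=
        image_eq_zero_of_notMem_tsupport fun h => hz (hs (tsupport_fderiv_subset ℝ h))
      simp [h0]
  refine (ae_ray_of_ae θ h).mono fun s hs => ?_
  exact (integral_congr_ae hs).trans (integral_ray_fderiv hφ hc θ s)

end LineIntegrals

/-! ### The X-ray transform of tensor fields -/

section Xray

open Metric Filter

/-- The components of the unit vector of direction `θ`. -/
def dirVec (θ : ℝ) : Fin 2 → ℂ := fun i => ((![Real.cos θ, Real.sin θ] i : ℝ) : ℂ)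

section PolyEval

variable {V : Type*} [AddCommGroup V] [Module ℂ V]

lemma polyEval_add {m : ℕ} (S T : (Fin m → Fin 2) → V) (v : Fin 2 → ℂ) :
    polyEval (S + T) v = polyEval S v + polyEval T v := by
  simp [polyEval, Finset.sum_add_distrib]

lemma polyEval_map {W : Type*} [AddCommGroup W] [Module ℂ W] (A : V →ₗ[ℂ] W) {m : ℕ}
    (T : (Fin m → Fin 2) → V) (v : Fin 2 → ℂ) :
    polyEval (fun I => A (T I)) v = A (polyEval T v) := by
  simp [polyEval]

lemma polyEval_sum {ι : Type*} (t : Finset ι) {m : ℕ} (T : ι → SymTensor m V) (v : Fin 2 → ℂ) :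
    polyEval (∑ j ∈ t, T j : SymTensor m V).1 v = ∑ j ∈ t, polyEval (T j).1 v := by
  classical
  induction t using Finset.induction_on with
  | empty => simp [polyEval]
  | insert j t hj ih =>
    rw [Finset.sum_insert hj, Finset.sum_insert hj, ← ih]
    exact polyEval_add _ _ v

lemma polyEval_cast {m n : ℕ} (h : m = n) (T : SymTensor m V) (v : Fin 2 → ℂ) :
    polyEval (SymTensor.cast h T).1 v = polyEval T.1 v := by
  subst h
  rfl

/-- The factor `g(v, v)` from `L` equals `1` on unit vectors. -/
lemma polyEval_metricMulPow {m : ℕ} (T : SymTensor m V) (k : ℕ) (θ : ℝ) :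
    polyEval (metricMulPow T k).1 (dirVec θ) = polyEval T.1 (dirVec θ) := by
  induction k with
  | zero => rfl
  | succ k ih =>
    have h : dirVec θ 0 ^ 2 + dirVec θ 1 ^ 2 = 1 := by
      simp only [dirVec, Matrix.cons_val_zero, Matrix.cons_val_one]
      exact_mod_cast Real.cos_sq_add_sin_sq θ
    rw [← ih, ← one_smul ℂ (polyEval (metricMulPow T k).1 (dirVec θ)), ← h]
    exact polyEval_metricMul _ _

end PolyEval

variable {a γ δ : ℝ} {m n : ℕ}

lemma polyEval_tensorWeightMul (T : TensorL2 (-γ) m) (v : Fin 2 → ℂ) :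
    polyEval (tensorWeightMul γ T).1 v = weightMul γ (polyEval T.1 v) :=
  polyEval_map (weightIso γ).toLinearMap T.1 v

lemma polyEval_innerDeriv (q : TensorH01 δ m) (v : Fin 2 → ℂ) :
    polyEval (innerDeriv q).1 v =
      v 0 • H01.pderiv 0 (polyEval q.1 v) + v 1 • H01.pderiv 1 (polyEval q.1 v) := by
  let P (i : Fin 2) : H01 δ →ₗ[ℂ] L2 δ :=
    LinearMap.proj i ∘ₗ LinearMap.snd ℂ _ _ ∘ₗ (H01 δ).subtype
  rw [innerDeriv, polyEval_symmetrize, polyEval_succ]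
  exact congrArg₂ (fun x y => v 0 • x + v 1 • y) (polyEval_map (P 0) q.1 v)
    (polyEval_map (P 1) q.1 v)

/-- For a fixed direction, `f(v, …, v)` is the `L²` function `polyEval f.1 v`. The exceptional null
set may depend on the direction. -/
lemma ell_ae_eq (f : TensorL2 δ m) (θ : ℝ) :
    (fun z => ell f z θ) =ᵐ[diskMeasure δ] (polyEval f.1 (dirVec θ) : L2 δ) := by
  classical
  have h : ∀ t : Finset (Fin m → Fin 2), (fun z => ∑ I ∈ t, f.1 I z * ∏ k, dirVec θ (I k))
      =ᵐ[diskMeasure δ] (∑ I ∈ t, (∏ k, dirVec θ (I k)) • f.1 I : L2 δ) := fun t => by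
    induction t using Finset.induction_on with
    | empty =>
      filter_upwards [Lp.coeFn_zero ℂ 2 (diskMeasure δ)] with z hz
      exact hz.symm
    | insert I t hI ih =>
      rw [Finset.sum_insert hI]
      filter_upwards [ih, Lp.coeFn_add ((∏ k, dirVec θ (I k)) • f.1 I)
        (∑ I ∈ t, (∏ k, dirVec θ (I k)) • f.1 I), Lp.coeFn_smul (∏ k, dirVec θ (I k)) (f.1 I)]
        with z h1 h2 h3
      rw [Finset.sum_insert hI, h2, Pi.add_apply, h3, ← h1, Pi.smul_apply, smul_eq_mul, mul_comm]
  exact h Finset.univ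

lemma cutoff_ell (a : ℝ) (f : TensorL2 δ m) (θ : ℝ) (z : ℂ) :
    cutoff a (fun z => ell f z θ) z =
      ∑ I : Fin m → Fin 2, cutoff a (f.1 I) z * ∏ k, dirVec θ (I k) := by
  by_cases hz : z ∈ ball (0 : ℂ) 1
  · simp only [cutoff, Set.indicator_of_mem hz, ell, dirVec, Finset.sum_mul]
    exact Finset.sum_congr rfl fun I _ => by ring
  · simp only [cutoff, Set.indicator_of_notMem hz, zero_mul, Finset.sum_const_zero]

lemma stronglyMeasurable_cutoff_ell (a : ℝ) (f : TensorL2 δ m) :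
    StronglyMeasurable fun x : (ℝ × ℝ) × ℝ =>
      cutoff a (fun z => ell f z x.1.1) (ray x.1.1 x.1.2 x.2) := by
  simp only [cutoff_ell]
  refine Finset.stronglyMeasurable_fun_sum _ fun I _ => StronglyMeasurable.mul ?_ ?_
  · exact (stronglyMeasurable_cutoff a (Lp.stronglyMeasurable (f.1 I))).comp_measurable
      continuous_ray.measurable
  · have h : ∀ i, Continuous fun x : (ℝ × ℝ) × ℝ => dirVec x.1.1 i := fun i => by
      fin_cases i <;> simp [dirVec] <;> fun_prop
    exact (continuous_finsetProd _ fun k _ => h (I k)).stronglyMeasurable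

lemma stronglyMeasurable_lineInt_ell (a : ℝ) (f : TensorL2 δ m) :
    StronglyMeasurable fun x : ℝ × ℝ => lineInt a (fun z => ell f z x.1) x.1 x.2 :=
  (stronglyMeasurable_cutoff_ell a f).integral_prod_right'

lemma cutoff_chord (a : ℝ) (f : TensorL2 δ m) {β α : ℝ} (hα : 0 ≤ Real.cos α) (t : ℝ) :
    cutoff a (fun z => ell f z (β + Real.pi + α))
        (ray (β + Real.pi + α) (Real.sin α) (t - Real.cos α)) =
      (Set.Ioo 0 (2 * Real.cos α)).indicator (xrayIntegrand a f β α) t := by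
  rw [← chord_eq_ray]
  by_cases ht : t ∈ Set.Ioo 0 (2 * Real.cos α)
  · rw [Set.indicator_of_mem ht, cutoff, Set.indicator_of_mem ((chord_mem_ball hα).2 ht)]
    rfl
  · rw [Set.indicator_of_notMem ht, cutoff,
      Set.indicator_of_notMem fun h => ht ((chord_mem_ball hα).1 h)]

/-- The geodesic with fan-beam coordinates `(β, α)` is the chord cut out of the oriented line of
direction `β + π + α` at signed distance `sin α` from the origin. -/
lemma xray_eq_lineInt (a : ℝ) (f : TensorL2 δ m) {w : ℝ × ℝ} (hw : 0 ≤ Real.cos w.2) :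
    xray a f w = lineInt a (fun z => ell f z (w.1 + Real.pi + w.2)) (w.1 + Real.pi + w.2)
      (Real.sin w.2) := by
  rw [xray, intervalIntegral.integral_of_le (by linarith), integral_Ioc_eq_integral_Ioo,
    ← integral_indicator measurableSet_Ioo, lineInt]
  simp only [← cutoff_chord a f hw]
  exact integral_sub_right_eq_self (fun τ => cutoff a (fun z => ell f z (w.1 + Real.pi + w.2))
    (ray (w.1 + Real.pi + w.2) (Real.sin w.2) τ)) _

lemma lineInt_ell (a : ℝ) (f : TensorL2 δ m) (θ : ℝ) :
    lineInt a (fun z => ell f z θ) θ =ᵐ[volume] lineInt a (polyEval f.1 (dirVec θ) : L2 δ) θ :=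
  lineInt_congr (cutoff_congr (ell_ae_eq f θ)) θ

/-- The X-ray transform with weight `d^a` of a tensor field in `L²_δ` converges absolutely along
almost every geodesic when `2a - δ > -1`. -/
lemma xrayConverges (ha : -1 < 2 * a - δ) (f : TensorL2 δ m) : XrayConverges a f := by
  let S := {x : ℝ × ℝ | Integrable fun τ => cutoff a (fun z => ell f z x.1) (ray x.1 x.2 τ)}
  have hS : MeasurableSet S := measurableSet_integrable
    (f := fun (x : ℝ × ℝ) τ => cutoff a (fun z => ell f z x.1) (ray x.1 x.2 τ))
    (stronglyMeasurable_cutoff_ell a f)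
  have h : ∀ θ, ∀ᵐ s, (θ, s) ∈ S := fun θ => integrable_ray
    ((integrable_cutoff ha (polyEval f.1 (dirVec θ))).congr (cutoff_congr (ell_ae_eq f θ)).symm) θ
  filter_upwards [ae_fanMeasure hS h, ae_fanMeasure_cos_nonneg δ] with w hw hcos
  rw [intervalIntegrable_iff_integrableOn_Ioo_of_le (by linarith),
    ← integrable_indicator_iff measurableSet_Ioo]
  refine (Integrable.comp_sub_right hw (Real.cos w.2)).congr (.of_forall fun t => ?_)
  exact cutoff_chord a f hcos t

/-- An identity between line integrals that holds on almost every line of each direction gives an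
identity between X-ray transforms. -/
lemma xray_ae_eq_of_lineInt {ι : Type*} [Fintype ι] {b : ι → ℝ} {c : ι → ℝ} {r : ι → ℕ}
    (f : TensorL2 δ m) (g : (j : ι) → TensorL2 (c j) (r j))
    (h : ∀ θ, ∀ᵐ s, lineInt a (polyEval f.1 (dirVec θ) : L2 δ) θ s =
      ∑ j, lineInt (b j) (polyEval (g j).1 (dirVec θ) : L2 (c j)) θ s) :
    xray a f =ᵐ[fanMeasure γ] fun w => ∑ j, xray (b j) (g j) w := by
  let S := {x : ℝ × ℝ | lineInt a (fun z => ell f z x.1) x.1 x.2 =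
    ∑ j, lineInt (b j) (fun z => ell (g j) z x.1) x.1 x.2}
  have hS : MeasurableSet S := StronglyMeasurable.measurableSet_eq_fun
    (stronglyMeasurable_lineInt_ell a f)
    (Finset.stronglyMeasurable_fun_sum _ fun j _ => stronglyMeasurable_lineInt_ell (b j) (g j))
  have h' : ∀ θ, ∀ᵐ s, (θ, s) ∈ S := fun θ => by
    have h2 : ∀ᵐ s, ∀ j, lineInt (b j) (fun z => ell (g j) z θ) θ s =
        lineInt (b j) (polyEval (g j).1 (dirVec θ) : L2 (c j)) θ s :=
      ae_all_iff.2 fun j => lineInt_ell (b j) (g j) θ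
    filter_upwards [h θ, lineInt_ell a f θ, h2] with s e1 e2 e3
    change lineInt a (fun z => ell f z θ) θ s = ∑ j, lineInt (b j) (fun z => ell (g j) z θ) θ s
    rw [e2, e1]
    exact Finset.sum_congr rfl fun j _ => (e3 j).symm
  filter_upwards [ae_fanMeasure hS h', ae_fanMeasure_cos_nonneg γ] with w hw hcos
  rw [xray_eq_lineInt a f hcos]
  refine Eq.trans hw (Finset.sum_congr rfl fun j _ => ?_)
  rw [xray_eq_lineInt _ _ hcos]

lemma xray_sum (ha : -1 < 2 * a - δ) {ι : Type*} [Fintype ι] {r : ι → ℕ} (f : TensorL2 δ m)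
    (g : (j : ι) → TensorL2 δ (r j))
    (h : ∀ θ, polyEval f.1 (dirVec θ) = ∑ j, polyEval (g j).1 (dirVec θ)) :
    xray a f =ᵐ[fanMeasure γ] fun w => ∑ j, xray a (g j) w :=
  xray_ae_eq_of_lineInt f g fun θ => by
    rw [h θ]
    exact lineInt_sum ha _ _ θ

lemma xray_add (ha : -1 < 2 * a - δ) {r s : ℕ} (f : TensorL2 δ m) (g : TensorL2 δ r)
    (k : TensorL2 δ s)
    (h : ∀ θ, polyEval f.1 (dirVec θ) = polyEval g.1 (dirVec θ) + polyEval k.1 (dirVec θ)) :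
    xray a f =ᵐ[fanMeasure γ] fun w => xray a g w + xray a k w := by
  let F : (j : Fin 2) → TensorL2 δ (![r, s] j) := Fin.cons g (Fin.cons k finZeroElim)
  refine (xray_sum ha f F fun θ => ?_).trans (.of_forall fun w => ?_)
  · rw [h θ, Fin.sum_univ_two]
    rfl
  · simp only [Fin.sum_univ_two]
    rfl

lemma lineInt_weightMul (u : L2 (-γ)) (θ : ℝ) :
    lineInt γ (weightMul γ u) θ =ᵐ[volume] lineInt 0 u θ := by
  refine lineInt_congr (cutoff_congr_ae (δ := γ) ?_) θ
  filter_upwards [coeFn_weightMul γ u, ae_mem_ball γ] with z hz hb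
  have h : bdf z ^ (-γ) * bdf z ^ γ = 1 := by
    rw [← Real.rpow_add (bdf_pos hb), neg_add_cancel, Real.rpow_zero]
  have h' : ((bdf z ^ (-γ) : ℝ) : ℂ) * ((bdf z ^ γ : ℝ) : ℂ) = 1 := by exact_mod_cast h
  rw [hz, Real.rpow_zero, Complex.ofReal_one]
  linear_combination u z * h'

lemma xray_tensorWeightMul (k : TensorL2 (-γ) m) :
    xray γ (tensorWeightMul γ k) =ᵐ[fanMeasure δ] xray 0 k := by
  refine (xray_ae_eq_of_lineInt (ι := Unit) (b := fun _ => 0) (c := fun _ => -γ) (r := fun _ => m)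
    (tensorWeightMul γ k) (fun _ => k) fun θ => ?_).trans (.of_forall fun w => ?_)
  · simp only [Finset.univ_unique, Finset.sum_singleton]
    rw [polyEval_tensorWeightMul]
    exact lineInt_weightMul _ θ
  · simp

/-- The X-ray transform annihilates the potential tensors `d^{-γ} d^s q`: along a geodesic the
integrand is the derivative of `q(v, …, v)`. -/
lemma xray_innerDeriv (hγ : -1 < γ) (q : TensorH01 (-γ) m) :
    xray γ (tensorWeightMul γ (innerDeriv q)) =ᵐ[fanMeasure δ] 0 := by
  refine (xray_ae_eq_of_lineInt (ι := Empty) (b := fun _ => 0) (c := fun _ => 0) (r := fun _ => 0)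
    (tensorWeightMul γ (innerDeriv q)) (fun j => j.elim) fun θ => ?_).trans
    (.of_forall fun w => ?_)
  · rw [polyEval_tensorWeightMul, polyEval_innerDeriv]
    filter_upwards [lineInt_weightMul (γ := γ) (dirVec θ 0 • H01.pderiv 0 (polyEval q.1 (dirVec θ)) +
      dirVec θ 1 • H01.pderiv 1 (polyEval q.1 (dirVec θ))) θ,
      lineInt_pderiv (by linarith) (polyEval q.1 (dirVec θ)) θ] with s h1 h2
    rw [h1, Finset.univ_eq_empty, Finset.sum_empty]
    exact h2
  · simp

/-- Potential tensors do not change the X-ray transform. -/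
lemma xray_add_potential (hγ : -1 < γ) (h : m + 1 = n) (q : TensorH01 (-γ) m)
    {f g : TensorL2 γ n} (hf : f = SymTensor.cast h (tensorWeightMul γ (innerDeriv q)) + g) :
    xray γ f =ᵐ[fanMeasure γ] xray γ g := by
  have h1 := xray_add (γ := γ) (a := γ) (by linarith) f (tensorWeightMul γ (innerDeriv q)) g
    fun θ => by
      rw [hf, ← polyEval_cast h]
      exact polyEval_add _ _ _
  filter_upwards [h1, xray_innerDeriv hγ q] with w e1 e2
  rw [e1, e2, Pi.zero_apply, zero_add]

lemma xray_ittEven (hγ : -1 < γ) {p : ℕ} (ft : (j : Fin (p + 1)) → TensorL2 γ (2 * j)) :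
    xray γ (ittEven p ft) =ᵐ[fanMeasure γ] fun w => ∑ j, xray γ (ft j) w :=
  xray_sum (by linarith) _ ft fun θ => by
    rw [ittEven, polyEval_sum]
    exact Finset.sum_congr rfl fun j _ => by rw [polyEval_cast, polyEval_metricMulPow]

lemma xray_ittOdd (hγ : -1 < γ) {p : ℕ} (h : H01 (-γ))
    (ft : (j : Fin (p + 1)) → TensorL2 γ (2 * j + 1)) :
    xray γ (ittOdd p h ft) =ᵐ[fanMeasure γ]
      fun w => xray 0 (starDeriv h) w + ∑ j, xray γ (ft j) w := by
  let g : TensorL2 γ (2 * p + 1) :=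
    ∑ j : Fin (p + 1), SymTensor.cast (by omega) (metricMulPow (ft j) (p - j))
  have h1 := xray_add (γ := γ) (a := γ) (by linarith) (ittOdd p h ft)
    (tensorWeightMul γ (starDeriv h)) g fun θ => by
      rw [← polyEval_metricMulPow (tensorWeightMul γ (starDeriv h)) p,
        ← polyEval_cast (show 1 + 2 * p = 2 * p + 1 by omega)]
      exact polyEval_add _ _ _
  have h2 : xray γ g =ᵐ[fanMeasure γ] fun w => ∑ j, xray γ (ft j) w :=
    xray_sum (by linarith) _ ft fun θ => by
      rw [polyEval_sum]
      exact Finset.sum_congr rfl fun j _ => by rw [polyEval_cast, polyEval_metricMulPow]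
  filter_upwards [h1, h2, xray_tensorWeightMul (γ := γ) (δ := γ) (starDeriv h)] with w e1 e2 e3
  rw [e1, e2, e3]

end Xray

end

end WeightedXray

theorem corollary2p3 (γ : ℝ) (hγ : γ ∈ Set.Ioo (-1 : ℝ) 1) :
    (∀ (p : ℕ) (hp : 1 ≤ p) (f : TensorL2 γ (2 * p)),
      (∃! c : TensorH01 (-γ) (2 * p - 1) × ((j : Fin (p + 1)) → TensorL2 γ (2 * j)),
        IsDecompEven hp f c.1 c.2) ∧
      ∀ (q : TensorH01 (-γ) (2 * p - 1)) (ft : (j : Fin (p + 1)) → TensorL2 γ (2 * j)),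
        IsDecompEven hp f q ft →
          XrayConverges γ f ∧ XrayConverges γ (ittEven p ft) ∧ (∀ j, XrayConverges γ (ft j)) ∧
          xray γ f =ᵐ[fanMeasure γ] xray γ (ittEven p ft) ∧
          xray γ (ittEven p ft) =ᵐ[fanMeasure γ] fun w => ∑ j, xray γ (ft j) w) ∧
    (∀ (p : ℕ) (f : TensorL2 γ (2 * p + 1)),
      (∃! c : TensorH01 (-γ) (2 * p) × H01 (-γ) × ((j : Fin (p + 1)) → TensorL2 γ (2 * j + 1)),
        IsDecompOdd f c.1 c.2.1 c.2.2) ∧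
      ∀ (q : TensorH01 (-γ) (2 * p)) (h : H01 (-γ))
        (ft : (j : Fin (p + 1)) → TensorL2 γ (2 * j + 1)),
        IsDecompOdd f q h ft →
          XrayConverges γ f ∧ XrayConverges γ (ittOdd p h ft) ∧ XrayConverges 0 (starDeriv h) ∧
          (∀ j, XrayConverges γ (ft j)) ∧
          xray γ f =ᵐ[fanMeasure γ] xray γ (ittOdd p h ft) ∧
          xray γ (ittOdd p h ft) =ᵐ[fanMeasure γ]
            fun w => xray 0 (starDeriv h) w + ∑ j, xray γ (ft j) w) := by
  have h1 : -1 < 2 * γ - γ := by linarith [hγ.1]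
  have h2 : -1 < 2 * 0 - -γ := by linarith [hγ.1]
  refine ⟨fun p hp f => ⟨?_, fun q ft hd => ?_⟩, fun p f => ⟨?_, fun q h ft hd => ?_⟩⟩
  · obtain ⟨q, ft, hd⟩ := exists_decompEven hγ hp f
    refine ⟨(q, ft), hd, fun c hc => ?_⟩
    obtain ⟨e1, e2⟩ := decompEven_unique hγ hp hc hd
    exact Prod.ext e1 e2
  · exact ⟨xrayConverges h1 f, xrayConverges h1 _, fun j => xrayConverges h1 _,
      xray_add_potential hγ.1 _ q hd.2, xray_ittEven hγ.1 ft⟩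
  · obtain ⟨q, h, ft, hd⟩ := exists_decompOdd hγ f
    refine ⟨(q, h, ft), hd, fun c hc => ?_⟩
    obtain ⟨e1, e2, e3⟩ := decompOdd_unique hγ hc hd
    exact Prod.ext e1 (Prod.ext e2 e3)
  · exact ⟨xrayConverges h1 f, xrayConverges h1 _, xrayConverges h2 _,
      fun j => xrayConverges h1 _, xray_add_potential hγ.1 rfl q hd.2, xray_ittOdd hγ.1 h ft⟩
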